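/- Let $n\ge 1$, $m\ge 0$, and let $W_n=\{(w_{ij},w_{ijk},w_{ijkl})\in(\mathbb R^n)^{\otimes 2}\times(\mathbb R^n)^{\otimes 3}\times(\mathbb R^n)^{\otimes 4} : \det(w_{ij})\ne 0\}$ and $Y^m_n=W_n\times(\mathbb R^n)^{\otimes m}\times(\mathbb R^n)^{\otimes(m+1)}$, with coordinates $(w_{ij},w_{ijk},w_{ijkl},y_I,y_{Ij})$. Let $L:Y^m_n\to\mathbb R$ be a smooth function such that $D_uD_vD_wL=0$ on $Y^m_n$ for all $u,v,w\in 0\times(\mathbb R^n)^{\otimes3}\times(\mathbb R^n)^{\otimes4}\times(\mathbb R^n)^{\otimes m}\times(\mathbb R^n)^{\otimes(m+1)}$. Suppose that for every triple $(M^n,g,D)$, where $M$ is a smooth $n$-manifold, $g$ a smooth Lorentz metric (signature $(-1,1,\dots,1)$) and $D$ a smooth $(0,m)$-tensor field on $M$, there is $f_{g,D}\in C^\infty(M)$ such that $$L(g_{ij},g_{ij,k},g_{ij,kl},D_I,D_{I,j})=f_{g,D}$$ in every coordinate chart on $M$, where commas denote partial derivatives. Then there are constants $a,b,c\in\mathbb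 R$ and functions $\mu^{IJ},\lambda^I,\beta^{Ij}$, smooth on the set of arrays $(w_{ij})$ with $\det(w_{ij})\ne0$, all depending only on $L$, such that for every triple $(M,g,D)$ the following expressions do not depend on the coordinate chart in which they are computed: the function $Q_g(D)=\mu^{IJ}(g_{ab})D_ID_J$, the function $T_g(D)=\lambda^I(g_{ab})D_I$, and the vector field $X_g(D)$ with components $X^j=\beta^{Ij}(g_{ab})D_I$; and, with $Bd_g(D)=\operatorname{div}_g X_g(D)$, $$f_{g,D}=a+bR_g+c\,|d\gamma|_g^2+Q_g(D)+T_g(D)+Bd_g(D).$$ Here $R_g$ is the scalar curvature, $d\gamma$ is the exterior derivative of the $m$-form $\gamma_{i_1\cdots i_m}=\frac1{m!}\sum_{\sigma\in S_m}\operatorname{sgn}(\sigma)D_{i_{\sigma(1)}\cdots i_{\sigma(m)}}$, and $|d\gamma|_g^2=g^{i_0j_0}\cdots g^{i_mj_m}(d\gamma)_{i_0\cdots i_m}(d\gamma)_{j_0\cdots j_m}$. -/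

import Mathlib

open scoped Manifold ContDiff

universe u

namespace LorentzLagrangian

/-- The model space `ℝⁿ`. -/
abbrev E (n : ℕ) : Type := EuclideanSpace ℝ (Fin n)

/-- The `k`-th standard basis vector of `ℝⁿ`. -/
noncomputable def basisVec {n : ℕ} (k : Fin n) : E n := EuclideanSpace.single k (1 : ℝ)

/-- The partial derivative `∂φ/∂xᵏ` of a function on `ℝⁿ`. -/
noncomputable def partialD {n : ℕ} (k : Fin n) (φ : E n → ℝ) : E n → ℝ :=
  fun x => fderiv ℝ φ x (basisVec k)

/-! ### The domain of the Lagrangians -/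

/-- `(w_ij, w_ijk, w_ijkl, y_I, y_Ij)`, with `I` a multi-index of length `m`. -/
abbrev JetSpace (n m : ℕ) : Type :=
  (Fin n → Fin n → ℝ) × (Fin n → Fin n → Fin n → ℝ) × (Fin n → Fin n → Fin n → Fin n → ℝ) ×
    ((Fin m → Fin n) → ℝ) × ((Fin m → Fin n) → Fin n → ℝ)

/-- The arrays `w_ij` with nonvanishing determinant. -/
def nondegenerate (n : ℕ) : Set (Fin n → Fin n → ℝ) :=
  {w | (Matrix.of w).det ≠ 0}

/-- The open subset `Y_n^m` of the jet space, on which `w_ij` is nondegenerate. -/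
def jetDomain (n m : ℕ) : Set (JetSpace n m) :=
  {y | y.1 ∈ nondegenerate n}

/-- `D_u D_v D_w L = 0` on the domain, for all directions `u, v, w` along which `w_ij` is
constant. -/
def IsQuadraticInDerivatives {n m : ℕ} (L : JetSpace n m → ℝ) : Prop :=
  ∀ y ∈ jetDomain n m, ∀ u v w : JetSpace n m, u.1 = 0 → v.1 = 0 → w.1 = 0 →
    lineDeriv ℝ (fun y₁ => lineDeriv ℝ (fun y₂ => lineDeriv ℝ L y₂ w) y₁ v) y u = 0

/-! ### Tensor fields on a manifold and their coordinate expressions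

A coordinate chart is an element `e` of the maximal smooth atlas, and coordinate expressions are
functions of the coordinates `x ∈ e.target`. -/

section Manifold

variable {n m : ℕ} {M : Type*} [TopologicalSpace M] [ChartedSpace (E n) M]

/-- The coordinate charts of the smooth manifold `M`. -/
abbrev charts (n : ℕ) (M : Type*) [TopologicalSpace M] [ChartedSpace (E n) M] :
    Set (OpenPartialHomeomorph M (E n)) :=
  IsManifold.maximalAtlas (𝓡 n) ∞ M

/-- Tensor fields of type `(0,m)`, not necessarily smooth. -/
abbrev TensorField (n m : ℕ) (M : Type*) [TopologicalSpace M] [ChartedSpace (E n) M] : Type _ :=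
  (p : M) → ContinuousMultilinearMap ℝ (fun _ : Fin m => TangentSpace (𝓡 n) p) ℝ

/-- Vector fields, not necessarily smooth. -/
abbrev VectorField (n : ℕ) (M : Type*) [TopologicalSpace M] [ChartedSpace (E n) M] : Type _ :=
  (p : M) → TangentSpace (𝓡 n) p

/-- The expression of a tensor field in a chart: its pull-back by the inverse of the chart. -/
noncomputable def inChart (e : OpenPartialHomeomorph M (E n)) (T : TensorField n m M) (x : E n) :
    ContinuousMultilinearMap ℝ (fun _ : Fin m => E n) ℝ :=
  (T (e.symm x)).compContinuousLinearMap (fun _ => mfderiv (𝓡 n) (𝓡 n) e.symm x)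

/-- The component `T_I = T(∂_{i₁}, …, ∂_{i_m})` in a chart. -/
noncomputable def tensorComp (e : OpenPartialHomeomorph M (E n)) (T : TensorField n m M)
    (I : Fin m → Fin n) (x : E n) : ℝ :=
  inChart e T x (fun a => basisVec (I a))

/-- The component `X^j` of a vector field in a chart. -/
noncomputable def vecComp (e : OpenPartialHomeomorph M (E n)) (X : VectorField n M)
    (j : Fin n) (x : E n) : ℝ :=
  EuclideanSpace.proj (𝕜 := ℝ) j (mfderiv (𝓡 n) (𝓡 n) e (e.symm x) (X (e.symm x)))

/-- A tensor field is smooth if its expression in each coordinate chart is smooth. -/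
def IsSmooth (T : TensorField n m M) : Prop :=
  ∀ e ∈ charts n M, ContDiffOn ℝ ∞ (inChart e T) e.target

/-- `diag(-1, 1, …, 1)`. -/
def minkowski {n : ℕ} (i j : Fin n) : ℝ :=
  if i = j then (if i.val = 0 then -1 else 1) else 0

/-- A Lorentz metric: a smooth symmetric `(0,2)`-tensor field of signature `(-1, 1, …, 1)`. -/
structure IsLorentzMetric (g : TensorField n 2 M) : Prop where
  smooth : IsSmooth g
  symm : ∀ (p : M) (v w : TangentSpace (𝓡 n) p), g p ![v, w] = g p ![w, v]
  signature : ∀ p : M, ∃ b : Module.Basis (Fin n) ℝ (TangentSpace (𝓡 n) p),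
    ∀ i j : Fin n, g p ![b i, b j] = minkowski i j

/-- The components `g_ij` in a chart. -/
noncomputable def metricComp (e : OpenPartialHomeomorph M (E n)) (g : TensorField n 2 M)
    (x : E n) (i j : Fin n) : ℝ :=
  tensorComp e g ![i, j] x

/-- The components `g^ij` of the inverse metric in a chart. -/
noncomputable def metricInv (e : OpenPartialHomeomorph M (E n)) (g : TensorField n 2 M)
    (x : E n) (i j : Fin n) : ℝ :=
  (Matrix.of (metricComp e g x))⁻¹ i j

/-- `(g_ij, g_ij,k, g_ij,kl, D_I, D_I,j)` at the point with coordinates `x`. -/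
noncomputable def jet (e : OpenPartialHomeomorph M (E n)) (g : TensorField n 2 M)
    (D : TensorField n m M) (x : E n) : JetSpace n m :=
  (fun i j => metricComp e g x i j,
   fun i j k => partialD k (fun y => metricComp e g y i j) x,
   fun i j k l => partialD l (partialD k (fun y => metricComp e g y i j)) x,
   fun I => tensorComp e D I x,
   fun I j => partialD j (tensorComp e D I) x)

/-! ### Scalar curvature -/

/-- `Γ^i_jk = ½ g^{ia} (g_{ja,k} + g_{ka,j} - g_{jk,a})`. -/
noncomputable def christoffel (e : OpenPartialHomeomorph M (E n)) (g : TensorField n 2 M)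
    (i j k : Fin n) (x : E n) : ℝ :=
  (1 / 2) * ∑ a, metricInv e g x i a *
    (partialD k (fun y => metricComp e g y j a) x + partialD j (fun y => metricComp e g y k a) x
      - partialD a (fun y => metricComp e g y j k) x)

/-- `R^i_jkl = ∂_l Γ^i_jk - ∂_k Γ^i_jl + Γ^r_jk Γ^i_rl - Γ^r_jl Γ^i_rk`, the components of
`dxⁱ(∇_l ∇_k ∂_j - ∇_k ∇_l ∂_j)` for the Levi-Civita connection. -/
noncomputable def riemann (e : OpenPartialHomeomorph M (E n)) (g : TensorField n 2 M)
    (i j k l : Fin n) (x : E n) : ℝ :=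
  partialD l (christoffel e g i j k) x - partialD k (christoffel e g i j l) x
    + ∑ r, (christoffel e g r j k x * christoffel e g i r l x
      - christoffel e g r j l x * christoffel e g i r k x)

/-- The scalar curvature `R_g = g^{jk} R^i_jki`, computed in a chart. -/
noncomputable def scalarCurvature (e : OpenPartialHomeomorph M (E n)) (g : TensorField n 2 M)
    (x : E n) : ℝ :=
  ∑ j, ∑ k, metricInv e g x j k * ∑ i, riemann e g i j k i x

/-! ### The exterior derivative of the antisymmetric part -/

/-- The expression in a chart of the `m`-form
`γ_{i₁…i_m} = (1/m!) ∑_σ sgn(σ) D_{i_σ(1)…i_σ(m)}`. -/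
noncomputable def altPart (e : OpenPartialHomeomorph M (E n)) (D : TensorField n m M) (x : E n) :
    (E n) [⋀^Fin m]→L[ℝ] ℝ :=
  ((m.factorial : ℝ)⁻¹) • ContinuousMultilinearMap.alternatization (inChart e D x)

/-- The components `(dγ)_{i₀…i_m}` in a chart. -/
noncomputable def dAltComp (e : OpenPartialHomeomorph M (E n)) (D : TensorField n m M)
    (I : Fin (m + 1) → Fin n) (x : E n) : ℝ :=
  extDeriv (altPart e D) x (fun a => basisVec (I a))

/-- `|dγ|_g² = g^{i₀j₀} ⋯ g^{i_m j_m} (dγ)_{i₀…i_m} (dγ)_{j₀…j_m}`, computed in a chart. -/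
noncomputable def normSqDAlt (e : OpenPartialHomeomorph M (E n)) (g : TensorField n 2 M)
    (D : TensorField n m M) (x : E n) : ℝ :=
  ∑ I : Fin (m + 1) → Fin n, ∑ J : Fin (m + 1) → Fin n,
    (∏ a, metricInv e g x (I a) (J a)) * dAltComp e D I x * dAltComp e D J x

/-! ### Divergence -/

/-- `√|det g|` in a chart. -/
noncomputable def volDensity (e : OpenPartialHomeomorph M (E n)) (g : TensorField n 2 M)
    (x : E n) : ℝ :=
  Real.sqrt |(Matrix.of (metricComp e g x)).det|

/-- The divergence `∇_j X^j = |det g|^{-1/2} ∂_j (|det g|^{1/2} X^j)`, computed in a chart. -/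
noncomputable def divergence (e : OpenPartialHomeomorph M (E n)) (g : TensorField n 2 M)
    (X : VectorField n M) (x : E n) : ℝ :=
  (volDensity e g x)⁻¹ * ∑ j, partialD j (fun y => volDensity e g y * vecComp e X j y) x

/-- The smooth function `f` on `M` satisfies
`L(g_ij, g_ij,k, g_ij,kl, D_I, D_I,j) = f` in every coordinate chart. -/
structure Represents (L : JetSpace n m → ℝ) (g : TensorField n 2 M) (D : TensorField n m M)
    (f : M → ℝ) : Prop where
  smooth : ContMDiff (𝓡 n) 𝓘(ℝ, ℝ) ∞ f
  eq : ∀ e ∈ charts n M, ∀ p ∈ e.source, L (jet e g D (e p)) = f p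

end Manifold

/-- `L` is coordinate invariant: on every manifold, for every Lorentz metric and every smooth
`(0,m)`-tensor field, it gives the same smooth function in all coordinate charts. -/
def IsCoordinateInvariant {n m : ℕ} (L : JetSpace n m → ℝ) : Prop :=
  ∀ (M : Type u) [TopologicalSpace M] [T2Space M] [SecondCountableTopology M]
    [ChartedSpace (E n) M] [IsManifold (𝓡 n) ∞ M]
    (g : TensorField n 2 M) (D : TensorField n m M), IsLorentzMetric g → IsSmooth D →
    ∃ f : M → ℝ, Represents L g D f

end LorentzLagrangian

open LorentzLagrangian

/-!
Write `(w, w₃, w₄, y, y')` for the arguments of `L`. The first point is that the hypothesis, a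
statement about manifolds, is one about jets. Given a Lorentz form `w` and arrays `w₄`, `y`, `y'`,
the polynomial metric `modelMetric` and an affine tensor field have the jet `(w, 0, w₄, y, y')` at
the origin of an open subset of `ℝⁿ`. In the charts given by cubic polynomial maps with derivatives
`S`, `Q`, `C` at the origin they have the jets `pullJet`, so `L` is constant on these
(`IsCoordinateInvariant.exists_value`).

On a fibre over `w`, `L` is its Taylor polynomial of order two at `(w, 0, 0, 0, 0)` (`eq_taylor`),
with linear part `linPart` and quadratic part `quadForm`. For `S = 1`, scaling `Q`, `C` and the jet
separates the orders in the identity of the polynomial with its displacement. A linear functional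
of `w₄` which ignores both the displacements by `C` and those quadratic in `Q` vanishes: the former
force the first Bianchi identity and hence the symmetries of a curvature tensor, the latter test it
on all products of two quadratic forms (`map_eq_zero_of_shift`). It follows that no quadratic term
contains `w₄`. The coordinate change `x ↦ -x` excludes the terms bilinear in `y` and `y'`. For
`w₃ = 0` there remain a constant, linear terms in `w₄`, `y` and `y'`, and quadratic terms in `y` and
in `y'` (`eq_normalForm`). Any metric arises from one with `w₃ = 0` by the coordinate change with
`Q` the Christoffel symbols (`partialD_metricComp_eq`); it replaces `w₄` by `w₄ - shiftQQ w Γ Γ` and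
`y'` by the covariant derivative of the tensor field, and it does not affect the quadratic term in
`y'` (`eq_normalForm_shift`).

All coefficients are equivariant under linear coordinate changes (`taylor_linear`), so they are
determined by their values at the Minkowski form, where they are invariant under the Lorentz group.
Only reflections and rotations or boosts in coordinate planes are needed. The linear form in `w₄`
satisfies the Bianchi identity, and is therefore a multiple of the one by which the scalar curvature
is given (`exists_eq_curvForm`, `scalarCurvature_eq`). The quadratic form in `y'` ignores second
order coordinate changes. Such a change moves `y'_{Ij}` by a tensor symmetric in `j` and an index of
`I`, so the form is alternating in all `m + 1` indices (`map_single_comp_swap`); being invariant, it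
is a multiple of the norm of the alternating part of `y'`, that is of `|dγ|²`
(`exists_eq_mul_sum_alt`, `normSqDAlt_eq`).

The linear form in `y'` has the coefficients `β^{Ij}(w)`. By equivariance they are parallel for any
metric, as the derivative of the equivariance at `S = 1` shows (`sum_fderiv_linPart_inclDY`).
Consequently `β^{Ij} ∇_j D_I = div X` for `X^j = β^{Ij} D_I` (`divergence_eq`). The terms in `y`
give `Q` and `T`. Equivariance also shows that `Q`, `T` and `X` do not depend on the chart.
-/

open LorentzLagrangian

namespace LorentzLagrangian

/-! ### Change of charts -/

lemma isOpen_transition_source {n : ℕ} {M : Type*} [TopologicalSpace M]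
    (e e' : OpenPartialHomeomorph M (E n)) : IsOpen (e.target ∩ e.symm ⁻¹' e'.source) :=
  e.symm.isOpen_inter_preimage e'.open_source

section ChartChange

variable {n m : ℕ} {M : Type*} [TopologicalSpace M] [ChartedSpace (E n) M]

lemma contDiffOn_transition [IsManifold (𝓡 n) ∞ M] {e e' : OpenPartialHomeomorph M (E n)}
    (he : e ∈ charts n M) (he' : e' ∈ charts n M) :
    ContDiffOn ℝ ∞ (e' ∘ e.symm) (e.target ∩ e.symm ⁻¹' e'.source) := by
  rw [← contMDiffOn_iff_contDiffOn]
  exact (contMDiffOn_of_mem_maximalAtlas he').comp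
    ((contMDiffOn_symm_of_mem_maximalAtlas he).mono Set.inter_subset_left)
    (fun x hx => hx.2)

lemma differentiableAt_transition [IsManifold (𝓡 n) ∞ M] {e e' : OpenPartialHomeomorph M (E n)}
    (he : e ∈ charts n M) (he' : e' ∈ charts n M) {x : E n} (hx : x ∈ e.target)
    (hx' : e.symm x ∈ e'.source) : DifferentiableAt ℝ (e' ∘ e.symm) x :=
  ((contDiffOn_transition he he').contDiffAt
    ((isOpen_transition_source e e').mem_nhds ⟨hx, hx'⟩)).differentiableAt (by simp)

lemma mdifferentiableAt_chart [IsManifold (𝓡 n) ∞ M] {e : OpenPartialHomeomorph M (E n)}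
    (he : e ∈ charts n M) {p : M} (hp : p ∈ e.source) :
    MDifferentiableAt (𝓡 n) (𝓡 n) e p :=
  (contMDiffAt_of_mem_maximalAtlas he hp).mdifferentiableAt (by simp)

lemma mdifferentiableAt_chart_symm [IsManifold (𝓡 n) ∞ M] {e : OpenPartialHomeomorph M (E n)}
    (he : e ∈ charts n M) {x : E n} (hx : x ∈ e.target) :
    MDifferentiableAt (𝓡 n) (𝓡 n) e.symm x :=
  (contMDiffAt_symm_of_mem_maximalAtlas he hx).mdifferentiableAt (by simp)

lemma mfderiv_symm_transition [IsManifold (𝓡 n) ∞ M] {e e' : OpenPartialHomeomorph M (E n)}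
    (he : e ∈ charts n M) (he' : e' ∈ charts n M) {x : E n} (hx : x ∈ e.target)
    (hx' : e.symm x ∈ e'.source) :
    (mfderiv (𝓡 n) (𝓡 n) e.symm x : E n →L[ℝ] E n)
      = (mfderiv (𝓡 n) (𝓡 n) e'.symm (e' (e.symm x)) : E n →L[ℝ] E n).comp
          (fderiv ℝ (e' ∘ e.symm) x) := by
  have h1 : e.symm =ᶠ[nhds x] e'.symm ∘ (e' ∘ e.symm) := by
    filter_upwards [(isOpen_transition_source e e').mem_nhds ⟨hx, hx'⟩] with y hy
    simp [e'.left_inv hy.2]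
  have h2 : mfderiv (𝓡 n) (𝓡 n) e.symm x = mfderiv (𝓡 n) (𝓡 n) (e'.symm ∘ (e' ∘ e.symm)) x :=
    h1.mfderiv_eq
  rw [h2, mfderiv_comp x (I' := 𝓡 n)]
  · rw [mfderiv_eq_fderiv]; rfl
  · exact mdifferentiableAt_chart_symm he' (e'.map_source hx')
  · exact (differentiableAt_transition he he' hx hx').mdifferentiableAt

/-- The tangent spaces at equal points are written as `E n`, to which they unfold; otherwise the
statement would need a cast. -/
lemma compContinuousLinearMap_congr (T : TensorField n m M) {p q : M} (h : p = q)
    {A B : E n →L[ℝ] E n} (hAB : A = B) :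
    ((T p : ContinuousMultilinearMap ℝ (fun _ : Fin m => E n) ℝ).compContinuousLinearMap
      (fun _ => A)) =
    ((T q : ContinuousMultilinearMap ℝ (fun _ : Fin m => E n) ℝ).compContinuousLinearMap
      (fun _ => B)) := by
  subst h; subst hAB; rfl

/-- Coordinate expressions of a tensor field in two charts are related by the pull-back under the
transition map. -/
lemma inChart_transition [IsManifold (𝓡 n) ∞ M] {e e' : OpenPartialHomeomorph M (E n)}
    (he : e ∈ charts n M) (he' : e' ∈ charts n M) (T : TensorField n m M) {x : E n}
    (hx : x ∈ e.target) (hx' : e.symm x ∈ e'.source) :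
    inChart e T x = (inChart e' T (e' (e.symm x))).compContinuousLinearMap
      (fun _ => fderiv ℝ (e' ∘ e.symm) x) := by
  have h := compContinuousLinearMap_congr T (e'.left_inv hx').symm
    (mfderiv_symm_transition he he' hx hx')
  refine h.trans ?_
  ext v
  rfl

/-- The matrix `∂τ^a/∂x^i` of the differential at `x` of a map of `ℝⁿ`. -/
noncomputable def jacobian (τ : E n → E n) (x : E n) (a i : Fin n) : ℝ :=
  fderiv ℝ τ x (basisVec i) a

lemma sum_smul_basisVec (v : E n) : v = ∑ a, v a • (basisVec a : E n) := by
  ext i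
  simp [basisVec, Finset.sum_apply, Pi.single_apply]

/-- The pull-back `S^* y` of the array of components of a covariant tensor under the linear map
with matrix `S`. -/
def pullT {k : ℕ} (S : Fin n → Fin n → ℝ) (y : (Fin k → Fin n) → ℝ) (I : Fin k → Fin n) : ℝ :=
  ∑ A, y A * ∏ a, S (A a) (I a)

lemma multilinear_apply_eq_sum (f : ContinuousMultilinearMap ℝ (fun _ : Fin m => E n) ℝ)
    (v : Fin m → E n) :
    f v = ∑ A : Fin m → Fin n, f (fun a => basisVec (A a)) * ∏ a, v a (A a) := by
  conv_lhs => rw [show v = fun a => ∑ b, v a b • (basisVec b : E n) from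
    funext fun a => sum_smul_basisVec (v a)]
  rw [f.map_sum]
  refine Finset.sum_congr rfl fun A _ => ?_
  rw [f.map_smul_univ, smul_eq_mul, mul_comm]

lemma tensorComp_transition [IsManifold (𝓡 n) ∞ M] {e e' : OpenPartialHomeomorph M (E n)}
    (he : e ∈ charts n M) (he' : e' ∈ charts n M) (T : TensorField n m M) (I : Fin m → Fin n)
    {x : E n} (hx : x ∈ e.target) (hx' : e.symm x ∈ e'.source) :
    tensorComp e T I x
      = pullT (jacobian (e' ∘ e.symm) x) (fun A => tensorComp e' T A (e' (e.symm x))) I := by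
  rw [tensorComp, inChart_transition he he' T hx hx',
    ContinuousMultilinearMap.compContinuousLinearMap_apply, multilinear_apply_eq_sum]
  rfl

lemma mfderiv_chart_comp_symm [IsManifold (𝓡 n) ∞ M] {e e' : OpenPartialHomeomorph M (E n)}
    (he : e ∈ charts n M) (he' : e' ∈ charts n M) {x : E n} (hx : x ∈ e.target)
    (hx' : e.symm x ∈ e'.source) (v : E n) :
    (mfderiv (𝓡 n) (𝓡 n) e' (e.symm x) : E n →L[ℝ] E n)
      ((mfderiv (𝓡 n) (𝓡 n) e.symm x : E n →L[ℝ] E n) v) = fderiv ℝ (e' ∘ e.symm) x v := by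
  have := mfderiv_comp x (I' := 𝓡 n) (mdifferentiableAt_chart he' hx')
    (mdifferentiableAt_chart_symm he hx)
  rw [mfderiv_eq_fderiv] at this
  rw [this]; rfl

lemma mfderiv_chart_symm_left_inv [IsManifold (𝓡 n) ∞ M] {e : OpenPartialHomeomorph M (E n)}
    (he : e ∈ charts n M) {x : E n} (hx : x ∈ e.target) (v : E n) :
    (mfderiv (𝓡 n) (𝓡 n) e (e.symm x) : E n →L[ℝ] E n)
      ((mfderiv (𝓡 n) (𝓡 n) e.symm x : E n →L[ℝ] E n) v) = v := by
  rw [mfderiv_chart_comp_symm he he hx (e.map_target hx)]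
  have h : e ∘ e.symm =ᶠ[nhds x] id := by
    filter_upwards [e.open_target.mem_nhds hx] with y hy
    simp [e.right_inv hy]
  rw [h.fderiv_eq, fderiv_id]; rfl

/-- On a manifold with a global chart, a tensor field is smooth if its expression in that chart
is. -/
lemma isSmooth_of_chart [IsManifold (𝓡 n) ∞ M] {e' : OpenPartialHomeomorph M (E n)}
    (he' : e' ∈ charts n M) (hsource : e'.source = Set.univ) {T : TensorField n m M}
    (hT : ContDiffOn ℝ ∞ (inChart e' T) e'.target) : IsSmooth T := by
  intro e he
  have htr := contDiffOn_transition he he'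
  have hset : e.target ∩ e.symm ⁻¹' e'.source = e.target := by simp [hsource]
  rw [hset] at htr
  have h1 : ContDiffOn ℝ ∞ (fun x => inChart e' T ((e' ∘ e.symm) x)) e.target :=
    hT.comp htr (fun x _ => e'.map_source (by simp [hsource]))
  have h2 : ContDiffOn ℝ ∞ (fderiv ℝ (e' ∘ e.symm)) e.target :=
    htr.fderiv_of_isOpen e.open_target (by simp)
  have h3 : ContDiffOn ℝ ∞ (fun x => ContinuousMultilinearMap.compContinuousLinearMapContinuousMultilinear
      ℝ (fun _ : Fin m => E n) (fun _ : Fin m => E n) ℝ (fun _ => fderiv ℝ (e' ∘ e.symm) x)) e.target :=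
    (ContinuousMultilinearMap.contDiff _).comp_contDiffOn (contDiffOn_pi.2 fun _ => h2)
  refine (h3.clm_apply h1).congr fun x hx => ?_
  rw [inChart_transition he he' T hx (by simp [hsource])]
  rfl

end ChartChange

/-! ### Partial derivatives and two-jets at the origin -/

section Jets

variable {n : ℕ}

lemma partialD_add {f g : E n → ℝ} {x : E n} (hf : DifferentiableAt ℝ f x)
    (hg : DifferentiableAt ℝ g x) (k : Fin n) :
    partialD k (fun y => f y + g y) x = partialD k f x + partialD k g x := by
  simp only [partialD]; rw [fderiv_fun_add hf hg]; rfl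

lemma partialD_mul {f g : E n → ℝ} {x : E n} (hf : DifferentiableAt ℝ f x)
    (hg : DifferentiableAt ℝ g x) (k : Fin n) :
    partialD k (fun y => f y * g y) x = partialD k f x * g x + f x * partialD k g x := by
  simp only [partialD]; rw [fderiv_fun_mul hf hg]; simp; ring

lemma partialD_sum {ι : Type*} {s : Finset ι} {f : ι → E n → ℝ} {x : E n}
    (hf : ∀ i ∈ s, DifferentiableAt ℝ (f i) x) (k : Fin n) :
    partialD k (fun y => ∑ i ∈ s, f i y) x = ∑ i ∈ s, partialD k (f i) x := by
  simp only [partialD]; rw [fderiv_fun_sum hf]; simp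

lemma partialD_const (c : ℝ) (k : Fin n) (x : E n) : partialD k (fun _ => c) x = 0 := by
  simp [partialD]

lemma partialD_const_mul {f : E n → ℝ} {x : E n} (c : ℝ) (hf : DifferentiableAt ℝ f x)
    (k : Fin n) : partialD k (fun y => c * f y) x = c * partialD k f x := by
  rw [partialD_mul (differentiableAt_const c) hf, partialD_const]; ring

lemma partialD_prod {ι : Type*} [DecidableEq ι] {s : Finset ι} {f : ι → E n → ℝ} {x : E n}
    (hf : ∀ i ∈ s, DifferentiableAt ℝ (f i) x) (k : Fin n) :
    partialD k (fun y => ∏ i ∈ s, f i y) x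
      = ∑ i ∈ s, partialD k (f i) x * ∏ j ∈ s.erase i, f j x := by
  simp only [partialD]
  rw [(HasFDerivAt.finsetProd fun i hi => (hf i hi).hasFDerivAt).fderiv]
  simp [mul_comm]

lemma differentiable_coord (i : Fin n) : Differentiable ℝ (fun x : E n => x i) :=
  (EuclideanSpace.proj (𝕜 := ℝ) i : E n →L[ℝ] ℝ).differentiable

lemma contDiff_coord (i : Fin n) : ContDiff ℝ ∞ (fun x : E n => x i) :=
  (EuclideanSpace.proj (𝕜 := ℝ) i : E n →L[ℝ] ℝ).contDiff

lemma partialD_coord (i k : Fin n) (x : E n) :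
    partialD k (fun x : E n => x i) x = if i = k then 1 else 0 := by
  have : (fun x : E n => x i) = (EuclideanSpace.proj (𝕜 := ℝ) i : E n →L[ℝ] ℝ) := rfl
  rw [partialD, this, ContinuousLinearMap.fderiv]
  simp [basisVec]

lemma partialD_congr {f g : E n → ℝ} {x : E n} (h : f =ᶠ[nhds x] g) (k : Fin n) :
    partialD k f =ᶠ[nhds x] partialD k g :=
  h.fderiv.fun_comp (fun A : E n →L[ℝ] ℝ => A (basisVec k))

lemma contDiff_partialD {f : E n → ℝ} (hf : ContDiff ℝ ∞ f) (k : Fin n) :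
    ContDiff ℝ ∞ (partialD k f) :=
  (hf.fderiv_right (m := ∞) (by simp)).clm_apply contDiff_const

/-- `f` is differentiable at `x` with `∂f/∂xᵏ = d` there. -/
structure HasPartialAt (k : Fin n) (f : E n → ℝ) (d : ℝ) (x : E n) : Prop where
  diff : DifferentiableAt ℝ f x
  eq : partialD k f x = d

namespace HasPartialAt

variable {k : Fin n} {f g : E n → ℝ} {d d' : ℝ} {x : E n}

lemma const (c : ℝ) : HasPartialAt k (fun _ => c) 0 x :=
  ⟨differentiableAt_const c, partialD_const c k x⟩

lemma coord (i : Fin n) : HasPartialAt k (fun x : E n => x i) (if i = k then 1 else 0) x :=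
  ⟨differentiable_coord i x, partialD_coord i k x⟩

lemma add (hf : HasPartialAt k f d x) (hg : HasPartialAt k g d' x) :
    HasPartialAt k (fun y => f y + g y) (d + d') x :=
  ⟨hf.diff.add hg.diff, by rw [partialD_add hf.diff hg.diff, hf.eq, hg.eq]⟩

lemma mul (hf : HasPartialAt k f d x) (hg : HasPartialAt k g d' x) :
    HasPartialAt k (fun y => f y * g y) (d * g x + f x * d') x :=
  ⟨hf.diff.mul hg.diff, by rw [partialD_mul hf.diff hg.diff, hf.eq, hg.eq]⟩

lemma const_mul (c : ℝ) (hf : HasPartialAt k f d x) :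
    HasPartialAt k (fun y => c * f y) (c * d) x :=
  ⟨hf.diff.const_mul c, by rw [partialD_const_mul c hf.diff, hf.eq]⟩

lemma sum {ι : Type*} {s : Finset ι} {f : ι → E n → ℝ} {d : ι → ℝ}
    (hf : ∀ i ∈ s, HasPartialAt k (f i) (d i) x) :
    HasPartialAt k (fun y => ∑ i ∈ s, f i y) (∑ i ∈ s, d i) x :=
  ⟨DifferentiableAt.fun_sum fun i hi => (hf i hi).diff, by
    rw [partialD_sum fun i hi => (hf i hi).diff]
    exact Finset.sum_congr rfl fun i hi => (hf i hi).eq⟩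

lemma prod {ι : Type*} [DecidableEq ι] {s : Finset ι} {f : ι → E n → ℝ} {d : ι → ℝ}
    (hf : ∀ i ∈ s, HasPartialAt k (f i) (d i) x) :
    HasPartialAt k (fun y => ∏ i ∈ s, f i y) (∑ i ∈ s, d i * ∏ j ∈ s.erase i, f j x) x :=
  ⟨(HasFDerivAt.finsetProd fun i hi => (hf i hi).diff.hasFDerivAt).differentiableAt, by
    rw [partialD_prod fun i hi => (hf i hi).diff]
    exact Finset.sum_congr rfl fun i hi => by rw [(hf i hi).eq]⟩

lemma sub (hf : HasPartialAt k f d x) (hg : HasPartialAt k g d' x) :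
    HasPartialAt k (fun y => f y - g y) (d - d') x := by
  have := hf.add (hg.const_mul (-1))
  simpa [sub_eq_add_neg] using this

end HasPartialAt

/-- A smooth function on `ℝⁿ` with value `c`, gradient `d` and Hessian `h` at the origin. -/
structure HasJet2 (f : E n → ℝ) (c : ℝ) (d : Fin n → ℝ) (h : Fin n → Fin n → ℝ) : Prop where
  smooth : ContDiff ℝ ∞ f
  val : f 0 = c
  grad : ∀ k, partialD k f 0 = d k
  hess : ∀ k l, partialD l (partialD k f) 0 = h k l

namespace HasJet2

lemma differentiable {f : E n → ℝ} {c d h} (H : HasJet2 f c d h) : Differentiable ℝ f :=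
  H.smooth.differentiable (by simp)

lemma const (c : ℝ) : HasJet2 (fun _ : E n => c) c (fun _ => 0) (fun _ _ => 0) where
  smooth := contDiff_const
  val := rfl
  grad k := partialD_const c k 0
  hess k l := by
    have : partialD k (fun _ : E n => c) = fun _ => 0 := funext fun x => partialD_const c k x
    rw [this, partialD_const]

lemma coord (i : Fin n) :
    HasJet2 (fun x : E n => x i) 0 (fun k => if i = k then 1 else 0) (fun _ _ => 0) where
  smooth := contDiff_coord i
  val := rfl
  grad k := partialD_coord i k 0
  hess k l := by
    have : partialD k (fun x : E n => x i) = fun _ => if i = k then 1 else 0 :=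
      funext fun x => partialD_coord i k x
    rw [this, partialD_const]

lemma add {f g : E n → ℝ} {c d h c' d' h'} (H : HasJet2 f c d h) (H' : HasJet2 g c' d' h') :
    HasJet2 (fun x => f x + g x) (c + c') (fun k => d k + d' k) (fun k l => h k l + h' k l) where
  smooth := H.smooth.add H'.smooth
  val := by rw [H.val, H'.val]
  grad k := by rw [partialD_add H.differentiable.differentiableAt
    H'.differentiable.differentiableAt, H.grad, H'.grad]
  hess k l := by
    have : partialD k (fun x => f x + g x) = fun x => partialD k f x + partialD k g x :=
      funext fun x => partialD_add H.differentiable.differentiableAt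
        H'.differentiable.differentiableAt k
    rw [this, partialD_add ((contDiff_partialD H.smooth k).differentiable (by simp) _)
      ((contDiff_partialD H'.smooth k).differentiable (by simp) _), H.hess, H'.hess]

lemma mul {f g : E n → ℝ} {c d h c' d' h'} (H : HasJet2 f c d h) (H' : HasJet2 g c' d' h') :
    HasJet2 (fun x => f x * g x) (c * c') (fun k => d k * c' + c * d' k)
      (fun k l => h k l * c' + d k * d' l + (d l * d' k + c * h' k l)) where
  smooth := H.smooth.mul H'.smooth
  val := by rw [H.val, H'.val]
  grad k := by rw [partialD_mul H.differentiable.differentiableAt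
    H'.differentiable.differentiableAt, H.grad, H'.grad, H.val, H'.val]
  hess k l := by
    have hd := (contDiff_partialD H.smooth k).differentiable (by simp)
    have hd' := (contDiff_partialD H'.smooth k).differentiable (by simp)
    have : partialD k (fun x => f x * g x)
        = fun x => partialD k f x * g x + f x * partialD k g x :=
      funext fun x => partialD_mul H.differentiable.differentiableAt
        H'.differentiable.differentiableAt k
    have hf : HasPartialAt l f (d l) 0 := ⟨H.differentiable _, H.grad l⟩
    have hg : HasPartialAt l g (d' l) 0 := ⟨H'.differentiable _, H'.grad l⟩
    have hf' : HasPartialAt l (partialD k f) (h k l) 0 := ⟨hd _, H.hess k l⟩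
    have hg' : HasPartialAt l (partialD k g) (h' k l) 0 := ⟨hd' _, H'.hess k l⟩
    rw [this, ((hf'.mul hg).add (hf.mul hg')).eq, H.val, H'.val, H.grad, H'.grad]

lemma sum {ι : Type*} (s : Finset ι) {f : ι → E n → ℝ} {c : ι → ℝ} {d : ι → Fin n → ℝ}
    {h : ι → Fin n → Fin n → ℝ}
    (H : ∀ i ∈ s, HasJet2 (f i) (c i) (d i) (h i)) :
    HasJet2 (fun x => ∑ i ∈ s, f i x) (∑ i ∈ s, c i) (fun k => ∑ i ∈ s, d i k)
      (fun k l => ∑ i ∈ s, h i k l) := by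
  classical
  induction s using Finset.induction_on with
  | empty => simpa using const (n := n) 0
  | insert a s ha ih =>
    simp only [Finset.sum_insert ha]
    exact (H a (Finset.mem_insert_self a s)).add
      (ih fun i hi => H i (Finset.mem_insert_of_mem hi))

lemma congr {f : E n → ℝ} {c d h c' d' h'} (H : HasJet2 f c d h) (hc : c = c')
    (hd : ∀ k, d k = d' k) (hh : ∀ k l, h k l = h' k l) : HasJet2 f c' d' h' where
  smooth := H.smooth
  val := H.val.trans hc
  grad k := (H.grad k).trans (hd k)
  hess k l := (H.hess k l).trans (hh k l)

end HasJet2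

/-! ### Polynomial coordinate changes -/

/-- The components of the cubic polynomial map of `ℝⁿ` fixing the origin with derivatives `S`, `Q`,
`C` there. -/
noncomputable def cubicComp (S : Fin n → Fin n → ℝ) (Q : Fin n → Fin n → Fin n → ℝ)
    (C : Fin n → Fin n → Fin n → Fin n → ℝ) (a : Fin n) (x : E n) : ℝ :=
  ∑ i, S a i * x i + (1 / 2) * ∑ i, ∑ j, Q a i j * (x i * x j)
    + (1 / 6) * ∑ i, ∑ j, ∑ k, C a i j k * (x i * (x j * x k))

/-- The cubic polynomial map of `ℝⁿ` fixing the origin with derivatives `S`, `Q`, `C` there. -/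
noncomputable def cubicMap (S : Fin n → Fin n → ℝ) (Q : Fin n → Fin n → Fin n → ℝ)
    (C : Fin n → Fin n → Fin n → Fin n → ℝ) (x : E n) : E n :=
  WithLp.toLp 2 fun a => cubicComp S Q C a x

variable {S : Fin n → Fin n → ℝ} {Q : Fin n → Fin n → Fin n → ℝ}
  {C : Fin n → Fin n → Fin n → Fin n → ℝ}

lemma hasJet2_cubicComp (hQ : ∀ a i j, Q a i j = Q a j i) (a : Fin n) :
    HasJet2 (cubicComp S Q C a) 0 (S a) (Q a) := by
  have h1 : HasJet2 (fun x : E n => ∑ i, S a i * x i) _ _ _ :=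
    HasJet2.sum Finset.univ fun i _ => (HasJet2.const (S a i)).mul (HasJet2.coord i)
  have h2 : HasJet2 (fun x : E n => ∑ i, ∑ j, Q a i j * (x i * x j)) _ _ _ :=
    HasJet2.sum Finset.univ fun i _ => HasJet2.sum Finset.univ fun j _ =>
      (HasJet2.const (Q a i j)).mul ((HasJet2.coord i).mul (HasJet2.coord j))
  have h3 : HasJet2 (fun x : E n => ∑ i, ∑ j, ∑ k, C a i j k * (x i * (x j * x k))) _ _ _ :=
    HasJet2.sum Finset.univ fun i _ => HasJet2.sum Finset.univ fun j _ =>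
      HasJet2.sum Finset.univ fun k _ => (HasJet2.const (C a i j k)).mul
        ((HasJet2.coord i).mul ((HasJet2.coord j).mul (HasJet2.coord k)))
  refine ((h1.add ((HasJet2.const (1 / 2)).mul h2)).add
    ((HasJet2.const (1 / 6)).mul h3)).congr ?_ ?_ ?_
  · simp
  · intro k; simp
  · intro k l
    simp [mul_add, Finset.sum_add_distrib, hQ a l k]
    ring

lemma partialD_cubicComp (hQ : ∀ a i j, Q a i j = Q a j i)
    (hC : ∀ a i j k, C a i j k = C a j i k) (hC' : ∀ a i j k, C a i j k = C a i k j)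
    (a i : Fin n) (x : E n) :
    partialD i (cubicComp S Q C a) x
      = S a i + ∑ j, Q a i j * x j + (1 / 2) * ∑ j, ∑ k, C a i j k * (x j * x k) := by
  have h1 : HasPartialAt i (fun x : E n => ∑ i, S a i * x i) _ x :=
    HasPartialAt.sum fun j _ => (HasPartialAt.coord j).const_mul (S a j)
  have h2 : HasPartialAt i (fun x : E n => ∑ i, ∑ j, Q a i j * (x i * x j)) _ x :=
    HasPartialAt.sum fun j _ => HasPartialAt.sum fun k _ =>
      ((HasPartialAt.coord j).mul (HasPartialAt.coord k)).const_mul (Q a j k)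
  have h3 : HasPartialAt i
      (fun x : E n => ∑ i, ∑ j, ∑ k, C a i j k * (x i * (x j * x k))) _ x :=
    HasPartialAt.sum fun j _ => HasPartialAt.sum fun k _ => HasPartialAt.sum fun l _ =>
      ((HasPartialAt.coord j).mul
        ((HasPartialAt.coord k).mul (HasPartialAt.coord l))).const_mul (C a j k l)
  refine ((h1.add (h2.const_mul (1 / 2))).add (h3.const_mul (1 / 6))).eq.trans ?_
  simp [mul_add, Finset.sum_add_distrib]
  have e0 : ∑ p, Q a p i * x p = ∑ p, Q a i p * x p :=
    Finset.sum_congr rfl fun p _ => by rw [hQ]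
  have e1 : ∑ p, ∑ q, C a p i q * (x p * x q) = ∑ p, ∑ q, C a i p q * (x p * x q) :=
    Finset.sum_congr rfl fun p _ => Finset.sum_congr rfl fun q _ => by rw [hC]
  have e2 : ∑ p, ∑ q, C a p q i * (x p * x q) = ∑ p, ∑ q, C a i p q * (x p * x q) :=
    Finset.sum_congr rfl fun p _ => Finset.sum_congr rfl fun q _ => by rw [hC', hC]
  rw [e0, e1, e2]; ring

lemma hasJet2_partialD_cubicComp (hQ : ∀ a i j, Q a i j = Q a j i)
    (hC : ∀ a i j k, C a i j k = C a j i k) (hC' : ∀ a i j k, C a i j k = C a i k j)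
    (a i : Fin n) : HasJet2 (partialD i (cubicComp S Q C a)) (S a i) (Q a i) (C a i) := by
  rw [funext (partialD_cubicComp hQ hC hC' a i)]
  have h2 : HasJet2 (fun x : E n => ∑ j, Q a i j * x j) _ _ _ :=
    HasJet2.sum Finset.univ fun j _ => (HasJet2.const (Q a i j)).mul (HasJet2.coord j)
  have h3 : HasJet2 (fun x : E n => ∑ j, ∑ k, C a i j k * (x j * x k)) _ _ _ :=
    HasJet2.sum Finset.univ fun j _ => HasJet2.sum Finset.univ fun k _ =>
      (HasJet2.const (C a i j k)).mul ((HasJet2.coord j).mul (HasJet2.coord k))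
  refine (((HasJet2.const (S a i)).add h2).add ((HasJet2.const (1 / 2)).mul h3)).congr ?_ ?_ ?_
  · simp
  · intro k; simp
  · intro k l
    simp [mul_add, Finset.sum_add_distrib, hC' a i l k]
    ring

lemma contDiff_cubicMap (hQ : ∀ a i j, Q a i j = Q a j i) : ContDiff ℝ ∞ (cubicMap S Q C) :=
  contDiff_euclidean.2 fun a => (hasJet2_cubicComp hQ a).smooth

lemma jacobian_eq_partialD {φ : E n → E n} {x : E n} (hφ : DifferentiableAt ℝ φ x) (a i : Fin n) :
    jacobian φ x a i = partialD i (fun y => φ y a) x := by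
  have : fderiv ℝ (fun y => φ y a) x
      = (EuclideanSpace.proj (𝕜 := ℝ) a : E n →L[ℝ] ℝ).comp (fderiv ℝ φ x) :=
    ((EuclideanSpace.proj (𝕜 := ℝ) a : E n →L[ℝ] ℝ).hasFDerivAt.comp x hφ.hasFDerivAt).fderiv
  rw [partialD, this]; rfl

lemma jacobian_cubicMap (hQ : ∀ a i j, Q a i j = Q a j i) (x : E n) (a i : Fin n) :
    jacobian (cubicMap S Q C) x a i = partialD i (cubicComp S Q C a) x :=
  jacobian_eq_partialD ((contDiff_cubicMap hQ).differentiable (by simp) x) a i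

lemma cubicMap_zero (hQ : ∀ a i j, Q a i j = Q a j i) : cubicMap S Q C 0 = 0 := by
  ext a; exact (hasJet2_cubicComp hQ a).val

lemma fderiv_apply_eq_mulVec {φ : E n → E n} (x v : E n) (a : Fin n) :
    fderiv ℝ φ x v a = ∑ i, jacobian φ x a i * v i := by
  conv_lhs => rw [sum_smul_basisVec v]
  simp [jacobian, mul_comm]

/-- A smooth map with invertible Jacobian matrix is, as a bounded linear map, an equivalence at
the infinitesimal level. -/
lemma exists_equiv_of_jacobian {φ : E n → E n} {x : E n}
    (h : (Matrix.of (jacobian φ x)).det ≠ 0) :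
    ∃ A : E n ≃L[ℝ] E n, (A : E n →L[ℝ] E n) = fderiv ℝ φ x := by
  have hinj : Function.Injective (fderiv ℝ φ x : E n →ₗ[ℝ] E n) := by
    rw [injective_iff_map_eq_zero]
    intro v hv
    have : Matrix.mulVec (Matrix.of (jacobian φ x)) (fun i => v i) = 0 := by
      ext a
      have := congrArg (fun w : E n => w a) hv
      simpa [fderiv_apply_eq_mulVec, Matrix.mulVec, dotProduct] using this
    have h0 := Matrix.eq_zero_of_mulVec_eq_zero h this
    ext i
    exact congrFun h0 i
  refine ⟨(LinearEquiv.ofInjectiveEndo _ hinj).toContinuousLinearEquiv, ?_⟩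
  ext v; rfl

/-- The inverse function theorem, the map being restricted to a neighbourhood of the origin on which
its Jacobian stays invertible, so that the inverse is smooth on the whole target. -/
lemma exists_local_diffeo {φ : E n → E n} (hφ : ContDiff ℝ ∞ φ)
    (h : (Matrix.of (jacobian φ 0)).det ≠ 0) :
    ∃ ψ : OpenPartialHomeomorph (E n) (E n), (ψ : E n → E n) = φ ∧ 0 ∈ ψ.source ∧
      ContDiffOn ℝ ∞ ψ.symm ψ.target := by
  obtain ⟨A, hA⟩ := exists_equiv_of_jacobian h
  have hd : ∀ x, HasFDerivAt φ (fderiv ℝ φ x) x :=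
    fun x => (hφ.differentiable (by simp) x).hasFDerivAt
  have hA0 : HasFDerivAt φ (A : E n →L[ℝ] E n) 0 := hA ▸ hd 0
  let ψ := hφ.contDiffAt.toOpenPartialHomeomorph φ hA0 (by simp)
  have hψ : (ψ : E n → E n) = φ := rfl
  have hcont : Continuous fun x => (Matrix.of (jacobian φ x)).det := by
    refine Continuous.matrix_det (continuous_matrix fun a i => ?_)
    have : Continuous fun x => fderiv ℝ φ x (basisVec i) :=
      (hφ.continuous_fderiv (by simp)).clm_apply continuous_const
    exact (EuclideanSpace.proj (𝕜 := ℝ) a : E n →L[ℝ] ℝ).continuous.comp this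
  have hO : IsOpen {x | (Matrix.of (jacobian φ x)).det ≠ 0} :=
    isOpen_ne_fun hcont continuous_const
  refine ⟨ψ.restrOpen _ hO, hψ, ?_, ?_⟩
  · exact ⟨ContDiffAt.mem_toOpenPartialHomeomorph_source _ hA0 (by simp), h⟩
  · intro y hy
    have hy' : y ∈ ψ.target ∧ (Matrix.of (jacobian φ (ψ.symm y))).det ≠ 0 := by
      have := (ψ.restrOpen _ hO).map_target hy
      rw [OpenPartialHomeomorph.restrOpen_source] at this
      refine ⟨?_, this.2⟩
      have h1 := (ψ.restrOpen _ hO).right_inv hy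
      have h2 : ψ (ψ.symm y) = y := h1
      rw [← h2]
      exact ψ.map_source this.1
    obtain ⟨B, hB⟩ := exists_equiv_of_jacobian hy'.2
    refine (ψ.contDiffAt_symm (f₀' := B) hy'.1 ?_ hφ.contDiffAt).contDiffWithinAt
    rw [hB]; exact hd _

end Jets

/-! ### A Lorentz manifold with a prescribed two-jet -/

section Model

variable {n m : ℕ}

/-- A bilinear form on `ℝⁿ` of signature `(-1, 1, …, 1)`, given by its array of components: it is
congruent to the Minkowski form. -/
def IsLorentzForm (w : Fin n → Fin n → ℝ) : Prop :=
  ∃ P : Matrix (Fin n) (Fin n) ℝ, P.det ≠ 0 ∧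
    Matrix.of w = P.transpose * Matrix.of minkowski * P

lemma transpose_mul_mul_apply (X G : Matrix (Fin n) (Fin n) ℝ) (i j : Fin n) :
    (X.transpose * G * X) i j = ∑ a, ∑ b, G a b * X a i * X b j := by
  simp only [Matrix.mul_apply, Matrix.transpose_apply, Finset.sum_mul]
  rw [Finset.sum_comm]
  exact Finset.sum_congr rfl fun a _ => Finset.sum_congr rfl fun b _ => by ring

/-- The covariant tensor on `ℝⁿ` with the given components. -/
noncomputable def tensorOf {k : ℕ} (c : (Fin k → Fin n) → ℝ) :
    ContinuousMultilinearMap ℝ (fun _ : Fin k => E n) ℝ :=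
  ∑ I, c I • (ContinuousMultilinearMap.mkPiAlgebra ℝ (Fin k) ℝ).compContinuousLinearMap
    (fun a => EuclideanSpace.proj (𝕜 := ℝ) (I a))

lemma tensorOf_apply {k : ℕ} (c : (Fin k → Fin n) → ℝ) (v : Fin k → E n) :
    tensorOf c v = ∑ I, c I * ∏ a, v a (I a) := by
  simp [tensorOf]

lemma tensorOf_basisVec {k : ℕ} (c : (Fin k → Fin n) → ℝ) (I : Fin k → Fin n) :
    tensorOf c (fun a => basisVec (I a)) = c I := by
  rw [tensorOf_apply, Finset.sum_eq_single I]
  · simp [basisVec]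
  · intro A _ hA
    obtain ⟨a, ha⟩ : ∃ a, A a ≠ I a := by
      by_contra h; push Not at h; exact hA (funext h)
    rw [Finset.prod_eq_zero (Finset.mem_univ a), mul_zero]
    simp [basisVec, ha]
  · simp

lemma sum_fin_two_arrow (F : Fin n → Fin n → ℝ) :
    ∑ A : Fin 2 → Fin n, F (A 0) (A 1) = ∑ a, ∑ b, F a b := by
  rw [← (finTwoArrowEquiv (Fin n)).symm.sum_comp, Fintype.sum_prod_type]
  rfl

/-- The quadratic forms `½ w_abcd xᶜ xᵈ`. -/
noncomputable def quadPart (w4 : Fin n → Fin n → Fin n → Fin n → ℝ) (a b : Fin n) (x : E n) : ℝ :=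
  (1 / 2) * ∑ c, ∑ d, w4 a b c d * (x c * x d)

/-- The polynomial metric `q + w + ¼ q w⁻¹ q` with `q_ab = ½ w_abcd xᶜ xᵈ`. It has two-jet
`(w_ab, 0, w_abcd)` at the origin, and equals `(1 + ½ w⁻¹ q)ᵀ w (1 + ½ w⁻¹ q)`, so that its
signature is that of `w` wherever it is nondegenerate. -/
noncomputable def modelMetric (w : Fin n → Fin n → ℝ)
    (w4 : Fin n → Fin n → Fin n → Fin n → ℝ) (a b : Fin n) (x : E n) : ℝ :=
  w a b + quadPart w4 a b x
    + (1 / 4) * ∑ c, ∑ d, quadPart w4 a c x * ((Matrix.of w)⁻¹ c d * quadPart w4 d b x)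

/-- The affine components `y_A + y_{A,b} xᵇ`. -/
noncomputable def modelTensor (y : (Fin m → Fin n) → ℝ) (y' : (Fin m → Fin n) → Fin n → ℝ)
    (A : Fin m → Fin n) (x : E n) : ℝ :=
  y A + ∑ b, y' A b * x b

/-- The jet `(g_ij, g_ij,k, g_ij,kl, D_I, D_I,j)` at the origin, in coordinates in which the
identity of the manifold is a map with derivatives `S`, `Q`, `C`, of fields which in the old
coordinates have the jet `(w, 0, w4, y, y')`. -/
noncomputable def pullJet (w : Fin n → Fin n → ℝ) (w4 : Fin n → Fin n → Fin n → Fin n → ℝ)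
    (y : (Fin m → Fin n) → ℝ) (y' : (Fin m → Fin n) → Fin n → ℝ)
    (S : Fin n → Fin n → ℝ) (Q : Fin n → Fin n → Fin n → ℝ)
    (C : Fin n → Fin n → Fin n → Fin n → ℝ) : JetSpace n m :=
  (fun i j => ∑ a, ∑ b, w a b * (S a i * S b j),
   fun i j k => ∑ a, ∑ b, w a b * (Q a i k * S b j + S a i * Q b j k),
   fun i j k l => ∑ a, ∑ b, (∑ c, ∑ d, w4 a b c d * (S c k * S d l)) * (S a i * S b j)
     + ∑ a, ∑ b, w a b * (C a i k l * S b j + Q a i k * Q b j l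
        + (Q a i l * Q b j k + S a i * C b j k l)),
   pullT S y,
   fun I j => ∑ A, (∑ b, y' A b * S b j) * ∏ a, S (A a) (I a)
     + ∑ A, y A * ∑ a, Q (A a) (I a) j * ∏ c ∈ Finset.univ.erase a, S (A c) (I c))

section PulledBack

variable {S : Fin n → Fin n → ℝ} {Q : Fin n → Fin n → Fin n → ℝ}
  {C : Fin n → Fin n → Fin n → Fin n → ℝ} {w : Fin n → Fin n → ℝ}
  {w4 : Fin n → Fin n → Fin n → Fin n → ℝ}
  {y : (Fin m → Fin n) → ℝ} {y' : (Fin m → Fin n) → Fin n → ℝ}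

lemma hasJet2_quadPart_cubicMap (hQ : ∀ a i j, Q a i j = Q a j i)
    (hw4 : ∀ a b c d, w4 a b c d = w4 a b d c) (a b : Fin n) :
    HasJet2 (fun x => quadPart w4 a b (cubicMap S Q C x)) 0 (fun _ => 0)
      (fun k l => ∑ c, ∑ d, w4 a b c d * (S c k * S d l)) := by
  have h : HasJet2 (fun x => ∑ c, ∑ d, w4 a b c d * (cubicMap S Q C x c * cubicMap S Q C x d))
      _ _ _ :=
    HasJet2.sum Finset.univ fun c _ => HasJet2.sum Finset.univ fun d _ =>
      (HasJet2.const (w4 a b c d)).mul ((hasJet2_cubicComp hQ c).mul (hasJet2_cubicComp hQ d))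
  refine ((HasJet2.const (1 / 2)).mul h).congr ?_ ?_ ?_
  · simp
  · intro k; simp
  · intro k l
    simp [mul_add, Finset.sum_add_distrib]
    have : ∑ c, ∑ d, w4 a b c d * (S c l * S d k) = ∑ c, ∑ d, w4 a b c d * (S c k * S d l) := by
      rw [Finset.sum_comm]
      exact Finset.sum_congr rfl fun c _ => Finset.sum_congr rfl fun d _ => by rw [hw4]; ring
    rw [this]; ring

lemma hasJet2_modelMetric_cubicMap (hQ : ∀ a i j, Q a i j = Q a j i)
    (hw4 : ∀ a b c d, w4 a b c d = w4 a b d c) (a b : Fin n) :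
    HasJet2 (fun x => modelMetric w w4 a b (cubicMap S Q C x)) (w a b) (fun _ => 0)
      (fun k l => ∑ c, ∑ d, w4 a b c d * (S c k * S d l)) := by
  have h : HasJet2 (fun x => ∑ c, ∑ d, quadPart w4 a c (cubicMap S Q C x) *
      ((Matrix.of w)⁻¹ c d * quadPart w4 d b (cubicMap S Q C x))) _ _ _ :=
    HasJet2.sum Finset.univ fun c _ => HasJet2.sum Finset.univ fun d _ =>
      (hasJet2_quadPart_cubicMap hQ hw4 a c).mul
        ((HasJet2.const _).mul (hasJet2_quadPart_cubicMap hQ hw4 d b))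
  refine (((HasJet2.const (w a b)).add (hasJet2_quadPart_cubicMap hQ hw4 a b)).add
    ((HasJet2.const (1 / 4)).mul h)).congr ?_ ?_ ?_ <;> simp

/-- The two-jet at the origin of the pull-back of `modelMetric` by a cubic map. -/
lemma hasJet2_pulledBack_metric (hQ : ∀ a i j, Q a i j = Q a j i)
    (hC : ∀ a i j k, C a i j k = C a j i k) (hC' : ∀ a i j k, C a i j k = C a i k j)
    (hw4 : ∀ a b c d, w4 a b c d = w4 a b d c) (i j : Fin n) :
    HasJet2 (fun x => ∑ a, ∑ b, modelMetric w w4 a b (cubicMap S Q C x) *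
        (partialD i (cubicComp S Q C a) x * partialD j (cubicComp S Q C b) x))
      ((pullJet w w4 y y' S Q C).1 i j) ((pullJet w w4 y y' S Q C).2.1 i j)
      ((pullJet w w4 y y' S Q C).2.2.1 i j) := by
  have h : HasJet2 (fun x => ∑ a, ∑ b, modelMetric w w4 a b (cubicMap S Q C x) *
        (partialD i (cubicComp S Q C a) x * partialD j (cubicComp S Q C b) x)) _ _ _ :=
    HasJet2.sum Finset.univ fun a _ => HasJet2.sum Finset.univ fun b _ =>
      (hasJet2_modelMetric_cubicMap hQ hw4 a b).mul
        ((hasJet2_partialD_cubicComp hQ hC hC' a i).mul (hasJet2_partialD_cubicComp hQ hC hC' b j))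
  refine h.congr ?_ ?_ ?_
  · rfl
  · intro k; simp [pullJet]
  · intro k l
    simp only [pullJet, ← Finset.sum_add_distrib]
    exact Finset.sum_congr rfl fun a _ => Finset.sum_congr rfl fun b _ => by ring

/-- The first derivatives at the origin of the pull-back of `modelTensor` by a cubic map. -/
lemma hasPartialAt_pulledBack_tensor (hQ : ∀ a i j, Q a i j = Q a j i)
    (hC : ∀ a i j k, C a i j k = C a j i k) (hC' : ∀ a i j k, C a i j k = C a i k j)
    (I : Fin m → Fin n) (j : Fin n) :
    HasPartialAt j (fun x => ∑ A, modelTensor y y' A (cubicMap S Q C x) *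
        ∏ a, partialD (I a) (cubicComp S Q C (A a)) x)
      ((pullJet w w4 y y' S Q C).2.2.2.2 I j) 0 := by
  have hφ : ∀ a, HasPartialAt j (fun x => cubicMap S Q C x a) (S a j) 0 := fun a =>
    ⟨(hasJet2_cubicComp hQ a).differentiable _, (hasJet2_cubicComp hQ a).grad j⟩
  have hdφ : ∀ a i, HasPartialAt j (partialD i (cubicComp S Q C a)) (Q a i j) 0 := fun a i =>
    ⟨(hasJet2_partialD_cubicComp hQ hC hC' a i).differentiable _,
      (hasJet2_partialD_cubicComp hQ hC hC' a i).grad j⟩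
  have h : HasPartialAt j (fun x => ∑ A, modelTensor y y' A (cubicMap S Q C x) *
        ∏ a, partialD (I a) (cubicComp S Q C (A a)) x) _ 0 :=
    HasPartialAt.sum fun A _ => HasPartialAt.mul
      ((HasPartialAt.const (y A)).add (HasPartialAt.sum fun b _ => (hφ b).const_mul (y' A b)))
      (HasPartialAt.prod fun a _ => hdφ (A a) (I a))
  refine ⟨h.diff, h.eq.trans ?_⟩
  have hv : ∀ a i, partialD i (cubicComp S Q C a) 0 = S a i :=
    fun a i => (hasJet2_partialD_cubicComp hQ hC hC' a i).val
  simp [pullJet, Finset.sum_add_distrib, hv, cubicMap_zero hQ, modelTensor]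

variable {M : Type*} [TopologicalSpace M] [ChartedSpace (E n) M] [IsManifold (𝓡 n) ∞ M]

/-- If fields have model components in the chart `e'`, their jet in a chart `e` from which the
transition map is cubic is the pulled back jet. -/
lemma jet_eq_pullJet {e e' : OpenPartialHomeomorph M (E n)} (he : e ∈ charts n M)
    (he' : e' ∈ charts n M) {g : TensorField n 2 M} {D : TensorField n m M}
    (hg : ∀ x ∈ e'.target, ∀ A, tensorComp e' g A x = modelMetric w w4 (A 0) (A 1) x)
    (hD : ∀ x ∈ e'.target, ∀ A, tensorComp e' D A x = modelTensor y y' A x)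
    (h0 : 0 ∈ e.target)
    (hφ : ∀ x ∈ e.target, e.symm x ∈ e'.source ∧ e' (e.symm x) = cubicMap S Q C x)
    (hQ : ∀ a i j, Q a i j = Q a j i)
    (hC : ∀ a i j k, C a i j k = C a j i k) (hC' : ∀ a i j k, C a i j k = C a i k j)
    (hw4 : ∀ a b c d, w4 a b c d = w4 a b d c) :
    jet e g D 0 = pullJet w w4 y y' S Q C := by
  have hjac : ∀ x ∈ e.target, jacobian (e' ∘ e.symm) x
      = fun a i => partialD i (cubicComp S Q C a) x := by
    intro x hx
    have : e' ∘ e.symm =ᶠ[nhds x] cubicMap S Q C := by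
      filter_upwards [e.open_target.mem_nhds hx] with z hz using (hφ z hz).2
    funext a i
    rw [← jacobian_cubicMap hQ, jacobian, jacobian, this.fderiv_eq]
  have hmet : ∀ i j, (fun x => metricComp e g x i j) =ᶠ[nhds 0] (fun x => ∑ a, ∑ b,
      modelMetric w w4 a b (cubicMap S Q C x) *
        (partialD i (cubicComp S Q C a) x * partialD j (cubicComp S Q C b) x)) := by
    intro i j
    filter_upwards [e.open_target.mem_nhds h0] with x hx
    rw [metricComp, tensorComp_transition he he' g _ hx (hφ x hx).1, hjac x hx, pullT,
      ← sum_fin_two_arrow]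
    refine Finset.sum_congr rfl fun A _ => ?_
    rw [hg _ (e'.map_source (hφ x hx).1), (hφ x hx).2, Fin.prod_univ_two]
    rfl
  have hten : ∀ I, tensorComp e D I =ᶠ[nhds 0] (fun x => ∑ A,
      modelTensor y y' A (cubicMap S Q C x) * ∏ a, partialD (I a) (cubicComp S Q C (A a)) x) := by
    intro I
    filter_upwards [e.open_target.mem_nhds h0] with x hx
    rw [tensorComp_transition he he' D _ hx (hφ x hx).1, hjac x hx, pullT]
    refine Finset.sum_congr rfl fun A _ => ?_
    rw [hD _ (e'.map_source (hφ x hx).1), (hφ x hx).2]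
  have hJ := hasJet2_pulledBack_metric (S := S) (w := w) (y := y) (y' := y') hQ hC hC' hw4
  refine Prod.ext ?_ (Prod.ext ?_ (Prod.ext ?_ (Prod.ext ?_ ?_)))
  · funext i j
    exact (hmet i j).eq_of_nhds.trans (hJ i j).val
  · funext i j k
    exact (partialD_congr (hmet i j) k).eq_of_nhds.trans ((hJ i j).grad k)
  · funext i j k l
    exact (partialD_congr (partialD_congr (hmet i j) k) l).eq_of_nhds.trans ((hJ i j).hess k l)
  · funext I
    refine (hten I).eq_of_nhds.trans ?_
    have hv : ∀ a i, partialD i (cubicComp S Q C a) 0 = S a i :=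
      fun a i => (hasJet2_partialD_cubicComp hQ hC hC' a i).val
    simp [pullJet, pullT, modelTensor, cubicMap_zero hQ, hv]
  · funext I j
    exact (partialD_congr (hten I) j).eq_of_nhds.trans
      (hasPartialAt_pulledBack_tensor (w := w) (w4 := w4) hQ hC hC' I j).eq

end PulledBack

/-! ### Invariance of the Lagrangian under changes of jets -/

lemma isSmooth_tensorOf {k : ℕ} {c : (Fin k → Fin n) → E n → ℝ} (hc : ∀ A, ContDiff ℝ ∞ (c A)) :
    ContDiff ℝ ∞ (fun x => tensorOf (fun A => c A x)) :=
  ContDiff.sum fun A _ => (hc A).smul contDiff_const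

lemma contDiff_quadPart (w4 : Fin n → Fin n → Fin n → Fin n → ℝ) (a b : Fin n) :
    ContDiff ℝ ∞ (quadPart w4 a b) :=
  contDiff_const.mul (ContDiff.sum fun c _ => ContDiff.sum fun d _ =>
    contDiff_const.mul ((contDiff_coord c).mul (contDiff_coord d)))

lemma contDiff_modelMetric (w : Fin n → Fin n → ℝ) (w4 : Fin n → Fin n → Fin n → Fin n → ℝ)
    (a b : Fin n) : ContDiff ℝ ∞ (modelMetric w w4 a b) :=
  (contDiff_const.add (contDiff_quadPart w4 a b)).add (contDiff_const.mul
    (ContDiff.sum fun c _ => ContDiff.sum fun d _ =>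
      (contDiff_quadPart w4 a c).mul (contDiff_const.mul (contDiff_quadPart w4 d b))))

lemma contDiff_modelTensor (y : (Fin m → Fin n) → ℝ) (y' : (Fin m → Fin n) → Fin n → ℝ)
    (A : Fin m → Fin n) : ContDiff ℝ ∞ (modelTensor y y' A) :=
  contDiff_const.add (ContDiff.sum fun b _ => contDiff_const.mul (contDiff_coord b))

lemma quadPart_zero (w4 : Fin n → Fin n → Fin n → Fin n → ℝ) (a b : Fin n) :
    quadPart w4 a b 0 = 0 := by simp [quadPart]

lemma IsLorentzForm.transpose_eq {w : Fin n → Fin n → ℝ} (hw : IsLorentzForm w) :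
    (Matrix.of w).transpose = Matrix.of w := by
  obtain ⟨P, _, h⟩ := hw
  have : (Matrix.of (minkowski (n := n))).transpose = Matrix.of minkowski := by
    ext i j
    simp only [Matrix.transpose_apply, Matrix.of_apply, minkowski]
    by_cases hij : i = j
    · subst hij; rfl
    · simp [hij, Ne.symm hij]
  rw [h, Matrix.transpose_mul, Matrix.transpose_mul, this, Matrix.transpose_transpose,
    Matrix.mul_assoc]

lemma IsLorentzForm.symm {w : Fin n → Fin n → ℝ} (hw : IsLorentzForm w) (i j : Fin n) :
    w i j = w j i := congrFun (congrFun hw.transpose_eq j) i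

lemma det_minkowski_ne_zero : (Matrix.of (minkowski (n := n))).det ≠ 0 := by
  have : Matrix.of (minkowski (n := n))
      = Matrix.diagonal fun i => if i.val = 0 then (-1 : ℝ) else 1 := by
    ext i j
    simp [minkowski, Matrix.diagonal_apply]
  rw [this, Matrix.det_diagonal, Finset.prod_ne_zero_iff]
  intro i _
  split_ifs <;> norm_num

lemma IsLorentzForm.det_ne_zero {w : Fin n → Fin n → ℝ} (hw : IsLorentzForm w) :
    (Matrix.of w).det ≠ 0 := by
  obtain ⟨P, hP, h⟩ := hw
  rw [h, Matrix.det_mul, Matrix.det_mul, Matrix.det_transpose]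
  exact mul_ne_zero (mul_ne_zero hP det_minkowski_ne_zero) hP

/-- The model metric is congruent to the constant metric `w`, so that nondegeneracy alone gives it
Lorentz signature. -/
lemma modelMetric_eq_conj {w : Fin n → Fin n → ℝ} (hw : IsLorentzForm w)
    {w4 : Fin n → Fin n → Fin n → Fin n → ℝ} (hw4 : ∀ a b c d, w4 a b c d = w4 b a c d) (x : E n) :
    Matrix.of (fun a b => modelMetric w w4 a b x)
      = (1 + (1 / 2 : ℝ) • ((Matrix.of w)⁻¹ * Matrix.of fun a b => quadPart w4 a b x)).transpose
        * Matrix.of w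
        * (1 + (1 / 2 : ℝ) • ((Matrix.of w)⁻¹ * Matrix.of fun a b => quadPart w4 a b x)) := by
  set q : Matrix (Fin n) (Fin n) ℝ := Matrix.of fun a b => quadPart w4 a b x with hq
  set G : Matrix (Fin n) (Fin n) ℝ := Matrix.of w with hG
  have hqT : q.transpose = q := by
    ext a b
    simp [hq, quadPart, hw4 a b]
  have hGT : (G⁻¹).transpose = G⁻¹ := by
    rw [Matrix.transpose_nonsing_inv, hw.transpose_eq]
  have hu : IsUnit G.det := isUnit_iff_ne_zero.2 hw.det_ne_zero
  have h1 : Matrix.of (fun a b => modelMetric w w4 a b x) = G + q + (1 / 4 : ℝ) • (q * G⁻¹ * q) := by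
    ext a b
    simp only [modelMetric, Matrix.add_apply, Matrix.of_apply, Matrix.smul_apply, smul_eq_mul,
      Matrix.mul_apply, Finset.sum_mul, hq, hG]
    rw [Finset.sum_comm]
    simp only [mul_assoc]
  rw [h1, Matrix.transpose_add, Matrix.transpose_one, Matrix.transpose_smul, Matrix.transpose_mul,
    hGT, hqT]
  simp only [add_mul, mul_add, one_mul, mul_one, Matrix.smul_mul, Matrix.mul_smul, smul_smul]
  have e1 : q * G⁻¹ * G = q := by rw [Matrix.mul_assoc, Matrix.nonsing_inv_mul G hu, mul_one]
  have e2 : G * (G⁻¹ * q) = q := by rw [← Matrix.mul_assoc, Matrix.mul_nonsing_inv G hu, one_mul]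
  have e3 : q * G⁻¹ * G * (G⁻¹ * q) = q * G⁻¹ * q := by rw [e1, Matrix.mul_assoc]
  rw [e1, e2, ← Matrix.mul_assoc q]
  ext i j
  simp only [Matrix.add_apply, Matrix.smul_apply, smul_eq_mul]
  ring

/-- Lorentz bases exist for the forms congruent to the Minkowski form. -/
lemma exists_basis_of_conj {B : Matrix (Fin n) (Fin n) ℝ} {G : Fin n → Fin n → ℝ}
    (hB : B.det ≠ 0) (hG : Matrix.of G = B.transpose * Matrix.of minkowski * B) :
    ∃ b : Module.Basis (Fin n) ℝ (E n),
      ∀ i j, ∑ a, ∑ c, G a c * (b i a * b j c) = minkowski i j := by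
  have hu : IsUnit B.det := isUnit_iff_ne_zero.2 hB
  have hinj : Function.Injective (Matrix.toEuclideanLin B⁻¹) := by
    rw [injective_iff_map_eq_zero]
    intro v hv
    have h0 : Matrix.mulVec B⁻¹ (fun i => v i) = 0 := by
      ext a; exact congrArg (fun w : E n => w a) hv
    have := Matrix.eq_zero_of_mulVec_eq_zero
      (Matrix.isUnit_nonsing_inv_det B hu).ne_zero h0
    ext i; exact congrFun this i
  refine ⟨(EuclideanSpace.basisFun (Fin n) ℝ).toBasis.map (LinearEquiv.ofInjectiveEndo _ hinj),
    fun i j => ?_⟩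
  have hb : ∀ i a, ((EuclideanSpace.basisFun (Fin n) ℝ).toBasis.map
      (LinearEquiv.ofInjectiveEndo _ hinj)) i a = B⁻¹ a i := by
    intro i a
    simp [Matrix.toLpLin_apply]
  simp only [hb]
  have := transpose_mul_mul_apply B⁻¹ (Matrix.of G) i j
  simp only [Matrix.of_apply, mul_assoc] at this
  rw [← this, hG, Matrix.mul_assoc, Matrix.mul_assoc, Matrix.mul_nonsing_inv B hu, mul_one,
    ← Matrix.mul_assoc, ← Matrix.transpose_mul, Matrix.mul_nonsing_inv B hu]
  simp

/-- In a manifold whose atlas is the single chart `e`, the inverse of `e` has derivative the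
identity, tangent spaces being identified with `ℝⁿ` by means of `e`. -/
lemma mfderiv_symm_of_chartAt_eq {M : Type*} [TopologicalSpace M] [ChartedSpace (E n) M]
    {e : OpenPartialHomeomorph M (E n)} (he : ∀ p, chartAt (E n) p = e) {x : E n}
    (hx : x ∈ e.target) :
    (mfderiv (𝓡 n) (𝓡 n) e.symm x : E n →L[ℝ] E n) = ContinuousLinearMap.id ℝ (E n) := by
  have h : HasMFDerivAt (𝓡 n) (𝓡 n) e.symm x (ContinuousLinearMap.id ℝ (E n)) := by
    refine ⟨e.symm.continuousAt hx, ?_⟩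
    refine HasFDerivWithinAt.congr_of_eventuallyEq (f := id) (hasFDerivWithinAt_id _ _) ?_ ?_
    · refine Filter.Eventually.filter_mono nhdsWithin_le_nhds ?_
      filter_upwards [e.open_target.mem_nhds hx] with z hz
      simp only [writtenInExtChartAt, extChartAt, he]
      exact e.right_inv hz
    · simp only [writtenInExtChartAt, extChartAt, he]
      exact e.right_inv hx
  exact h.mfderiv

/-- A coordinate invariant function takes the same value on all jets which are pulled back from
one and the same Lorentz jet. -/
theorem IsCoordinateInvariant.exists_value {L : JetSpace n m → ℝ}
    (hinv : IsCoordinateInvariant.{u} L) {w : Fin n → Fin n → ℝ} (hw : IsLorentzForm w)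
    {w4 : Fin n → Fin n → Fin n → Fin n → ℝ} (hw4 : ∀ a b c d, w4 a b c d = w4 b a c d)
    (hw4' : ∀ a b c d, w4 a b c d = w4 a b d c)
    (y : (Fin m → Fin n) → ℝ) (y' : (Fin m → Fin n) → Fin n → ℝ) :
    ∃ val : ℝ, ∀ (S : Fin n → Fin n → ℝ) (Q : Fin n → Fin n → Fin n → ℝ)
      (C : Fin n → Fin n → Fin n → Fin n → ℝ), (Matrix.of S).det ≠ 0 →
      (∀ a i j, Q a i j = Q a j i) → (∀ a i j k, C a i j k = C a j i k) →
      (∀ a i j k, C a i j k = C a i k j) → L (pullJet w w4 y y' S Q C) = val := by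
  set K : E n → Matrix (Fin n) (Fin n) ℝ := fun x =>
    1 + (1 / 2 : ℝ) • ((Matrix.of w)⁻¹ * Matrix.of fun a b => quadPart w4 a b x) with hK
  have hKc : Continuous fun x => (K x).det := by
    refine Continuous.matrix_det (continuous_matrix fun a i => ?_)
    simp only [hK, Matrix.add_apply, Matrix.smul_apply, Matrix.mul_apply, Matrix.of_apply]
    have := fun a b => (contDiff_quadPart w4 a b).continuous
    fun_prop
  let U : Set (E n) := {x | (K x).det ≠ 0}
  have hU : IsOpen U := isOpen_ne_fun hKc continuous_const
  have h0U : (0 : E n) ∈ U := by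
    have : (Matrix.of fun a b => quadPart w4 a b (0 : E n)) = 0 := by
      ext a b; exact quadPart_zero w4 a b
    simp [U, hK, this]
  -- The manifold is the open set where the model metric is nondegenerate, lifted to the universe
  -- over which the invariance is assumed.
  let f : ULift.{u} U → E n := fun p => p.down
  have hf : Topology.IsOpenEmbedding f :=
    hU.isOpenEmbedding_subtypeVal.comp Homeomorph.ulift.isOpenEmbedding
  let p₀ : ULift.{u} U := ⟨⟨0, h0U⟩⟩
  have : Nonempty (ULift.{u} U) := ⟨p₀⟩
  let _ : ChartedSpace (E n) (ULift.{u} U) := hf.singletonChartedSpace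
  have : IsManifold (𝓡 n) ∞ (ULift.{u} U) := hf.isManifold_singleton
  have : SecondCountableTopology (ULift.{u} U) :=
    Homeomorph.ulift.secondCountableTopology
  let e : OpenPartialHomeomorph (ULift.{u} U) (E n) := hf.toOpenPartialHomeomorph f
  have hchart : ∀ p : ULift.{u} U, chartAt (E n) p = e := fun p => rfl
  have he : e ∈ charts n (ULift.{u} U) := IsManifold.chart_mem_maximalAtlas p₀
  have hsrc : e.source = Set.univ := rfl
  let g : TensorField n 2 (ULift.{u} U) := fun p =>
    tensorOf (fun A => modelMetric w w4 (A 0) (A 1) (f p))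
  let D : TensorField n m (ULift.{u} U) := fun p => tensorOf (fun A => modelTensor y y' A (f p))
  have hin : ∀ {k : ℕ} (c : (Fin k → Fin n) → E n → ℝ), ∀ x ∈ e.target,
      inChart e (fun p => tensorOf (fun A => c A (f p)) : TensorField n k (ULift.{u} U)) x
        = tensorOf (fun A => c A x) := by
    intro k c x hx
    have h1 : f (e.symm x) = x := e.right_inv hx
    ext v
    refine (ContinuousMultilinearMap.compContinuousLinearMap_apply _ _ _).trans ?_
    rw [mfderiv_symm_of_chartAt_eq hchart hx]
    exact congrArg (fun z => tensorOf (fun A => c A z) v) h1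
  have hsm : ∀ {k : ℕ} (c : (Fin k → Fin n) → E n → ℝ), (∀ A, ContDiff ℝ ∞ (c A)) →
      IsSmooth (fun p => tensorOf (fun A => c A (f p)) : TensorField n k (ULift.{u} U)) := by
    intro k c hc
    exact isSmooth_of_chart he hsrc ((isSmooth_tensorOf hc).contDiffOn.congr (hin c))
  have hval : ∀ (p : ULift.{u} U) (v v' : E n), tensorOf (fun A : Fin 2 → Fin n =>
      modelMetric w w4 (A 0) (A 1) (f p)) ![v, v']
        = ∑ a, ∑ b, modelMetric w w4 a b (f p) * (v a * v' b) := by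
    intro p v v'
    rw [tensorOf_apply, ← sum_fin_two_arrow]
    exact Finset.sum_congr rfl fun A _ => by rw [Fin.prod_univ_two]; rfl
  have hsymm : ∀ x a b, modelMetric w w4 a b x = modelMetric w w4 b a x := by
    intro x a b
    have h := modelMetric_eq_conj hw hw4 x
    have h2 : (Matrix.of (fun a b => modelMetric w w4 a b x)).transpose
        = Matrix.of (fun a b => modelMetric w w4 a b x) := by
      rw [h, Matrix.transpose_mul, Matrix.transpose_mul, hw.transpose_eq,
        Matrix.transpose_transpose, Matrix.mul_assoc]
    exact congrFun (congrFun h2 b) a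
  have hg : IsLorentzMetric g := by
    refine ⟨hsm _ fun A => contDiff_modelMetric w w4 _ _, ?_, ?_⟩
    · intro p v v'
      refine (hval p v v').trans (Eq.trans ?_ (hval p v' v).symm)
      rw [Finset.sum_comm]
      exact Finset.sum_congr rfl fun a _ => Finset.sum_congr rfl fun b _ => by
        rw [hsymm]; ring
    · intro p
      obtain ⟨P, hP, hwP⟩ := hw
      have hKp : (K (f p)).det ≠ 0 := p.down.2
      have h : Matrix.of (fun a b => modelMetric w w4 a b (f p))
          = (K (f p)).transpose * Matrix.of w * K (f p) :=
        modelMetric_eq_conj ⟨P, hP, hwP⟩ hw4 (f p)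
      obtain ⟨b, hb⟩ := exists_basis_of_conj (B := P * K (f p))
        (G := fun a b => modelMetric w w4 a b (f p))
        (by rw [Matrix.det_mul]; exact mul_ne_zero hP hKp)
        (by rw [h, hwP, Matrix.transpose_mul]; simp only [Matrix.mul_assoc])
      exact ⟨b, fun i j => (hval p (b i) (b j)).trans (hb i j)⟩
  obtain ⟨F, hF⟩ := hinv (ULift.{u} U) g D hg (hsm _ fun A => contDiff_modelTensor y y' A)
  refine ⟨F p₀, fun S Q C hS hQ hC hC' => ?_⟩
  have hjac : jacobian (cubicMap S Q C) 0 = S := by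
    funext a i
    rw [jacobian_cubicMap hQ, (hasJet2_partialD_cubicComp hQ hC hC' a i).val]
  -- The chart in which the jet is the pulled back one is the inverse of the cubic map, after `e`.
  obtain ⟨ψ, hψ, h0, hψs⟩ := exists_local_diffeo (contDiff_cubicMap (S := S) (C := C) hQ)
    (by rw [hjac]; exact hS)
  have hφ0 : ψ 0 = 0 := by rw [hψ, cubicMap_zero hQ]
  let e₁ : OpenPartialHomeomorph (ULift.{u} U) (E n) := e.trans ψ.symm
  have he₁ : e₁ ∈ charts n (ULift.{u} U) := by
    refine (IsManifold.mem_maximalAtlas_iff_contMDiffOn (I := 𝓡 n) (n := ∞) e₁).2 ⟨?_, ?_⟩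
    · have h1 : ContMDiffOn (𝓡 n) (𝓡 n) ∞ ψ.symm ψ.target := hψs.contMDiffOn
      exact h1.comp ((contMDiffOn_of_mem_maximalAtlas he).mono (fun p hp => hp.1))
        (fun p hp => hp.2)
    · have h1 : ContMDiffOn (𝓡 n) (𝓡 n) ∞ ψ ψ.source := by
        rw [hψ]; exact (contDiff_cubicMap hQ).contDiffOn.contMDiffOn
      exact (contMDiffOn_symm_of_mem_maximalAtlas he).comp (h1.mono (fun p hp => hp.1))
        (fun p hp => hp.2)
  have hp0 : e p₀ = 0 := rfl
  have hψ0 : ψ.symm 0 = 0 := by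
    conv_lhs => rw [← hφ0]
    exact ψ.left_inv h0
  have h0t : (0 : E n) ∈ ψ.target := by
    have := ψ.map_source h0
    rwa [hφ0] at this
  have hp1 : p₀ ∈ e₁.source := ⟨trivial, by
    change e p₀ ∈ ψ.target
    rw [hp0]; exact h0t⟩
  have hep1 : e₁ p₀ = 0 := by
    change ψ.symm (e p₀) = 0
    rw [hp0, hψ0]
  have key := hF.eq e₁ he₁ p₀ hp1
  rw [hep1] at key
  rw [← key]
  congr 1
  symm
  refine jet_eq_pullJet he₁ he ?_ ?_ ?_ ?_ hQ hC hC' hw4'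
  · intro x hx A
    have := hin (fun A : Fin 2 → Fin n => modelMetric w w4 (A 0) (A 1)) x hx
    rw [tensorComp, this, tensorOf_basisVec]
  · intro x hx A
    rw [tensorComp, hin (modelTensor y y') x hx, tensorOf_basisVec]
  · rw [← hep1]; exact e₁.map_source hp1
  · intro x hx
    refine ⟨trivial, ?_⟩
    have h1 : ψ x ∈ e.target := hx.2
    change e (e.symm (ψ x)) = _
    rw [e.right_inv h1, hψ]

end Model

/-! ### The Taylor expansion of a quadratic Lagrangian -/

section Taylor

variable {n m : ℕ}

lemma continuous_det_of : Continuous fun w : Fin n → Fin n → ℝ => (Matrix.of w).det :=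
  Continuous.matrix_det (continuous_matrix fun i j => by
    simp only [Matrix.of_apply]; fun_prop)

lemma isOpen_nondegenerate : IsOpen (nondegenerate n) :=
  isOpen_ne_fun continuous_det_of continuous_const

lemma isOpen_jetDomain : IsOpen (jetDomain n m) :=
  isOpen_nondegenerate.preimage continuous_fst

/-- The base point `(w, 0, 0, 0, 0)`. -/
def basePoint (w : Fin n → Fin n → ℝ) : JetSpace n m := (w, 0)

/-- The differential of `L` at `(w, 0, 0, 0, 0)`. -/
noncomputable def linPart (L : JetSpace n m → ℝ) (w : Fin n → Fin n → ℝ) (v : JetSpace n m) : ℝ :=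
  fderiv ℝ L (basePoint w) v

/-- Half the second differential of `L` at `(w, 0, 0, 0, 0)`, a bilinear form. -/
noncomputable def quadForm (L : JetSpace n m → ℝ) (w : Fin n → Fin n → ℝ)
    (u v : JetSpace n m) : ℝ :=
  (1 / 2) * fderiv ℝ (fderiv ℝ L) (basePoint w) u v

lemma linPart_add (L : JetSpace n m → ℝ) (w : Fin n → Fin n → ℝ) (u v : JetSpace n m) :
    linPart L w (u + v) = linPart L w u + linPart L w v := by simp [linPart]

lemma linPart_smul (L : JetSpace n m → ℝ) (w : Fin n → Fin n → ℝ) (c : ℝ) (u : JetSpace n m) :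
    linPart L w (c • u) = c * linPart L w u := by simp [linPart]

lemma quadForm_add_left (L : JetSpace n m → ℝ) (w : Fin n → Fin n → ℝ) (u u' v : JetSpace n m) :
    quadForm L w (u + u') v = quadForm L w u v + quadForm L w u' v := by
  simp [quadForm, mul_add]

lemma quadForm_add_right (L : JetSpace n m → ℝ) (w : Fin n → Fin n → ℝ) (u v v' : JetSpace n m) :
    quadForm L w u (v + v') = quadForm L w u v + quadForm L w u v' := by
  simp [quadForm, mul_add]

lemma quadForm_smul_left (L : JetSpace n m → ℝ) (w : Fin n → Fin n → ℝ) (c : ℝ)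
    (u v : JetSpace n m) : quadForm L w (c • u) v = c * quadForm L w u v := by
  simp [quadForm]; ring

lemma quadForm_smul_right (L : JetSpace n m → ℝ) (w : Fin n → Fin n → ℝ) (c : ℝ)
    (u v : JetSpace n m) : quadForm L w u (c • v) = c * quadForm L w u v := by
  simp [quadForm]; ring

variable {L : JetSpace n m → ℝ}

lemma contDiffOn_fderiv (hL : ContDiffOn ℝ ∞ L (jetDomain n m)) :
    ContDiffOn ℝ ∞ (fderiv ℝ L) (jetDomain n m) :=
  hL.fderiv_of_isOpen isOpen_jetDomain (by simp)

lemma contDiffOn_fderiv_fderiv (hL : ContDiffOn ℝ ∞ L (jetDomain n m)) :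
    ContDiffOn ℝ ∞ (fderiv ℝ (fderiv ℝ L)) (jetDomain n m) :=
  (contDiffOn_fderiv hL).fderiv_of_isOpen isOpen_jetDomain (by simp)

lemma contDiffOn_linPart (hL : ContDiffOn ℝ ∞ L (jetDomain n m)) (v : JetSpace n m) :
    ContDiffOn ℝ ∞ (fun w => linPart L w v) (nondegenerate n) := by
  have h : ContDiffOn ℝ ∞ (fun w => fderiv ℝ L (basePoint w)) (nondegenerate n) :=
    (contDiffOn_fderiv hL).comp (contDiff_id.prodMk contDiff_const).contDiffOn (fun w hw => hw)
  exact h.clm_apply contDiffOn_const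

lemma contDiffOn_quadForm (hL : ContDiffOn ℝ ∞ L (jetDomain n m)) (u v : JetSpace n m) :
    ContDiffOn ℝ ∞ (fun w => quadForm L w u v) (nondegenerate n) := by
  have h : ContDiffOn ℝ ∞ (fun w => fderiv ℝ (fderiv ℝ L) (basePoint w)) (nondegenerate n) :=
    (contDiffOn_fderiv_fderiv hL).comp (contDiff_id.prodMk contDiff_const).contDiffOn
      (fun w hw => hw)
  exact contDiffOn_const.mul ((h.clm_apply contDiffOn_const).clm_apply contDiffOn_const)

lemma quadForm_symm (hL : ContDiffOn ℝ ∞ L (jetDomain n m)) {w : Fin n → Fin n → ℝ}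
    (hw : w ∈ nondegenerate n) (u v : JetSpace n m) : quadForm L w u v = quadForm L w v u := by
  have h : ContDiffAt ℝ ∞ L (basePoint w) := hL.contDiffAt (isOpen_jetDomain.mem_nhds hw)
  have := (h.isSymmSndFDerivAt (by
    simpa using (WithTop.coe_le_coe.2 le_top : ((2 : ℕ∞) : WithTop ℕ∞) ≤ ((⊤ : ℕ∞) : WithTop ℕ∞)))) u v
  rw [quadForm, quadForm, this]

/-- On a fibre of the jet space over a fixed `w`, a quadratic Lagrangian coincides with its second
order Taylor polynomial. -/
lemma eq_taylor (hL : ContDiffOn ℝ ∞ L (jetDomain n m)) (hquad : IsQuadraticInDerivatives L)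
    {w : Fin n → Fin n → ℝ} (hw : w ∈ nondegenerate n) {v : JetSpace n m} (hv : v.1 = 0) :
    L (basePoint w + v) = L (basePoint w) + linPart L w v + quadForm L w v v := by
  have hdom : ∀ t : ℝ, basePoint w + t • v ∈ jetDomain n m := by
    intro t
    have : (basePoint w + t • v).1 = w := by simp [basePoint, hv]
    simpa [jetDomain, this] using hw
  have hnb : ∀ y ∈ jetDomain n m, jetDomain n m ∈ nhds y := fun y hy =>
    isOpen_jetDomain.mem_nhds hy
  have d0 : ∀ y ∈ jetDomain n m, DifferentiableAt ℝ L y := fun y hy =>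
    (hL.contDiffAt (hnb y hy)).differentiableAt (by simp)
  have d1 : ∀ y ∈ jetDomain n m, DifferentiableAt ℝ (fderiv ℝ L) y := fun y hy =>
    ((contDiffOn_fderiv hL).contDiffAt (hnb y hy)).differentiableAt (by simp)
  have d2 : ∀ y ∈ jetDomain n m, DifferentiableAt ℝ (fderiv ℝ (fderiv ℝ L)) y := fun y hy =>
    ((contDiffOn_fderiv_fderiv hL).contDiffAt (hnb y hy)).differentiableAt (by simp)
  have e1 : ∀ y ∈ jetDomain n m, lineDeriv ℝ L y v = fderiv ℝ L y v := fun y hy =>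
    (d0 y hy).lineDeriv_eq_fderiv
  have f1 : ∀ y ∈ jetDomain n m, HasFDerivAt (fun y => fderiv ℝ L y v)
      ((fderiv ℝ (fderiv ℝ L) y).flip v) y := fun y hy => by
    simpa using (d1 y hy).hasFDerivAt.clm_apply (hasFDerivAt_const v y)
  have e2 : ∀ y ∈ jetDomain n m, lineDeriv ℝ (fun y => lineDeriv ℝ L y v) y v
      = fderiv ℝ (fderiv ℝ L) y v v := by
    intro y hy
    have : (fun y => lineDeriv ℝ L y v) =ᶠ[nhds y] fun y => fderiv ℝ L y v := by
      filter_upwards [hnb y hy] with z hz using e1 z hz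
    rw [this.lineDeriv_eq, ((f1 y hy).hasLineDerivAt v).lineDeriv]; rfl
  have f2 : ∀ y ∈ jetDomain n m, HasLineDerivAt ℝ (fun y => fderiv ℝ (fderiv ℝ L) y v v) 0 y v := by
    intro y hy
    have hd : DifferentiableAt ℝ (fun y => fderiv ℝ (fderiv ℝ L) y v v) y :=
      ((d2 y hy).clm_apply (differentiableAt_const v)).clm_apply (differentiableAt_const v)
    have : (fun y => lineDeriv ℝ (fun y => lineDeriv ℝ L y v) y v)
        =ᶠ[nhds y] fun y => fderiv ℝ (fderiv ℝ L) y v v := by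
      filter_upwards [hnb y hy] with z hz using e2 z hz
    have h0 := hquad y hy v v v hv hv hv
    rw [this.lineDeriv_eq] at h0
    rw [← h0]
    exact hd.lineDifferentiableAt.hasLineDerivAt
  -- Along the line through the base point the third derivative vanishes.
  have hline : ∀ (F : JetSpace n m → ℝ) (F' : ℝ) (t : ℝ),
      HasLineDerivAt ℝ F F' (basePoint w + t • v) v →
      HasDerivAt (fun s : ℝ => F (basePoint w + s • v)) F' t := by
    intro F F' t h
    have h' : HasDerivAt (fun s : ℝ => F (basePoint w + t • v + s • v)) F' (t - t) := by
      rw [sub_self]; exact h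
    have := h'.comp_sub_const t t
    refine this.congr_of_eventuallyEq (Filter.Eventually.of_forall fun s => ?_)
    simp only []
    congr 1
    rw [add_assoc, ← add_smul]; simp
  set c2 := fderiv ℝ (fderiv ℝ L) (basePoint w) v v with hc2
  set c1 := fderiv ℝ L (basePoint w) v with hc1
  have k2 : ∀ t : ℝ, fderiv ℝ (fderiv ℝ L) (basePoint w + t • v) v v = c2 := by
    intro t
    have h := is_const_of_deriv_eq_zero
      (f := fun s : ℝ => fderiv ℝ (fderiv ℝ L) (basePoint w + s • v) v v)
      (fun s => (hline _ _ s (f2 _ (hdom s))).differentiableAt)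
      (fun s => (hline _ _ s (f2 _ (hdom s))).deriv) t 0
    simpa using h
  have k1 : ∀ t : ℝ, fderiv ℝ L (basePoint w + t • v) v = c1 + t * c2 := by
    intro t
    have hd : ∀ s : ℝ, HasDerivAt (fun s : ℝ => fderiv ℝ L (basePoint w + s • v) v - s * c2) 0 s := by
      intro s
      have := (hline _ _ s ((f1 _ (hdom s)).hasLineDerivAt v)).sub
        ((hasDerivAt_id s).mul_const c2)
      rw [ContinuousLinearMap.flip_apply, k2, one_mul, sub_self] at this
      exact this
    have h := is_const_of_deriv_eq_zero (fun s => (hd s).differentiableAt)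
      (fun s => (hd s).deriv) t 0
    simp at h
    linarith
  have k0 : ∀ t : ℝ, L (basePoint w + t • v) = L (basePoint w) + t * c1 + t ^ 2 * (c2 / 2) := by
    intro t
    have hd : ∀ s : ℝ, HasDerivAt
        (fun s : ℝ => L (basePoint w + s • v) - (s * c1 + s ^ 2 * (c2 / 2))) 0 s := by
      intro s
      have := (hline _ _ s ((d0 _ (hdom s)).hasFDerivAt.hasLineDerivAt v)).sub
        (((hasDerivAt_id s).mul_const c1).add ((hasDerivAt_pow 2 s).mul_const (c2 / 2)))
      refine this.congr_deriv ?_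
      rw [k1]; simp; ring
    have h := is_const_of_deriv_eq_zero (fun s => (hd s).differentiableAt)
      (fun s => (hd s).deriv) t 0
    simp at h
    linarith
  have := k0 1
  rw [one_smul] at this
  rw [this, linPart, quadForm]
  ring

end Taylor

/-! ### Actions of coordinate changes on jets -/

section Actions

variable {n m : ℕ}

/-- The jet direction `(0, 0, w4, 0, 0)`. -/
def incl4 (a : Fin n → Fin n → Fin n → Fin n → ℝ) : JetSpace n m := (0, 0, a, 0, 0)

/-- The jet direction `(0, w3, 0, 0, 0)`. -/
def incl3 (a : Fin n → Fin n → Fin n → ℝ) : JetSpace n m := (0, a, 0, 0, 0)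

/-- The jet direction `(0, 0, 0, y, 0)`. -/
def inclY (a : (Fin m → Fin n) → ℝ) : JetSpace n m := (0, 0, 0, a, 0)

/-- The jet direction `(0, 0, 0, 0, y')`. -/
def inclDY (a : (Fin m → Fin n) → Fin n → ℝ) : JetSpace n m := (0, 0, 0, 0, a)

/-- The first derivatives `w_aj Q^a_ik + w_ia Q^a_jk` of a constant metric in coordinates with
second derivatives `Q`. -/
def shift3 (w : Fin n → Fin n → ℝ) (Q : Fin n → Fin n → Fin n → ℝ) (i j k : Fin n) : ℝ :=
  ∑ a, (w a j * Q a i k + w i a * Q a j k)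

/-- The polarization of the second derivatives of a constant metric in coordinates with
second derivatives `Q` and vanishing third derivatives. -/
def shiftQQ (w : Fin n → Fin n → ℝ) (Q R : Fin n → Fin n → Fin n → ℝ) (i j k l : Fin n) : ℝ :=
  ∑ a, ∑ b, w a b * (Q a i k * R b j l + Q a i l * R b j k)

lemma shiftQQ_swap_left {w : Fin n → Fin n → ℝ} (hw : ∀ i j, w i j = w j i)
    (Q : Fin n → Fin n → Fin n → ℝ) (i j k l : Fin n) :
    shiftQQ w Q Q i j k l = shiftQQ w Q Q j i k l := by
  simp only [shiftQQ]
  rw [Finset.sum_comm]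
  exact Finset.sum_congr rfl fun a _ => Finset.sum_congr rfl fun b _ => by
    rw [hw]; ring

lemma shiftQQ_swap_right (w : Fin n → Fin n → ℝ) (Q : Fin n → Fin n → Fin n → ℝ)
    (i j k l : Fin n) : shiftQQ w Q Q i j k l = shiftQQ w Q Q i j l k :=
  Finset.sum_congr rfl fun a _ => Finset.sum_congr rfl fun b _ => by ring

/-- The contribution of the third derivatives `C` of a coordinate change to the second derivatives
of a metric. -/
def shiftC (w : Fin n → Fin n → ℝ) (C : Fin n → Fin n → Fin n → Fin n → ℝ)
    (i j k l : Fin n) : ℝ :=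
  ∑ a, (w a j * C a i k l + w i a * C a j k l)

/-- The contribution `∑ₐ Q^k_{iₐj} y_{I[a→k]}` of the second derivatives of a coordinate change to
the first derivatives of the components of a covariant tensor. -/
def shiftY (Q : Fin n → Fin n → Fin n → ℝ) (y : (Fin m → Fin n) → ℝ) (I : Fin m → Fin n)
    (j : Fin n) : ℝ :=
  ∑ a, ∑ k, Q k (I a) j * y (Function.update I a k)

/-- The identity matrix, as an array. -/
def delta (i j : Fin n) : ℝ := if i = j then 1 else 0

lemma prod_delta {ι : Type*} [DecidableEq ι] (s : Finset ι) (A I : ι → Fin n) :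
    ∏ c ∈ s, delta (A c) (I c) = if ∀ c ∈ s, A c = I c then 1 else 0 := by
  simp only [delta]
  exact Finset.prod_ite_zero.trans (by simp)

lemma sum_mul_prod_erase_delta (a : Fin m) (I : Fin m → Fin n) (F : (Fin m → Fin n) → ℝ) :
    ∑ A, F A * ∏ c ∈ Finset.univ.erase a, delta (A c) (I c)
      = ∑ k, F (Function.update I a k) := by
  classical
  have hinj : Function.Injective (fun k => Function.update I a k) :=
    Function.update_injective I a
  rw [← Finset.sum_image (s := Finset.univ) (f := F) hinj.injOn]
  symm
  rw [Finset.sum_subset_zero_on_sdiff (Finset.subset_univ _)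
    (g := fun A => F A * ∏ c ∈ Finset.univ.erase a, delta (A c) (I c))]
  · intro A hA
    rw [prod_delta, if_neg, mul_zero]
    intro h
    apply (Finset.mem_sdiff.1 hA).2
    refine Finset.mem_image.2 ⟨A a, Finset.mem_univ _, ?_⟩
    funext c
    by_cases hc : c = a
    · subst hc; simp
    · simp [hc, h c (Finset.mem_erase.2 ⟨hc, Finset.mem_univ _⟩)]
  · intro A hA
    obtain ⟨k, _, rfl⟩ := Finset.mem_image.1 hA
    rw [prod_delta, if_pos, mul_one]
    intro c hc
    rw [Function.update_of_ne (Finset.mem_erase.1 hc).1]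

lemma sum_mul_prod_delta (I : Fin m → Fin n) (F : (Fin m → Fin n) → ℝ) :
    ∑ A, F A * ∏ c, delta (A c) (I c) = F I := by
  rw [Finset.sum_eq_single I]
  · rw [prod_delta, if_pos (fun _ _ => rfl), mul_one]
  · intro A _ hA
    rw [prod_delta, if_neg (fun h => hA (funext fun c => h c (Finset.mem_univ c))), mul_zero]
  · simp

lemma pullT_delta (y : (Fin m → Fin n) → ℝ) : pullT delta y = y :=
  funext fun I => sum_mul_prod_delta I y

/-- The pull-back of a bilinear form. -/
def pull2 (S : Fin n → Fin n → ℝ) (w : Fin n → Fin n → ℝ) (i j : Fin n) : ℝ :=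
  ∑ a, ∑ b, w a b * (S a i * S b j)

/-- The pull-back of a four-tensor. -/
def pull4 (S : Fin n → Fin n → ℝ) (w4 : Fin n → Fin n → Fin n → Fin n → ℝ) (i j k l : Fin n) : ℝ :=
  ∑ a, ∑ b, (∑ c, ∑ d, w4 a b c d * (S c k * S d l)) * (S a i * S b j)

/-- The pull-back of a tensor with `m + 1` indices. -/
def pullDY (S : Fin n → Fin n → ℝ) (y' : (Fin m → Fin n) → Fin n → ℝ) (I : Fin m → Fin n)
    (j : Fin n) : ℝ :=
  ∑ A, (∑ b, y' A b * S b j) * ∏ a, S (A a) (I a)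

lemma sum_mul_delta (F : Fin n → ℝ) (j : Fin n) : ∑ b, F b * delta b j = F j := by
  simp [delta]

lemma pull2_delta (w : Fin n → Fin n → ℝ) : pull2 delta w = w := by
  funext i j
  simp [pull2, delta]

lemma pullJet_linear (w : Fin n → Fin n → ℝ) (w4 : Fin n → Fin n → Fin n → Fin n → ℝ)
    (y : (Fin m → Fin n) → ℝ) (y' : (Fin m → Fin n) → Fin n → ℝ) (S : Fin n → Fin n → ℝ) :
    pullJet w w4 y y' S 0 0
      = basePoint (pull2 S w) + (incl4 (pull4 S w4) + inclY (pullT S y) + inclDY (pullDY S y')) := by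
  simp only [pullJet, basePoint, incl4, inclY, inclDY]
  refine Prod.ext ?_ (Prod.ext ?_ (Prod.ext ?_ (Prod.ext ?_ ?_))) <;> simp <;> funext <;>
    simp [pull2, pull4, pullDY]

lemma pullJet_delta (w : Fin n → Fin n → ℝ) (w4 : Fin n → Fin n → Fin n → Fin n → ℝ)
    (y : (Fin m → Fin n) → ℝ) (y' : (Fin m → Fin n) → Fin n → ℝ)
    (Q : Fin n → Fin n → Fin n → ℝ) (C : Fin n → Fin n → Fin n → Fin n → ℝ) :
    pullJet w w4 y y' delta Q C
      = basePoint w + ((incl4 w4 + inclY y + inclDY y')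
        + (incl3 (shift3 w Q) + incl4 (shiftQQ w Q Q) + incl4 (shiftC w C)
            + inclDY (shiftY Q y))) := by
  simp only [pullJet, basePoint, incl4, inclY, inclDY, incl3]
  refine Prod.ext ?_ (Prod.ext ?_ (Prod.ext ?_ (Prod.ext ?_ ?_)))
  · simp only [Prod.fst_add, add_zero]
    exact pull2_delta w
  · funext i j k
    simp [shift3, delta, mul_add, Finset.sum_add_distrib]
  · funext i j k l
    simp [shiftQQ, shiftC, delta, mul_add, Finset.sum_add_distrib]
    ring
  · simp [pullT_delta]
  · funext I j
    simp only [sum_mul_delta, sum_mul_prod_delta]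
    simp [shiftY]
    simp_rw [Finset.mul_sum, ← mul_assoc]
    rw [Finset.sum_comm]
    refine Finset.sum_congr rfl fun a _ => ?_
    rw [sum_mul_prod_erase_delta a I (fun A => y A * Q (A a) (I a) j)]
    simp [mul_comm]

end Actions

/-! ### Linear functionals on second derivatives of metrics -/

section CurvatureFunctional

variable {n : ℕ}

/-- The tensor product of four coordinate covectors. -/
def unit4 (p q r s : Fin n) (i j k l : Fin n) : ℝ := delta p i * delta q j * delta r k * delta s l

/-- The symmetrization of `unit4 p q r s` in the first and in the last pair of arguments. -/
def symUnit4 (p q r s : Fin n) : Fin n → Fin n → Fin n → Fin n → ℝ :=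
  unit4 p q r s + unit4 q p r s + unit4 p q s r + unit4 q p s r

lemma eq_sum_unit4 (a : Fin n → Fin n → Fin n → Fin n → ℝ) :
    a = ∑ p, ∑ q, ∑ r, ∑ s, a p q r s • unit4 p q r s := by
  funext i j k l
  simp [Finset.sum_apply, unit4, delta]

/-- A linear functional on arrays with the symmetries of the second derivatives of a metric is
determined by its values on the symmetrized tensors `symUnit4`, each entry being met four times. -/
lemma four_mul_map_eq_sum (f : (Fin n → Fin n → Fin n → Fin n → ℝ) →ₗ[ℝ] ℝ)
    {a : Fin n → Fin n → Fin n → Fin n → ℝ} (ha : ∀ i j k l, a i j k l = a j i k l)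
    (ha' : ∀ i j k l, a i j k l = a i j l k) :
    4 * f a = ∑ p, ∑ q, ∑ r, ∑ s, a p q r s * f (symUnit4 p q r s) := by
  have h0 : f a = ∑ p, ∑ q, ∑ r, ∑ s, a p q r s * f (unit4 p q r s) := by
    conv_lhs => rw [eq_sum_unit4 a]
    simp
  have h1 : f a = ∑ p, ∑ q, ∑ r, ∑ s, a p q r s * f (unit4 q p r s) := by
    rw [h0, Finset.sum_comm]
    exact Finset.sum_congr rfl fun p _ => Finset.sum_congr rfl fun q _ =>
      Finset.sum_congr rfl fun r _ => Finset.sum_congr rfl fun s _ => by rw [ha]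
  have swap : ∀ G : Fin n → Fin n → Fin n → Fin n → ℝ,
      ∑ p, ∑ q, ∑ r, ∑ s, a p q r s * G p q r s = ∑ p, ∑ q, ∑ r, ∑ s, a p q r s * G p q s r := by
    intro G
    refine Finset.sum_congr rfl fun p _ => Finset.sum_congr rfl fun q _ => ?_
    rw [Finset.sum_comm]
    exact Finset.sum_congr rfl fun r _ => Finset.sum_congr rfl fun s _ => by rw [ha']
  have h2 := h0.trans (swap fun p q r s => f (unit4 p q r s))
  have h3 := h1.trans (swap fun p q r s => f (unit4 q p r s))
  simp only [symUnit4, map_add, mul_add, Finset.sum_add_distrib]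
  rw [← h0, ← h1, ← h2, ← h3]; ring

variable {w h : Fin n → Fin n → ℝ} {f : (Fin n → Fin n → Fin n → Fin n → ℝ) →ₗ[ℝ] ℝ}

lemma delta_comm (i j : Fin n) : delta i j = delta j i := by
  simp [delta, eq_comm]

lemma symUnit4_swap_left (p q r s : Fin n) : symUnit4 p q r s = symUnit4 q p r s := by
  simp only [symUnit4]; abel

lemma symUnit4_swap_right (p q r s : Fin n) : symUnit4 p q r s = symUnit4 p q s r := by
  simp only [symUnit4]; abel

/-- A functional which ignores the third derivatives of coordinate changes satisfies the first
Bianchi identity. -/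
lemma map_symUnit4_cyclic (hsymm : ∀ i j, w i j = w j i)
    (hwh : ∀ i j, ∑ a, w i a * h a j = delta i j)
    (hC : ∀ C : Fin n → Fin n → Fin n → Fin n → ℝ, (∀ a i j k, C a i j k = C a j i k) →
      (∀ a i j k, C a i j k = C a i k j) → f (shiftC w C) = 0) (p q r s : Fin n) :
    f (symUnit4 p q r s) + f (symUnit4 p r q s) + f (symUnit4 p s q r) = 0 := by
  let c : Fin n → Fin n → Fin n → ℝ := fun i k l =>
    delta q i * delta r k * delta s l + delta q i * delta s k * delta r l
    + delta r i * delta q k * delta s l + delta r i * delta s k * delta q l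
    + delta s i * delta q k * delta r l + delta s i * delta r k * delta q l
  have h0 := hC (fun a i k l => h a p * c i k l) (fun a i j k => by simp only [c]; ring)
    (fun a i j k => by simp only [c]; ring)
  rw [← map_add, ← map_add, ← h0]
  congr 1
  funext i j k l
  have e1 : ∑ a, w a j * (h a p * c i k l) = delta p j * c i k l := by
    rw [delta_comm, ← hwh, Finset.sum_mul]
    exact Finset.sum_congr rfl fun a _ => by rw [hsymm]; ring
  have e2 : ∑ a, w i a * (h a p * c j k l) = delta p i * c j k l := by
    rw [delta_comm, ← hwh, Finset.sum_mul]
    exact Finset.sum_congr rfl fun a _ => by ring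
  simp only [shiftC, Finset.sum_add_distrib, e1, e2, Pi.add_apply, symUnit4, unit4, c]
  ring

/-- A functional on symmetric second derivatives of metrics which ignores both the third
derivatives of coordinate changes and the second derivatives of a flat metric is zero. -/
lemma map_eq_zero_of_shift (hsymm : ∀ i j, w i j = w j i)
    (hwh : ∀ i j, ∑ a, w i a * h a j = delta i j)
    (hC : ∀ C : Fin n → Fin n → Fin n → Fin n → ℝ, (∀ a i j k, C a i j k = C a j i k) →
      (∀ a i j k, C a i j k = C a i k j) → f (shiftC w C) = 0)
    (hQ : ∀ Q R : Fin n → Fin n → Fin n → ℝ, (∀ a i j, Q a i j = Q a j i) →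
      (∀ a i j, R a i j = R a j i) → f (shiftQQ w Q R + shiftQQ w R Q) = 0)
    {a : Fin n → Fin n → Fin n → Fin n → ℝ} (ha : ∀ i j k l, a i j k l = a j i k l)
    (ha' : ∀ i j k l, a i j k l = a i j l k) : f a = 0 := by
  have hcyc := map_symUnit4_cyclic hsymm hwh hC
  have hflat : ∀ q r s t : Fin n, f (symUnit4 q s r t) + f (symUnit4 q t r s)
      + f (symUnit4 r s q t) + f (symUnit4 r t q s) = 0 := by
    intro q r s t
    let σ : Fin n → Fin n → ℝ := fun i k => delta q i * delta r k + delta r i * delta q k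
    let τ : Fin n → Fin n → ℝ := fun i k => delta s i * delta t k + delta t i * delta s k
    have h0 := hQ (fun a i k => h a q * σ i k) (fun a i k => delta a q * τ i k)
      (fun a i j => by simp only [σ]; ring) (fun a i j => by simp only [τ]; ring)
    have hqq : ∑ a, w q a * h a q = 1 := by rw [hwh]; simp [delta]
    rw [← map_add, ← map_add, ← map_add, ← h0]
    congr 1
    funext i j k l
    have e1 : ∀ X Y X' Y' : ℝ, ∑ a, ∑ b, w a b * (h a q * X * (delta b q * Y)
        + h a q * X' * (delta b q * Y')) = X * Y + X' * Y' := by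
      intro X Y X' Y'
      have : ∀ a, ∑ b, w a b * (h a q * X * (delta b q * Y) + h a q * X' * (delta b q * Y'))
          = w q a * h a q * (X * Y + X' * Y') := by
        intro a
        rw [← hsymm a q]
        rw [show w a q * h a q * (X * Y + X' * Y')
          = w a q * (h a q * X * Y + h a q * X' * Y') by ring,
          ← sum_mul_delta (fun b => w a b * (h a q * X * Y + h a q * X' * Y')) q]
        exact Finset.sum_congr rfl fun b _ => by ring
      simp_rw [this]
      rw [← Finset.sum_mul, hqq, one_mul]
    have e2 : ∀ X Y X' Y' : ℝ, ∑ a, ∑ b, w a b * (delta a q * Y * (h b q * X)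
        + delta a q * Y' * (h b q * X')) = X * Y + X' * Y' := by
      intro X Y X' Y'
      rw [Finset.sum_comm, ← e1]
      exact Finset.sum_congr rfl fun a _ => Finset.sum_congr rfl fun b _ => by
        rw [hsymm]; ring
    simp only [shiftQQ, Pi.add_apply, e1, e2, symUnit4, unit4, σ, τ]
    ring
  have hl : ∀ p q r s : Fin n, f (symUnit4 p q r s) = f (symUnit4 q p r s) := fun p q r s => by
    rw [symUnit4_swap_left]
  have hr : ∀ p q r s : Fin n, f (symUnit4 p q r s) = f (symUnit4 p q s r) := fun p q r s => by
    rw [symUnit4_swap_right]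
  have hzero : ∀ p q r s : Fin n, f (symUnit4 p q r s) = 0 := by
    intro p q r s
    -- Cyclicity at each of the four indices gives the symmetry under exchange of pairs.
    have pair : ∀ a b c d : Fin n, f (symUnit4 a b c d) = f (symUnit4 c d a b) := by
      intro a b c d
      have c1 := hcyc a b c d
      have c2 := hcyc b a c d
      have c3 := hcyc c a b d
      have c4 := hcyc d a b c
      linarith [hl a b c d, hl a c b d, hl a d b c, hl b c a d, hl b d a c, hl c d a b]
    have c1 := hcyc p r q s
    have c2 := hflat p q r s
    have c3 := hflat p q s r
    linarith [pair p r q s, pair p s q r, hl p q r s, hl p r q s, hl p s q r, hl q r p s,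
      hl q s p r, pair p q r s, hr q r p s, hr q s p r, hr p s r q, hr p r s q, hr p r q s,
      hr p s q r]
  have := four_mul_map_eq_sum f ha ha'
  simp only [hzero, mul_zero, Finset.sum_const_zero] at this
  linarith

end CurvatureFunctional

/-! ### The normal form of an invariant quadratic Lagrangian -/

section NormalForm

variable {n m : ℕ}

lemma incl3_smul (t : ℝ) (a : Fin n → Fin n → Fin n → ℝ) :
    (incl3 (t • a) : JetSpace n m) = t • incl3 a := by simp [incl3]

lemma incl4_smul (t : ℝ) (a : Fin n → Fin n → Fin n → Fin n → ℝ) :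
    (incl4 (t • a) : JetSpace n m) = t • incl4 a := by simp [incl4]

lemma incl4_add (a b : Fin n → Fin n → Fin n → Fin n → ℝ) :
    (incl4 (a + b) : JetSpace n m) = incl4 a + incl4 b := by simp [incl4]

lemma inclY_smul (t : ℝ) (a : (Fin m → Fin n) → ℝ) :
    (inclY (t • a) : JetSpace n m) = t • inclY a := by simp [inclY]

lemma inclY_add (a b : (Fin m → Fin n) → ℝ) :
    (inclY (a + b) : JetSpace n m) = inclY a + inclY b := by simp [inclY]

lemma inclDY_smul (t : ℝ) (a : (Fin m → Fin n) → Fin n → ℝ) :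
    (inclDY (t • a) : JetSpace n m) = t • inclDY a := by simp [inclDY]

lemma inclDY_add (a b : (Fin m → Fin n) → Fin n → ℝ) :
    (inclDY (a + b) : JetSpace n m) = inclDY a + inclDY b := by simp [inclDY]

lemma incl3_zero : (incl3 0 : JetSpace n m) = 0 := rfl
lemma incl4_zero : (incl4 0 : JetSpace n m) = 0 := rfl
lemma inclY_zero : (inclY 0 : JetSpace n m) = 0 := rfl
lemma inclDY_zero : (inclDY 0 : JetSpace n m) = 0 := rfl

lemma shift3_smul (w : Fin n → Fin n → ℝ) (t : ℝ) (Q : Fin n → Fin n → Fin n → ℝ) :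
    shift3 w (t • Q) = t • shift3 w Q := by
  funext i j k
  simp only [shift3, Pi.smul_apply, smul_eq_mul, Finset.mul_sum]
  exact Finset.sum_congr rfl fun a _ => by ring

lemma shiftQQ_smul (w : Fin n → Fin n → ℝ) (t : ℝ) (Q : Fin n → Fin n → Fin n → ℝ) :
    shiftQQ w (t • Q) (t • Q) = t ^ 2 • shiftQQ w Q Q := by
  funext i j k l
  simp only [shiftQQ, Pi.smul_apply, smul_eq_mul, Finset.mul_sum]
  exact Finset.sum_congr rfl fun a _ => Finset.sum_congr rfl fun b _ => by ring

lemma shiftQQ_add (w : Fin n → Fin n → ℝ) (Q R : Fin n → Fin n → Fin n → ℝ) :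
    shiftQQ w (Q + R) (Q + R)
      = shiftQQ w Q Q + shiftQQ w R R + (shiftQQ w Q R + shiftQQ w R Q) := by
  funext i j k l
  simp only [shiftQQ, Pi.add_apply, ← Finset.sum_add_distrib]
  exact Finset.sum_congr rfl fun a _ => Finset.sum_congr rfl fun b _ => by ring

lemma shiftY_smul (t : ℝ) (Q : Fin n → Fin n → Fin n → ℝ) (y : (Fin m → Fin n) → ℝ) :
    shiftY (t • Q) y = t • shiftY Q y := by
  funext I j
  simp only [shiftY, Pi.smul_apply, smul_eq_mul, Finset.mul_sum]
  exact Finset.sum_congr rfl fun a _ => Finset.sum_congr rfl fun b _ => by ring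

lemma shiftY_zero (Q : Fin n → Fin n → Fin n → ℝ) : shiftY Q (0 : (Fin m → Fin n) → ℝ) = 0 := by
  funext I j; simp [shiftY]

lemma shift3_zero (w : Fin n → Fin n → ℝ) : shift3 w 0 = 0 := by
  funext i j k; simp [shift3]

lemma shiftQQ_zero (w : Fin n → Fin n → ℝ) : shiftQQ w 0 0 = 0 := by
  funext i j k l; simp [shiftQQ]

lemma shiftC_zero (w : Fin n → Fin n → ℝ) : shiftC w 0 = 0 := by
  funext i j k l; simp [shiftC]

lemma shiftY_zero_left (y : (Fin m → Fin n) → ℝ) : shiftY (0 : Fin n → Fin n → Fin n → ℝ) y = 0 := by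
  funext I j; simp [shiftY]

/-- The jet direction `(0, 0, w4, y, y')`. -/
def jetDir (w4 : Fin n → Fin n → Fin n → Fin n → ℝ) (y : (Fin m → Fin n) → ℝ)
    (y' : (Fin m → Fin n) → Fin n → ℝ) : JetSpace n m :=
  incl4 w4 + inclY y + inclDY y'

lemma det_delta : (Matrix.of (delta : Fin n → Fin n → ℝ)).det = 1 := by
  have : Matrix.of (delta : Fin n → Fin n → ℝ) = 1 := by
    ext i j; simp [delta, Matrix.one_apply]
  rw [this, Matrix.det_one]

variable {L : JetSpace n m → ℝ} {w : Fin n → Fin n → ℝ}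

/-- Invariance under coordinate changes with first derivative the identity. -/
lemma IsCoordinateInvariant.shift (hinv : IsCoordinateInvariant.{u} L) (hw : IsLorentzForm w)
    {w4 : Fin n → Fin n → Fin n → Fin n → ℝ} (hw4 : ∀ a b c d, w4 a b c d = w4 b a c d)
    (hw4' : ∀ a b c d, w4 a b c d = w4 a b d c)
    (y : (Fin m → Fin n) → ℝ) (y' : (Fin m → Fin n) → Fin n → ℝ)
    {Q : Fin n → Fin n → Fin n → ℝ} {C : Fin n → Fin n → Fin n → Fin n → ℝ}
    (hQ : ∀ a i j, Q a i j = Q a j i) (hC : ∀ a i j k, C a i j k = C a j i k)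
    (hC' : ∀ a i j k, C a i j k = C a i k j) :
    L (basePoint w + (jetDir w4 y y' + (incl3 (shift3 w Q) + incl4 (shiftQQ w Q Q)
      + incl4 (shiftC w C) + inclDY (shiftY Q y)))) = L (basePoint w + jetDir w4 y y') := by
  obtain ⟨val, hval⟩ := hinv.exists_value hw hw4 hw4' y y'
  have h1 := hval delta Q C (by rw [det_delta]; exact one_ne_zero) hQ hC hC'
  have h2 := hval delta 0 0 (by rw [det_delta]; exact one_ne_zero) (fun _ _ _ => rfl)
    (fun _ _ _ _ => rfl) (fun _ _ _ _ => rfl)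
  rw [pullJet_delta] at h1 h2
  rw [shift3_zero, shiftQQ_zero, shiftC_zero, shiftY_zero_left, incl3_zero, incl4_zero,
    inclDY_zero] at h2
  simp only [add_zero] at h2
  exact h1.trans h2.symm

/-- Invariance under linear coordinate changes. -/
lemma IsCoordinateInvariant.linear (hinv : IsCoordinateInvariant.{u} L) (hw : IsLorentzForm w)
    {w4 : Fin n → Fin n → Fin n → Fin n → ℝ} (hw4 : ∀ a b c d, w4 a b c d = w4 b a c d)
    (hw4' : ∀ a b c d, w4 a b c d = w4 a b d c)
    (y : (Fin m → Fin n) → ℝ) (y' : (Fin m → Fin n) → Fin n → ℝ)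
    {S : Fin n → Fin n → ℝ} (hS : (Matrix.of S).det ≠ 0) :
    L (basePoint (pull2 S w) + jetDir (pull4 S w4) (pullT S y) (pullDY S y'))
      = L (basePoint w + jetDir w4 y y') := by
  obtain ⟨val, hval⟩ := hinv.exists_value hw hw4 hw4' y y'
  have h1 := hval S 0 0 hS (fun _ _ _ => rfl) (fun _ _ _ _ => rfl) (fun _ _ _ _ => rfl)
  have h2 := hval delta 0 0 (by rw [det_delta]; exact one_ne_zero) (fun _ _ _ => rfl)
    (fun _ _ _ _ => rfl) (fun _ _ _ _ => rfl)
  rw [pullJet_linear] at h1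
  rw [pullJet_delta] at h2
  rw [shift3_zero, shiftQQ_zero, shiftC_zero, shiftY_zero_left, incl3_zero, incl4_zero,
    inclDY_zero] at h2
  simp only [add_zero] at h2
  exact h1.trans h2.symm

lemma jetDir_fst (w4 : Fin n → Fin n → Fin n → Fin n → ℝ) (y : (Fin m → Fin n) → ℝ)
    (y' : (Fin m → Fin n) → Fin n → ℝ) : (jetDir w4 y y').1 = 0 := by
  simp [jetDir, incl4, inclY, inclDY]

lemma exists_inverse_array (hw : IsLorentzForm w) : ∃ h : Fin n → Fin n → ℝ,
    ∀ i j, ∑ a, w i a * h a j = delta i j := by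
  refine ⟨fun i j => (Matrix.of w)⁻¹ i j, fun i j => ?_⟩
  have := congrFun (congrFun (Matrix.mul_nonsing_inv (Matrix.of w)
    (isUnit_iff_ne_zero.2 hw.det_ne_zero)) i) j
  rw [Matrix.mul_apply] at this
  simpa [Matrix.one_apply, delta] using this

section Quadratic

variable (hL : ContDiffOn ℝ ∞ L (jetDomain n m)) (hquad : IsQuadraticInDerivatives L)
  (hinv : IsCoordinateInvariant.{u} L) (hw : IsLorentzForm w)
  {w4 : Fin n → Fin n → Fin n → Fin n → ℝ} (hw4 : ∀ a b c d, w4 a b c d = w4 b a c d)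
  (hw4' : ∀ a b c d, w4 a b c d = w4 a b d c)
  (y : (Fin m → Fin n) → ℝ) (y' : (Fin m → Fin n) → Fin n → ℝ)

include hL hquad hinv hw

include hw4 hw4' in
/-- Invariance of the Taylor polynomial: its value does not change when the jet is displaced by the
effect `d` of a coordinate change tangent to the identity. -/
lemma taylor_shift {Q : Fin n → Fin n → Fin n → ℝ} {C : Fin n → Fin n → Fin n → Fin n → ℝ}
    (hQ : ∀ a i j, Q a i j = Q a j i) (hC : ∀ a i j k, C a i j k = C a j i k)
    (hC' : ∀ a i j k, C a i j k = C a i k j) {d : JetSpace n m}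
    (hd : d = incl3 (shift3 w Q) + incl4 (shiftQQ w Q Q)
      + incl4 (shiftC w C) + inclDY (shiftY Q y)) :
    linPart L w d + 2 * quadForm L w (jetDir w4 y y') d + quadForm L w d d = 0 := by
  have h := hinv.shift hw hw4 hw4' y y' hQ hC hC'
  rw [← hd] at h
  have hd1 : d.1 = 0 := by rw [hd]; simp [incl3, incl4, inclDY]
  have hnd : w ∈ nondegenerate n := hw.det_ne_zero
  rw [eq_taylor hL hquad hnd (by simp [jetDir_fst, hd1]),
    eq_taylor hL hquad hnd (jetDir_fst _ _ _), linPart_add, quadForm_add_left,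
    quadForm_add_right, quadForm_add_right, quadForm_symm hL hnd d] at h
  linarith

include hw4 hw4' in
/-- The case of `taylor_shift` in which the coordinate change differs from the identity by terms of
third order. -/
lemma taylor_shiftC {C : Fin n → Fin n → Fin n → Fin n → ℝ}
    (hC : ∀ a i j k, C a i j k = C a j i k) (hC' : ∀ a i j k, C a i j k = C a i k j) :
    linPart L w (incl4 (shiftC w C)) + 2 * quadForm L w (jetDir w4 y y') (incl4 (shiftC w C))
      + quadForm L w (incl4 (shiftC w C)) (incl4 (shiftC w C)) = 0 :=
  taylor_shift hL hquad hinv hw hw4 hw4' y y' (Q := 0) (fun _ _ _ => rfl) hC hC' (by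
    rw [shift3_zero, shiftQQ_zero, shiftY_zero_left, incl3_zero, incl4_zero, inclDY_zero]
    simp)

/-- Third derivatives of coordinate changes affect neither the linear nor the quadratic part. For
the linear part this uses the quadratic one on the displacement itself. -/
lemma linPart_quadForm_shiftC {C : Fin n → Fin n → Fin n → Fin n → ℝ}
    (hC : ∀ a i j k, C a i j k = C a j i k) (hC' : ∀ a i j k, C a i j k = C a i k j) :
    linPart L w (incl4 (shiftC w C)) = 0 ∧
    ∀ (w4 : Fin n → Fin n → Fin n → Fin n → ℝ) (y : (Fin m → Fin n) → ℝ)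
      (y' : (Fin m → Fin n) → Fin n → ℝ), (∀ a b c d, w4 a b c d = w4 b a c d) →
      (∀ a b c d, w4 a b c d = w4 a b d c) →
      quadForm L w (jetDir w4 y y') (incl4 (shiftC w C)) = 0 := by
  have h0 := taylor_shiftC hL hquad hinv hw (w4 := 0) (fun _ _ _ _ => rfl) (fun _ _ _ _ => rfl)
    0 0 hC hC'
  have hz : quadForm L w (jetDir 0 0 0) (incl4 (shiftC w C)) = 0 := by
    simp [jetDir, incl4_zero, inclY_zero, inclDY_zero, quadForm]
  have hq : ∀ (w4 : Fin n → Fin n → Fin n → Fin n → ℝ) (y : (Fin m → Fin n) → ℝ)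
      (y' : (Fin m → Fin n) → Fin n → ℝ), (∀ a b c d, w4 a b c d = w4 b a c d) →
      (∀ a b c d, w4 a b c d = w4 a b d c) →
      quadForm L w (jetDir w4 y y') (incl4 (shiftC w C)) = 0 := by
    intro w4 y y' h1 h2
    have := taylor_shiftC hL hquad hinv hw h1 h2 y y' hC hC'
    linarith
  refine ⟨?_, hq⟩
  have hd := hq (shiftC w C) 0 0
    (fun i j k l => Finset.sum_congr rfl fun a _ => by rw [hw.symm a j, hw.symm i a]; ring)
    (fun i j k l => Finset.sum_congr rfl fun a _ => by rw [hC' a i k l, hC' a j k l])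
  have : (jetDir (shiftC w C) 0 0 : JetSpace n m) = incl4 (shiftC w C) := by
    simp [jetDir, inclY_zero, inclDY_zero]
  rw [this] at hd
  linarith

include hw4 hw4' in
/-- The first and second order terms, in the size of a quadratic coordinate change, of the
invariance of the Taylor polynomial. -/
lemma taylor_shiftQ {Q : Fin n → Fin n → Fin n → ℝ} (hQ : ∀ a i j, Q a i j = Q a j i) :
    linPart L w (incl3 (shift3 w Q) + inclDY (shiftY Q y))
      + 2 * quadForm L w (jetDir w4 y y') (incl3 (shift3 w Q) + inclDY (shiftY Q y)) = 0 ∧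
    linPart L w (incl4 (shiftQQ w Q Q))
      + 2 * quadForm L w (jetDir w4 y y') (incl4 (shiftQQ w Q Q))
      + quadForm L w (incl3 (shift3 w Q) + inclDY (shiftY Q y))
          (incl3 (shift3 w Q) + inclDY (shiftY Q y)) = 0 := by
  set a : JetSpace n m := incl3 (shift3 w Q) + inclDY (shiftY Q y) with ha
  set b : JetSpace n m := incl4 (shiftQQ w Q Q) with hb
  have key : ∀ t : ℝ, linPart L w (t • a + t ^ 2 • b)
      + 2 * quadForm L w (jetDir w4 y y') (t • a + t ^ 2 • b)
      + quadForm L w (t • a + t ^ 2 • b) (t • a + t ^ 2 • b) = 0 := fun t =>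
    taylor_shift hL hquad hinv hw hw4 hw4' y y' (Q := t • Q) (C := 0)
      (fun a i j => by simp [hQ a i j]) (fun _ _ _ _ => rfl) (fun _ _ _ _ => rfl) (by
        rw [shiftC_zero, incl4_zero, shift3_smul, shiftQQ_smul, shiftY_smul, incl3_smul,
          incl4_smul, inclDY_smul, ha, hb]
        module)
  simp only [linPart_add, linPart_smul, quadForm_add_left, quadForm_add_right,
    quadForm_smul_left, quadForm_smul_right] at key
  have k1 := key 1
  have k2 := key (-1)
  have k3 := key 2
  have k4 := key (-2)
  norm_num at k1 k2 k3 k4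
  -- `key` is a polynomial of degree four in `t` without constant term; these values determine it.
  constructor <;> linarith

/-- Comparison of the terms bilinear in `y` and `y'`, and linear in `y'`, of the first order relation
of `taylor_shiftQ`. -/
lemma quadForm_inclDY_shiftY {Q : Fin n → Fin n → Fin n → ℝ} (hQ : ∀ a i j, Q a i j = Q a j i) :
    quadForm L w (inclDY y') (inclDY (shiftY Q y)) = 0 ∧
    quadForm L w (inclDY y') (incl3 (shift3 w Q)) = 0 := by
  have hs : ∀ a b c d, (0 : Fin n → Fin n → Fin n → Fin n → ℝ) a b c d = 0 := fun _ _ _ _ => rfl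
  have h1 := (taylor_shiftQ hL hquad hinv hw (w4 := 0) (fun _ _ _ _ => rfl) (fun _ _ _ _ => rfl)
    y y' hQ).1
  have h2 := (taylor_shiftQ hL hquad hinv hw (w4 := 0) (fun _ _ _ _ => rfl) (fun _ _ _ _ => rfl)
    y 0 hQ).1
  have h3 := (taylor_shiftQ hL hquad hinv hw (w4 := 0) (fun _ _ _ _ => rfl) (fun _ _ _ _ => rfl)
    0 y' hQ).1
  have h4 := (taylor_shiftQ hL hquad hinv hw (w4 := 0) (fun _ _ _ _ => rfl) (fun _ _ _ _ => rfl)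
    0 0 hQ).1
  simp only [jetDir, shiftY_zero, incl4_zero, inclY_zero, inclDY_zero, zero_add, add_zero,
    quadForm_add_left, quadForm_add_right] at h1 h2 h3 h4
  have hz : quadForm L w 0 (incl3 (shift3 w Q)) = 0 := by simp [quadForm]
  constructor <;> linarith

include hw4 hw4' in
/-- Comparison of the second order relation of `taylor_shiftQ` at a jet with the same relation at the
zero jet: the terms quadratic in the first order displacement agree. -/
lemma quadForm_shiftQQ {Q : Fin n → Fin n → Fin n → ℝ} (hQ : ∀ a i j, Q a i j = Q a j i) :
    quadForm L w (jetDir w4 y y') (incl4 (shiftQQ w Q Q)) = 0 := by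
  have hnd : w ∈ nondegenerate n := hw.det_ne_zero
  have h1 := (taylor_shiftQ hL hquad hinv hw hw4 hw4' y y' hQ).2
  have h2 := (taylor_shiftQ hL hquad hinv hw (w4 := 0) (fun _ _ _ _ => rfl) (fun _ _ _ _ => rfl)
    0 0 hQ).2
  have h3 := quadForm_inclDY_shiftY hL hquad hinv hw y (shiftY Q y) hQ
  have h4 := quadForm_symm hL hnd (incl3 (shift3 w Q)) (inclDY (shiftY Q y))
  have hz : quadForm L w 0 (incl4 (shiftQQ w Q Q)) = 0 := by simp [quadForm]
  rw [show (jetDir 0 0 0 : JetSpace n m) = 0 by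
    simp [jetDir, incl4_zero, inclY_zero, inclDY_zero]] at h2
  simp only [shiftY_zero, inclDY_zero, add_zero, quadForm_add_left, quadForm_add_right] at h1 h2
  linarith [h3.1, h3.2]

include hw4 hw4' in
/-- The second derivatives of the metric enter an invariant quadratic Lagrangian at most linearly,
in coordinates in which the first derivatives of the metric vanish. -/
lemma quadForm_incl4 {a : Fin n → Fin n → Fin n → Fin n → ℝ}
    (ha : ∀ i j k l, a i j k l = a j i k l) (ha' : ∀ i j k l, a i j k l = a i j l k) :
    quadForm L w (jetDir w4 y y') (incl4 a) = 0 := by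
  obtain ⟨h, hwh⟩ := exists_inverse_array hw
  let f : (Fin n → Fin n → Fin n → Fin n → ℝ) →ₗ[ℝ] ℝ :=
    { toFun := fun a => quadForm L w (jetDir w4 y y') (incl4 a)
      map_add' := fun a b => by rw [incl4_add, quadForm_add_right]
      map_smul' := fun t a => by rw [incl4_smul, quadForm_smul_right]; rfl }
  refine map_eq_zero_of_shift (f := f) hw.symm hwh ?_ ?_ ha ha'
  · intro C hC hC'
    exact (linPart_quadForm_shiftC hL hquad hinv hw hC hC').2 w4 y y' hw4 hw4'
  · intro Q R hQ hR
    have h1 : f (shiftQQ w (Q + R) (Q + R)) = 0 :=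
      quadForm_shiftQQ hL hquad hinv hw hw4 hw4' y y' (fun a i j => by simp [hQ a i j, hR a i j])
    have h2 : f (shiftQQ w Q Q) = 0 := quadForm_shiftQQ hL hquad hinv hw hw4 hw4' y y' hQ
    have h3 : f (shiftQQ w R R) = 0 := quadForm_shiftQQ hL hquad hinv hw hw4 hw4' y y' hR
    rw [shiftQQ_add, map_add, map_add, h2, h3] at h1
    simpa using h1

end Quadratic

/-! ### Equivariance of the Taylor coefficients -/

lemma of_pull2 (S w : Fin n → Fin n → ℝ) :
    Matrix.of (pull2 S w) = (Matrix.of S).transpose * Matrix.of w * Matrix.of S := by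
  ext i j
  rw [transpose_mul_mul_apply]
  simp only [Matrix.of_apply, pull2, mul_assoc]

lemma IsLorentzForm.pull2 (hw : IsLorentzForm w) {S : Fin n → Fin n → ℝ}
    (hS : (Matrix.of S).det ≠ 0) : IsLorentzForm (pull2 S w) := by
  obtain ⟨P, hP, h⟩ := hw
  refine ⟨P * Matrix.of S, by rw [Matrix.det_mul]; exact mul_ne_zero hP hS, ?_⟩
  rw [of_pull2, h, Matrix.transpose_mul]
  simp only [Matrix.mul_assoc]

lemma pull4_smul (S : Fin n → Fin n → ℝ) (t : ℝ) (a : Fin n → Fin n → Fin n → Fin n → ℝ) :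
    pull4 S (t • a) = t • pull4 S a := by
  funext i j k l
  simp only [pull4, Pi.smul_apply, smul_eq_mul, Finset.mul_sum, Finset.sum_mul, mul_assoc]

lemma pullT_smul {k : ℕ} (S : Fin n → Fin n → ℝ) (t : ℝ) (a : (Fin k → Fin n) → ℝ) :
    pullT S (t • a) = t • pullT S a := by
  funext I
  simp only [pullT, Pi.smul_apply, smul_eq_mul, Finset.mul_sum, mul_assoc]

lemma pullT_add {k : ℕ} (S : Fin n → Fin n → ℝ) (a b : (Fin k → Fin n) → ℝ) :
    pullT S (a + b) = pullT S a + pullT S b := by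
  funext I
  simp only [pullT, Pi.add_apply, add_mul, Finset.sum_add_distrib]

lemma pullDY_smul (S : Fin n → Fin n → ℝ) (t : ℝ) (a : (Fin m → Fin n) → Fin n → ℝ) :
    pullDY S (t • a) = t • pullDY S a := by
  funext I j
  simp only [pullDY, Pi.smul_apply, smul_eq_mul, Finset.mul_sum, Finset.sum_mul, mul_assoc]

lemma pullDY_add (S : Fin n → Fin n → ℝ) (a b : (Fin m → Fin n) → Fin n → ℝ) :
    pullDY S (a + b) = pullDY S a + pullDY S b := by
  funext I j
  simp only [pullDY, Pi.add_apply, add_mul, Finset.sum_add_distrib]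

lemma jetDir_smul (t : ℝ) (w4 : Fin n → Fin n → Fin n → Fin n → ℝ) (y : (Fin m → Fin n) → ℝ)
    (y' : (Fin m → Fin n) → Fin n → ℝ) :
    jetDir (t • w4) (t • y) (t • y') = t • jetDir w4 y y' := by
  simp only [jetDir, incl4_smul, inclY_smul, inclDY_smul, smul_add]

lemma pull4_zero (S : Fin n → Fin n → ℝ) :
    pull4 S (0 : Fin n → Fin n → Fin n → Fin n → ℝ) = 0 := by
  funext; simp [pull4]

lemma pullT_zero {k : ℕ} (S : Fin n → Fin n → ℝ) : pullT S (0 : (Fin k → Fin n) → ℝ) = 0 := by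
  funext; simp [pullT]

lemma pullDY_zero (S : Fin n → Fin n → ℝ) :
    pullDY S (0 : (Fin m → Fin n) → Fin n → ℝ) = 0 := by
  funext; simp [pullDY]

section Equivariance

variable (hL : ContDiffOn ℝ ∞ L (jetDomain n m)) (hquad : IsQuadraticInDerivatives L)
  (hinv : IsCoordinateInvariant.{u} L) (hw : IsLorentzForm w)
  {S : Fin n → Fin n → ℝ} (hS : (Matrix.of S).det ≠ 0)

include hL hquad hinv hw hS

/-- The Taylor coefficients are equivariant under linear coordinate changes; they are separated by
scaling the jet. -/
lemma taylor_linear {w4 : Fin n → Fin n → Fin n → Fin n → ℝ}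
    (hw4 : ∀ a b c d, w4 a b c d = w4 b a c d) (hw4' : ∀ a b c d, w4 a b c d = w4 a b d c)
    (y : (Fin m → Fin n) → ℝ) (y' : (Fin m → Fin n) → Fin n → ℝ) :
    L (basePoint (pull2 S w)) = L (basePoint w) ∧
    linPart L (pull2 S w) (jetDir (pull4 S w4) (pullT S y) (pullDY S y'))
      = linPart L w (jetDir w4 y y') ∧
    quadForm L (pull2 S w) (jetDir (pull4 S w4) (pullT S y) (pullDY S y'))
        (jetDir (pull4 S w4) (pullT S y) (pullDY S y'))
      = quadForm L w (jetDir w4 y y') (jetDir w4 y y') := by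
  have key : ∀ t : ℝ, L (basePoint (pull2 S w))
      + t * linPart L (pull2 S w) (jetDir (pull4 S w4) (pullT S y) (pullDY S y'))
      + t * (t * quadForm L (pull2 S w) (jetDir (pull4 S w4) (pullT S y) (pullDY S y'))
        (jetDir (pull4 S w4) (pullT S y) (pullDY S y')))
      = L (basePoint w) + t * linPart L w (jetDir w4 y y')
        + t * (t * quadForm L w (jetDir w4 y y') (jetDir w4 y y')) := by
    intro t
    have h := hinv.linear hw (w4 := t • w4) (fun a b c d => by simp [hw4 a b c d])
      (fun a b c d => by simp [hw4' a b c d]) (t • y) (t • y') hS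
    rw [pull4_smul, pullT_smul, pullDY_smul, jetDir_smul, jetDir_smul,
      eq_taylor hL hquad (hw.pull2 hS).det_ne_zero (by simp [jetDir_fst]),
      eq_taylor hL hquad hw.det_ne_zero (by simp [jetDir_fst])] at h
    simpa only [linPart_smul, quadForm_smul_left, quadForm_smul_right] using h
  have k0 := key 0
  have k1 := key 1
  have k2 := key (-1)
  refine ⟨?_, ?_, ?_⟩ <;> linarith

lemma eq_const_pull2 : L (basePoint (pull2 S w)) = L (basePoint w) :=
  (taylor_linear hL hquad hinv hw hS (w4 := 0) (fun _ _ _ _ => rfl) (fun _ _ _ _ => rfl) 0 0).1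

lemma linPart_pull4 {w4 : Fin n → Fin n → Fin n → Fin n → ℝ}
    (hw4 : ∀ a b c d, w4 a b c d = w4 b a c d) (hw4' : ∀ a b c d, w4 a b c d = w4 a b d c) :
    linPart L (pull2 S w) (incl4 (pull4 S w4)) = linPart L w (incl4 w4) := by
  have := (taylor_linear hL hquad hinv hw hS hw4 hw4' 0 0).2.1
  simpa [jetDir, pull4_zero, pullT_zero, pullDY_zero, inclY_zero, inclDY_zero] using this

lemma linPart_pullT (y : (Fin m → Fin n) → ℝ) :
    linPart L (pull2 S w) (inclY (pullT S y)) = linPart L w (inclY y) := by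
  have := (taylor_linear hL hquad hinv hw hS (w4 := 0) (fun _ _ _ _ => rfl)
    (fun _ _ _ _ => rfl) y 0).2.1
  simpa [jetDir, pull4_zero, pullT_zero, pullDY_zero, incl4_zero, inclDY_zero] using this

lemma linPart_pullDY (y' : (Fin m → Fin n) → Fin n → ℝ) :
    linPart L (pull2 S w) (inclDY (pullDY S y')) = linPart L w (inclDY y') := by
  have := (taylor_linear hL hquad hinv hw hS (w4 := 0) (fun _ _ _ _ => rfl)
    (fun _ _ _ _ => rfl) 0 y').2.1
  simpa [jetDir, pull4_zero, pullT_zero, pullDY_zero, incl4_zero, inclY_zero] using this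

lemma quadForm_pullT (y : (Fin m → Fin n) → ℝ) :
    quadForm L (pull2 S w) (inclY (pullT S y)) (inclY (pullT S y))
      = quadForm L w (inclY y) (inclY y) := by
  have := (taylor_linear hL hquad hinv hw hS (w4 := 0) (fun _ _ _ _ => rfl)
    (fun _ _ _ _ => rfl) y 0).2.2
  simpa [jetDir, pull4_zero, pullT_zero, pullDY_zero, incl4_zero, inclDY_zero] using this

lemma quadForm_pullDY (x' y' : (Fin m → Fin n) → Fin n → ℝ) :
    quadForm L (pull2 S w) (inclDY (pullDY S x')) (inclDY (pullDY S y'))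
      = quadForm L w (inclDY x') (inclDY y') := by
  have key : ∀ y' : (Fin m → Fin n) → Fin n → ℝ,
      quadForm L (pull2 S w) (inclDY (pullDY S y')) (inclDY (pullDY S y'))
        = quadForm L w (inclDY y') (inclDY y') := by
    intro y'
    have := (taylor_linear hL hquad hinv hw hS (w4 := 0) (fun _ _ _ _ => rfl)
      (fun _ _ _ _ => rfl) 0 y').2.2
    simpa [jetDir, pull4_zero, pullT_zero, pullDY_zero, incl4_zero, inclY_zero] using this
  have h1 := key (x' + y')
  have s1 := quadForm_symm hL (hw.pull2 hS).det_ne_zero (inclDY (pullDY S x'))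
    (inclDY (pullDY S y'))
  have s2 := quadForm_symm hL hw.det_ne_zero (inclDY x') (inclDY y')
  simp only [pullDY_add, inclDY_add, quadForm_add_left, quadForm_add_right] at h1
  linarith [key x', key y']

end Equivariance

section Expansion

variable (hL : ContDiffOn ℝ ∞ L (jetDomain n m)) (hquad : IsQuadraticInDerivatives L)
  (hinv : IsCoordinateInvariant.{u} L) (hw : IsLorentzForm w)

include hL hquad hinv hw

/-- By the invariance under `x ↦ -x`, there is no term bilinear in `D_I` and `D_{I,j}`. -/
lemma quadForm_inclY_inclDY (y : (Fin m → Fin n) → ℝ) (y' : (Fin m → Fin n) → Fin n → ℝ) :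
    quadForm L w (inclY y) (inclDY y') = 0 := by
  let S : Fin n → Fin n → ℝ := fun i j => -1 * delta i j
  have hSm : Matrix.of S = -1 := by
    ext i j
    simp only [S, delta, Matrix.of_apply, Matrix.neg_apply, Matrix.one_apply]
    ring
  have hS : (Matrix.of S).det ≠ 0 := by
    rw [hSm, Matrix.det_neg, Matrix.det_one]; simp
  have hp2 : pull2 S w = w := by
    have := of_pull2 S w
    rw [hSm] at this
    simpa using this
  have hpT : pullT S y = (-1 : ℝ) ^ m • y := by
    rw [← pullT_delta ((-1 : ℝ) ^ m • y)]
    funext I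
    simp only [pullT, S, Finset.prod_mul_distrib, Finset.prod_const, Finset.card_univ,
      Fintype.card_fin, Pi.smul_apply, smul_eq_mul]
    exact Finset.sum_congr rfl fun A _ => by ring
  have hpD : pullDY S y' = (-1 : ℝ) ^ (m + 1) • y' := by
    funext I j
    have : ∀ A, (∑ b, y' A b * S b j) * ∏ a, S (A a) (I a)
        = (-1 : ℝ) ^ (m + 1) * y' A j * ∏ a, delta (A a) (I a) := by
      intro A
      have h1 : ∑ b, y' A b * S b j = - y' A j := by
        rw [← sum_mul_delta (y' A) j, ← Finset.sum_neg_distrib]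
        exact Finset.sum_congr rfl fun b _ => by simp only [S]; ring
      rw [h1]
      simp only [S, Finset.prod_mul_distrib, Finset.prod_const, Finset.card_univ,
        Fintype.card_fin, pow_succ]
      ring
    simp only [pullDY, this, sum_mul_prod_delta]
    rfl
  have key : ∀ y' : (Fin m → Fin n) → Fin n → ℝ, pullDY S y' = (-1 : ℝ) ^ (m + 1) • y' →
      quadForm L w (jetDir 0 ((-1 : ℝ) ^ m • y) ((-1 : ℝ) ^ (m + 1) • y'))
        (jetDir 0 ((-1 : ℝ) ^ m • y) ((-1 : ℝ) ^ (m + 1) • y'))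
      = quadForm L w (jetDir 0 y y') (jetDir 0 y y') := by
    intro y' hy'
    have := (taylor_linear hL hquad hinv hw hS (w4 := 0) (fun _ _ _ _ => rfl)
      (fun _ _ _ _ => rfl) y y').2.2
    rwa [hp2, hpT, hy', pull4_zero] at this
  have k1 := key y' hpD
  have hs := quadForm_symm hL hw.det_ne_zero (inclY y) (inclDY y')
  simp only [jetDir, incl4_zero, zero_add, inclY_smul, inclDY_smul, quadForm_add_left,
    quadForm_add_right, quadForm_smul_left, quadForm_smul_right, pow_succ] at k1
  have hm : ((-1 : ℝ) ^ m) * ((-1 : ℝ) ^ m) = 1 := by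
    rw [← mul_pow]; simp
  linear_combination (-1 / 4) * k1 + (1 / 4) * hm * (quadForm L w (inclY y) (inclY y)
    - quadForm L w (inclY y) (inclDY y') - quadForm L w (inclDY y') (inclY y)
    + quadForm L w (inclDY y') (inclDY y')) + (1 / 2) * hs

/-- The value of an invariant quadratic Lagrangian on a jet for which the first derivatives of the
metric vanish. -/
lemma eq_normalForm {w4 : Fin n → Fin n → Fin n → Fin n → ℝ}
    (hw4 : ∀ a b c d, w4 a b c d = w4 b a c d) (hw4' : ∀ a b c d, w4 a b c d = w4 a b d c)
    (y : (Fin m → Fin n) → ℝ) (y' : (Fin m → Fin n) → Fin n → ℝ) :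
    L (basePoint w + jetDir w4 y y') = L (basePoint w) + linPart L w (incl4 w4)
      + linPart L w (inclY y) + linPart L w (inclDY y')
      + quadForm L w (inclY y) (inclY y) + quadForm L w (inclDY y') (inclDY y') := by
  rw [eq_taylor hL hquad hw.det_ne_zero (jetDir_fst _ _ _)]
  have hnd := hw.det_ne_zero
  have h1 := quadForm_incl4 hL hquad hinv hw hw4 hw4' y y' hw4 hw4'
  have h2 := quadForm_incl4 hL hquad hinv hw (w4 := 0) (fun _ _ _ _ => rfl) (fun _ _ _ _ => rfl)
    y y' hw4 hw4'
  have h3 := quadForm_inclY_inclDY hL hquad hinv hw y y'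
  have s1 := quadForm_symm hL hnd (inclY y) (inclDY y')
  have s2 := quadForm_symm hL hnd (inclY y) (incl4 w4)
  have s3 := quadForm_symm hL hnd (inclDY y') (incl4 w4)
  simp only [jetDir, incl4_zero, zero_add, quadForm_add_left, quadForm_add_right,
    linPart_add] at *
  linarith

/-- Passage to coordinates in which the first derivatives of the metric vanish. -/
lemma eq_normalForm_shift {Q : Fin n → Fin n → Fin n → ℝ} (hQ : ∀ a i j, Q a i j = Q a j i)
    {w4 : Fin n → Fin n → Fin n → Fin n → ℝ}
    (hw4 : ∀ a b c d, w4 a b c d = w4 b a c d) (hw4' : ∀ a b c d, w4 a b c d = w4 a b d c)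
    (y : (Fin m → Fin n) → ℝ) (y' : (Fin m → Fin n) → Fin n → ℝ) :
    L (w, shift3 w Q, w4, y, y') = L (basePoint w) + linPart L w (incl4 (w4 - shiftQQ w Q Q))
      + linPart L w (inclY y) + linPart L w (inclDY (y' - shiftY Q y))
      + quadForm L w (inclY y) (inclY y) + quadForm L w (inclDY y') (inclDY y') := by
  have h4 : ∀ a b c d, (w4 - shiftQQ w Q Q) a b c d = (w4 - shiftQQ w Q Q) b a c d :=
    fun a b c d => by simp only [Pi.sub_apply]; rw [hw4, shiftQQ_swap_left hw.symm]
  have h4' : ∀ a b c d, (w4 - shiftQQ w Q Q) a b c d = (w4 - shiftQQ w Q Q) a b d c :=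
    fun a b c d => by simp only [Pi.sub_apply]; rw [hw4', shiftQQ_swap_right]
  have h := hinv.shift hw h4 h4' y (y' - shiftY Q y) hQ (C := 0) (fun _ _ _ _ => rfl)
    (fun _ _ _ _ => rfl)
  rw [eq_normalForm hL hquad hinv hw h4 h4'] at h
  have hjet : basePoint w + (jetDir (w4 - shiftQQ w Q Q) y (y' - shiftY Q y)
      + (incl3 (shift3 w Q) + incl4 (shiftQQ w Q Q) + incl4 (shiftC w 0) + inclDY (shiftY Q y)))
      = (w, shift3 w Q, w4, y, y') := by
    simp [basePoint, jetDir, incl3, incl4, inclY, inclDY, shiftC_zero]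
  rw [hjet] at h
  rw [h]
  have hb : quadForm L w (inclDY (y' - shiftY Q y)) (inclDY (y' - shiftY Q y))
      = quadForm L w (inclDY y') (inclDY y') := by
    have e : y' - shiftY Q y = y' + (-1 : ℝ) • shiftY Q y := by simp [sub_eq_add_neg]
    have h1 := (quadForm_inclDY_shiftY hL hquad hinv hw y y' hQ).1
    have h2 := (quadForm_inclDY_shiftY hL hquad hinv hw y (shiftY Q y) hQ).1
    have h3 := quadForm_symm hL hw.det_ne_zero (inclDY y') (inclDY (shiftY Q y))
    rw [e, inclDY_add, inclDY_smul]
    simp only [quadForm_add_left, quadForm_add_right, quadForm_smul_left, quadForm_smul_right]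
    linarith
  rw [hb]

end Expansion

end NormalForm

/-! ### Linear isometries of Minkowski space -/

section Isometries

variable {n : ℕ}

/-- The diagonal entries `-1, 1, …, 1` of the Minkowski form. -/
noncomputable def eps (i : Fin n) : ℝ := if i.val = 0 then -1 else 1

lemma eps_mul_self (i : Fin n) : eps i * eps i = 1 := by
  unfold eps; split_ifs <;> norm_num

lemma eps_eq_or (i : Fin n) : eps i = 1 ∨ eps i = -1 := by
  unfold eps; split_ifs <;> simp

lemma minkowski_eq (i j : Fin n) : minkowski i j = eps i * delta i j := by
  simp [minkowski, eps, delta]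

lemma isLorentzForm_minkowski : IsLorentzForm (minkowski : Fin n → Fin n → ℝ) :=
  ⟨1, by simp, by simp⟩

lemma pull2_minkowski (S : Fin n → Fin n → ℝ) (x y : Fin n) :
    pull2 S minkowski x y = ∑ a, eps a * (S a x * S a y) := by
  simp [pull2, minkowski_eq, delta]

lemma det_ne_zero_of_pull2 {S : Fin n → Fin n → ℝ} (hS : pull2 S minkowski = minkowski) :
    (Matrix.of S).det ≠ 0 := by
  intro h0
  have := congrArg (fun w => (Matrix.of w).det) hS
  simp only [of_pull2, Matrix.det_mul, h0, mul_zero] at this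
  exact det_minkowski_ne_zero this.symm

/-- The reflection in the coordinate `t`. -/
def reflection (t i j : Fin n) : ℝ := (if i = t then -1 else 1) * delta i j

lemma pull2_reflection (t : Fin n) : pull2 (reflection t) minkowski = minkowski := by
  funext x y
  rw [pull2_minkowski, minkowski_eq]
  simp only [reflection]
  refine (Finset.sum_congr rfl fun a _ => ?_).trans
    ((sum_mul_delta (fun a => eps a * delta a y) x))
  split_ifs <;> ring

/-- A rotation or a boost in the plane of two coordinates; the sign `eps i₀ * eps i₁`
distinguishes the two cases, and the coefficients come from the triples `3, 4, 5`. -/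
lemma exists_planar_isometry {i₀ i₁ : Fin n} (h : i₀ ≠ i₁) :
    ∃ (S : Fin n → Fin n → ℝ) (c s : ℝ), pull2 S minkowski = minkowski ∧ s ≠ 0 ∧
      c ^ 2 + eps i₀ * eps i₁ * s ^ 2 = 1 ∧
      (∀ x, S i₀ x = c * delta i₀ x + s * delta i₁ x) ∧
      (∀ j, j ≠ i₀ → j ≠ i₁ → S j = delta j) := by
  obtain ⟨c, s, hs, hcs⟩ : ∃ c s : ℝ, s ≠ 0 ∧ c ^ 2 + eps i₀ * eps i₁ * s ^ 2 = 1 := by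
    rcases eps_eq_or i₀ with h0 | h0 <;> rcases eps_eq_or i₁ with h1 | h1 <;> rw [h0, h1]
    · exact ⟨3 / 5, 4 / 5, by norm_num, by norm_num⟩
    · exact ⟨5 / 4, 3 / 4, by norm_num, by norm_num⟩
    · exact ⟨5 / 4, 3 / 4, by norm_num, by norm_num⟩
    · exact ⟨3 / 5, 4 / 5, by norm_num, by norm_num⟩
  let S : Fin n → Fin n → ℝ := fun a x =>
    if a = i₀ then c * delta i₀ x + s * delta i₁ x
    else if a = i₁ then -(eps i₀ * eps i₁) * s * delta i₀ x + c * delta i₁ x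
    else delta a x
  have h0 : ∀ x, S i₀ x = c * delta i₀ x + s * delta i₁ x := fun x => by simp [S]
  have h1 : ∀ x, S i₁ x = -(eps i₀ * eps i₁) * s * delta i₀ x + c * delta i₁ x := fun x => by
    simp [S, h.symm]
  have hj : ∀ j, j ≠ i₀ → j ≠ i₁ → S j = delta j := fun j h0 h1 => by
    funext x; simp [S, h0, h1]
  refine ⟨S, c, s, ?_, hs, hcs, h0, hj⟩
  funext x y
  have e : minkowski x y = ∑ a : Fin n, eps a * (delta a x * delta a y) := by
    rw [← pull2_minkowski, pull2_delta]
  rw [pull2_minkowski, e, ← sub_eq_zero, ← Finset.sum_sub_distrib,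
    Fintype.sum_eq_add i₀ i₁ h (fun a ha => by rw [hj a ha.1 ha.2, sub_self]), h0, h0, h1, h1]
  rcases eps_eq_or i₀ with e0 | e0 <;> rcases eps_eq_or i₁ with e1 | e1 <;> rw [e0, e1] at hcs ⊢
  · linear_combination (delta i₀ x * delta i₀ y + delta i₁ x * delta i₁ y) * hcs
  · linear_combination (delta i₀ x * delta i₀ y - delta i₁ x * delta i₁ y) * hcs
  · linear_combination (-delta i₀ x * delta i₀ y + delta i₁ x * delta i₁ y) * hcs
  · linear_combination (-delta i₀ x * delta i₀ y - delta i₁ x * delta i₁ y) * hcs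

end Isometries

/-! ### The scalar curvature is the only invariant linear in the second derivatives -/

section CurvatureCoefficient

variable {n m : ℕ}

/-- The linear form in the second derivatives of the metric to which the scalar curvature reduces
where the first derivatives vanish; `h` stands for the inverse metric. -/
noncomputable def curvForm (h : Fin n → Fin n → ℝ) (a : Fin n → Fin n → Fin n → Fin n → ℝ) : ℝ :=
  ∑ j, ∑ k, h j k * ∑ i, ∑ b, h i b *
    ((1 / 2) * (a k b j i - a j k b i - a i b j k + a j i b k))

lemma pull4_add (S : Fin n → Fin n → ℝ) (a b : Fin n → Fin n → Fin n → Fin n → ℝ) :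
    pull4 S (a + b) = pull4 S a + pull4 S b := by
  funext i j k l
  simp only [pull4, Pi.add_apply, add_mul, Finset.sum_add_distrib]

lemma pull4_unit4 (S : Fin n → Fin n → ℝ) (p q r s i j k l : Fin n) :
    pull4 S (unit4 p q r s) i j k l = S p i * S q j * S r k * S s l := by
  simp [pull4, unit4, delta]
  ring

lemma pull4_symUnit4 (S : Fin n → Fin n → ℝ) (p q r s i j k l : Fin n) :
    pull4 S (symUnit4 p q r s) i j k l
      = (S p i * S q j + S q i * S p j) * (S r k * S s l + S s k * S r l) := by
  simp only [symUnit4, pull4_add, Pi.add_apply, pull4_unit4]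
  ring

lemma symUnit4_apply (p q r s i j k l : Fin n) :
    symUnit4 p q r s i j k l = (delta p i * delta q j + delta q i * delta p j)
      * (delta r k * delta s l + delta s k * delta r l) := by
  simp only [symUnit4, Pi.add_apply, unit4]
  ring

/-- A functional on the second derivatives of metrics at the Minkowski form which satisfies the
Bianchi identity and is invariant under isometries is a multiple of the scalar curvature. -/
lemma exists_eq_curvForm {f : (Fin n → Fin n → Fin n → Fin n → ℝ) →ₗ[ℝ] ℝ}
    (hcyc : ∀ p q r s, f (symUnit4 p q r s) + f (symUnit4 p r q s) + f (symUnit4 p s q r) = 0)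
    (hinv : ∀ S : Fin n → Fin n → ℝ, pull2 S minkowski = minkowski → ∀ p q r s,
      f (pull4 S (symUnit4 p q r s)) = f (symUnit4 p q r s)) :
    ∃ b : ℝ, ∀ a : Fin n → Fin n → Fin n → Fin n → ℝ, (∀ i j k l, a i j k l = a j i k l) →
      (∀ i j k l, a i j k l = a i j l k) → f a = b * curvForm minkowski a := by
  have hl : ∀ p q r s : Fin n, f (symUnit4 p q r s) = f (symUnit4 q p r s) := fun p q r s => by
    rw [symUnit4_swap_left]
  have hr : ∀ p q r s : Fin n, f (symUnit4 p q r s) = f (symUnit4 p q s r) := fun p q r s => by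
    rw [symUnit4_swap_right]
  -- Reflection in the coordinate `t` kills the values at indices among which `t` occurs an odd
  -- number of times.
  have hodd : ∀ t p q r s : Fin n, ((if p = t then (-1 : ℝ) else 1) * (if q = t then -1 else 1)
      * (if r = t then -1 else 1) * (if s = t then -1 else 1)) = -1 →
      f (symUnit4 p q r s) = 0 := by
    intro t p q r s h
    have h1 := hinv _ (pull2_reflection t) p q r s
    have h2 : pull4 (reflection t) (symUnit4 p q r s) = (-1 : ℝ) • symUnit4 p q r s := by
      funext i j k l
      rw [pull4_symUnit4, ← h, Pi.smul_apply, Pi.smul_apply, Pi.smul_apply, Pi.smul_apply,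
        symUnit4_apply, smul_eq_mul]
      simp only [reflection]
      ring
    rw [h2, map_smul, smul_eq_mul] at h1
    linarith
  have hswap : ∀ p q, f (symUnit4 p p q q) = f (symUnit4 q q p p) := by
    intro p q
    linarith [hcyc p p q q, hcyc q q p p, hl p q p q, hr q p p q]
  -- A rotation or boost in the plane of `i₀`, `i₁` compares the values with either of them.
  have hmove : ∀ i₀ i₁ j : Fin n, i₀ ≠ i₁ → j ≠ i₀ → j ≠ i₁ →
      f (symUnit4 i₀ i₀ j j) * eps i₀ = f (symUnit4 i₁ i₁ j j) * eps i₁ := by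
    intro i₀ i₁ j h h0 h1
    obtain ⟨S, c, s, hS, hs, hcs, hS0, hSj⟩ := exists_planar_isometry h
    have e1 := hinv S hS i₀ i₀ j j
    have e2 : pull4 S (symUnit4 i₀ i₀ j j) = c ^ 2 • symUnit4 i₀ i₀ j j
        + (2 * (c * s)) • symUnit4 i₀ i₁ j j + s ^ 2 • symUnit4 i₁ i₁ j j := by
      funext i k l q
      simp only [pull4_symUnit4, Pi.add_apply, Pi.smul_apply, symUnit4_apply, smul_eq_mul, hS0,
        hSj j h0 h1]
      ring
    have e3 : f (symUnit4 i₀ i₁ j j) = 0 := hodd i₀ i₀ i₁ j j (by simp [h.symm, h0])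
    rw [e2, map_add, map_add, map_smul, map_smul, map_smul, e3] at e1
    simp only [smul_eq_mul] at e1
    have e4 : s ^ 2 * (f (symUnit4 i₁ i₁ j j) - eps i₀ * eps i₁ * f (symUnit4 i₀ i₀ j j)) = 0 := by
      linear_combination e1 - f (symUnit4 i₀ i₀ j j) * hcs
    have e5 := (mul_eq_zero.1 e4).resolve_left (pow_ne_zero 2 hs)
    linear_combination (-eps i₁) * e5 - f (symUnit4 i₀ i₀ j j) * eps i₀ * eps_mul_self i₁
  -- The numbers `f(p,p,q,q) εₚ ε_q` for `p ≠ q` agree.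
  let B : Fin n → Fin n → ℝ := fun p q => f (symUnit4 p p q q) * eps p * eps q
  have hBs : ∀ p q, B p q = B q p := fun p q => by simp only [B]; rw [hswap p q]; ring
  have hBm : ∀ p p' q, q ≠ p → q ≠ p' → B p q = B p' q := by
    intro p p' q h h'
    by_cases hpp : p = p'
    · rw [hpp]
    · simp only [B]; rw [hmove p p' q hpp h h']
  obtain ⟨κ, hκ⟩ : ∃ κ : ℝ, ∀ p q, p ≠ q → B p q = κ := by
    by_cases hex : ∃ p q : Fin n, p ≠ q
    · obtain ⟨p₀, q₀, h₀⟩ := hex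
      refine ⟨B p₀ q₀, fun p q h => ?_⟩
      by_cases h1 : q = p₀
      · subst h1
        rw [hBs p q]
        by_cases h2 : p = q₀
        · rw [h2]
        · rw [hBs q p, hBs q q₀]
          exact hBm _ _ _ h.symm h₀
      · rw [hBm p p₀ q h.symm h1, hBs p₀ q, hBs p₀ q₀]
        exact hBm _ _ _ (Ne.symm h1) h₀
    · exact ⟨0, fun p q h => (hex ⟨p, q, h⟩).elim⟩
  have hF : ∀ p q r s, f (symUnit4 p q r s) = κ * (eps p * eps r * (delta p q * delta r s)
      - (1 / 2) * (eps p * eps q) * (delta p r * delta q s + delta p s * delta q r)) := by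
    have hdiag : ∀ p q : Fin n, p ≠ q → f (symUnit4 p p q q) = κ * (eps p * eps q) := by
      intro p q h
      rw [← hκ p q h]
      simp only [B]
      linear_combination (-f (symUnit4 p p q q) * eps q * eps q) * eps_mul_self p
        - f (symUnit4 p p q q) * eps_mul_self q
    have hmix : ∀ p q : Fin n, p ≠ q →
        f (symUnit4 p q p q) = κ * (-(1 / 2) * (eps p * eps q)) := by
      intro p q h
      linarith [hcyc p p q q, hdiag p q h]
    intro p q r s
    by_cases h1 : p = q
    · subst h1
      by_cases h2 : r = s
      · subst h2
        by_cases h3 : p = r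
        · subst h3
          have := hcyc p p p p
          have h4 : f (symUnit4 p p p p) = 0 := by linarith
          rw [h4]
          simp only [delta, if_true]
          ring
        · rw [hdiag p r h3]; simp [delta, h3]
      · rw [hodd r p p r s (by by_cases hp : p = r <;> simp [hp, Ne.symm h2])]
        simp only [delta, h2]
        by_cases hp : p = r
        · subst hp; simp [h2]
        · simp [hp]
    · by_cases h2 : p = r
      · subst h2
        by_cases h3 : q = s
        · subst h3
          rw [hmix p q h1]; simp [delta, h1]
        · rw [hodd q p q p s (by simp [h1, Ne.symm h3])]
          simp [delta, h1, h3, Ne.symm h1]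
      · by_cases h3 : p = s
        · subst h3
          by_cases h4 : q = r
          · subst h4
            rw [hr, hmix p q h1]; simp [delta, h1]
          · rw [hodd q p q r p (by simp [h1, Ne.symm h4])]
            simp [delta, h1, h2, h4]
        · rw [hodd p p q r s (by simp [Ne.symm h1, Ne.symm h2, Ne.symm h3])]
          simp [delta, h1, h2, h3]
  refine ⟨-(κ / 4), fun a ha ha' => ?_⟩
  have h4 := four_mul_map_eq_sum f ha ha'
  have e1 : ∑ p, ∑ q, ∑ r, ∑ s, a p q r s * f (symUnit4 p q r s)
      = κ * (∑ p, ∑ r, eps p * eps r * a p p r r - ∑ p, ∑ q, eps p * eps q * a p q p q) := by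
    have t1 : ∑ p, ∑ q, ∑ r, ∑ s, a p q r s * f (symUnit4 p q r s)
        = ∑ p, ∑ q, ∑ r, ∑ s, ((κ * (eps p * eps r * a p q r s)) * delta p q * delta r s
          - ((κ / 2) * (eps p * eps q * a p q r s)) * delta p r * delta q s
          - ((κ / 2) * (eps p * eps q * a p q r s)) * delta p s * delta q r) :=
      Finset.sum_congr rfl fun p _ => Finset.sum_congr rfl fun q _ =>
        Finset.sum_congr rfl fun r _ => Finset.sum_congr rfl fun s _ => by rw [hF]; ring
    have t2 : ∑ p, ∑ q, eps p * eps q * a p q q p = ∑ p, ∑ q, eps p * eps q * a p q p q :=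
      Finset.sum_congr rfl fun p _ => Finset.sum_congr rfl fun q _ => by rw [ha']
    rw [t1]
    simp only [Finset.sum_sub_distrib, delta, mul_ite, mul_one, mul_zero, Finset.sum_ite_eq,
      Finset.sum_ite_irrel, Finset.sum_const_zero, Finset.mem_univ, if_true]
    simp only [← Finset.mul_sum, t2]
    ring
  have e2 : curvForm minkowski a
      = ∑ p, ∑ q, eps p * eps q * a p q p q - ∑ p, ∑ r, eps p * eps r * a p p r r := by
    have t1 : curvForm minkowski a = ∑ j, ∑ i, ((1 / 2) * (eps j * eps i * a j i j i)
        - (1 / 2) * (eps j * eps i * a j j i i) - (1 / 2) * (eps j * eps i * a i i j j)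
        + (1 / 2) * (eps j * eps i * a j i i j)) := by
      simp only [curvForm, minkowski_eq]
      refine Finset.sum_congr rfl fun j _ => ?_
      rw [show ∑ k, eps j * delta j k * ∑ i, ∑ b, eps i * delta i b *
          ((1 / 2) * (a k b j i - a j k b i - a i b j k + a j i b k))
        = ∑ k, (eps j * ∑ i, ∑ b, eps i * delta i b *
          ((1 / 2) * (a k b j i - a j k b i - a i b j k + a j i b k))) * delta k j from
        Finset.sum_congr rfl fun k _ => by rw [delta_comm]; ring, sum_mul_delta, Finset.mul_sum]
      refine Finset.sum_congr rfl fun i _ => ?_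
      rw [show ∑ b, eps i * delta i b *
          ((1 / 2) * (a j b j i - a j j b i - a i b j j + a j i b j))
        = ∑ b, (eps i * ((1 / 2) * (a j b j i - a j j b i - a i b j j + a j i b j))) * delta b i
        from Finset.sum_congr rfl fun k _ => by rw [delta_comm]; ring, sum_mul_delta]
      ring
    have t2 : ∑ j, ∑ i, eps j * eps i * a i i j j = ∑ p, ∑ r, eps p * eps r * a p p r r := by
      rw [Finset.sum_comm]
      exact Finset.sum_congr rfl fun p _ => Finset.sum_congr rfl fun q _ => by ring
    have t3 : ∑ p, ∑ q, eps p * eps q * a p q q p = ∑ p, ∑ q, eps p * eps q * a p q p q :=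
      Finset.sum_congr rfl fun p _ => Finset.sum_congr rfl fun q _ => by rw [ha']
    rw [t1]
    simp only [Finset.sum_sub_distrib, Finset.sum_add_distrib, ← Finset.mul_sum, t2, t3]
    ring
  rw [e2]
  rw [e1] at h4
  linarith

end CurvatureCoefficient

/-! ### The norm of the exterior derivative is the only invariant quadratic in the derivatives -/

section Alternating

variable {n k : ℕ}

/-- The sum over all permutations of the indices, with signs. -/
noncomputable def alt (u : (Fin k → Fin n) → ℝ) (I : Fin k → Fin n) : ℝ :=
  ∑ σ : Equiv.Perm (Fin k), ((Equiv.Perm.sign σ : ℤ) : ℝ) * u (I ∘ σ)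

lemma alt_comp (u : (Fin k → Fin n) → ℝ) (I : Fin k → Fin n) (τ : Equiv.Perm (Fin k)) :
    alt u (I ∘ τ) = ((Equiv.Perm.sign τ : ℤ) : ℝ) * alt u I := by
  rw [alt, alt, Finset.mul_sum, ← Equiv.sum_comp (Equiv.mulLeft τ⁻¹)]
  refine Finset.sum_congr rfl fun σ _ => ?_
  simp only [Equiv.coe_mulLeft, Equiv.Perm.sign_mul, Equiv.Perm.sign_inv, Units.val_mul,
    Int.cast_mul, mul_assoc]
  congr 3
  funext a
  simp

lemma sign_mul_self_real (σ : Equiv.Perm (Fin k)) :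
    ((Equiv.Perm.sign σ : ℤ) : ℝ) * ((Equiv.Perm.sign σ : ℤ) : ℝ) = 1 := by
  rw [← Int.cast_mul, Int.units_coe_mul_self, Int.cast_one]

lemma exists_swap_comp_eq {I : Fin k → Fin n} (hI : ¬ Function.Injective I) :
    ∃ x y, x ≠ y ∧ I ∘ Equiv.swap x y = I := by
  obtain ⟨x, y, h, hxy⟩ := Function.not_injective_iff.1 hI
  refine ⟨x, y, hxy, funext fun a => ?_⟩
  simp only [Function.comp_apply, Equiv.swap_apply_def]
  split_ifs with h1 h2
  · rw [h1, h]
  · rw [h2, h]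
  · rfl

lemma alt_eq_zero (u : (Fin k → Fin n) → ℝ) {I : Fin k → Fin n} (hI : ¬ Function.Injective I) :
    alt u I = 0 := by
  obtain ⟨x, y, hxy, h⟩ := exists_swap_comp_eq hI
  have := alt_comp u I (Equiv.swap x y)
  rw [h, Equiv.Perm.sign_swap hxy] at this
  push_cast at this
  linarith

/-- Alternation is, up to the factor `k!`, an orthogonal projection. -/
lemma sum_mul_alt (ε : Fin n → ℝ) (u : (Fin k → Fin n) → ℝ) :
    ∑ I, (∏ a, ε (I a)) * alt u I ^ 2
      = (k.factorial : ℝ) * ∑ I : Fin k → Fin n, (∏ a, ε (I a)) * (u I * alt u I) := by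
  have h1 : ∀ σ : Equiv.Perm (Fin k), ∑ I : Fin k → Fin n,
      (∏ a, ε (I a)) * (((Equiv.Perm.sign σ : ℤ) : ℝ) * u (I ∘ σ) * alt u I)
        = ∑ I : Fin k → Fin n, (∏ a, ε (I a)) * (u I * alt u I) := by
    intro σ
    rw [← Equiv.sum_comp (Equiv.arrowCongr σ (Equiv.refl (Fin n)))]
    refine Finset.sum_congr rfl fun I _ => ?_
    have h2 : (Equiv.arrowCongr σ (Equiv.refl (Fin n))) I = I ∘ (σ⁻¹ : Equiv.Perm (Fin k)) := rfl
    have h3 := alt_comp u I σ⁻¹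
    have h4 : ∏ a, ε ((I ∘ (σ⁻¹ : Equiv.Perm (Fin k))) a) = ∏ a, ε (I a) :=
      Equiv.prod_comp σ⁻¹ (fun a => ε (I a))
    have h5 : (I ∘ (σ⁻¹ : Equiv.Perm (Fin k))) ∘ σ = I := by funext a; simp
    rw [h2, h3, h4, h5, Equiv.Perm.sign_inv]
    linear_combination (∏ a, ε (I a)) * u I * alt u I * sign_mul_self_real σ
  have h2 : ∀ I : Fin k → Fin n, (∏ a, ε (I a)) * alt u I ^ 2 = ∑ σ : Equiv.Perm (Fin k),
      (∏ a, ε (I a)) * (((Equiv.Perm.sign σ : ℤ) : ℝ) * u (I ∘ σ) * alt u I) := by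
    intro I
    rw [← Finset.mul_sum, ← Finset.sum_mul, pow_two, ← alt]
  rw [Finset.sum_congr rfl fun I _ => h2 I, Finset.sum_comm, Finset.sum_congr rfl fun σ _ => h1 σ,
    Finset.sum_const, Finset.card_univ, Fintype.card_perm, Fintype.card_fin, nsmul_eq_mul]

lemma pullT_single (S : Fin n → Fin n → ℝ) (I J : Fin k → Fin n) :
    pullT S (Pi.single I 1) J = ∏ a, S (I a) (J a) := by
  simp [pullT, Pi.single_apply]

lemma exists_perm_of_range_subset {I J : Fin k → Fin n} (hJ : Function.Injective J) (h : Set.range J ⊆ Set.range I) :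
    ∃ σ : Equiv.Perm (Fin k), J = I ∘ σ := by
  choose s hs using fun a => h (Set.mem_range_self (f := J) a)
  have hinj : Function.Injective s := fun a b hab => hJ (by rw [← hs a, ← hs b, hab])
  exact ⟨Equiv.ofBijective s (Finite.injective_iff_bijective.1 hinj), funext fun a => (hs a).symm⟩

/-- Multi-indices without repetitions are eigenvectors of the reflections, the eigenvalue showing
whether the reflected coordinate occurs in them. -/
lemma pullT_reflection_single {I : Fin k → Fin n} (hI : Function.Injective I) (t : Fin n)
    [Decidable (t ∈ Set.range I)] :
    pullT (reflection t) (Pi.single I 1)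
      = (if t ∈ Set.range I then (-1 : ℝ) else 1) • Pi.single I 1 := by
  have h1 : ∏ a, (if I a = t then (-1 : ℝ) else 1) = if t ∈ Set.range I then (-1 : ℝ) else 1 := by
    split_ifs with h
    · obtain ⟨a, rfl⟩ := h
      rw [Finset.prod_eq_single a (fun b _ hb => if_neg fun h => hb (hI h)) (by simp), if_pos rfl]
    · exact Finset.prod_eq_one fun a _ => if_neg fun h' => h ⟨a, h'⟩
  funext J
  rw [pullT_single, ← h1]
  simp only [reflection, Finset.prod_mul_distrib, Pi.smul_apply, smul_eq_mul]
  rw [← pullT_single, pullT_delta]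

lemma injective_update {I : Fin k → Fin n} (hI : Function.Injective I) {q : Fin n}
    (hq : q ∉ Set.range I) (x : Fin k) : Function.Injective (Function.update I x q) := by
  intro a a' h
  by_cases h1 : a = x <;> by_cases h2 : a' = x
  · rw [h1, h2]
  · subst h1
    rw [Function.update_self, Function.update_of_ne h2] at h
    exact (hq ⟨_, h.symm⟩).elim
  · subst h2
    rw [Function.update_self, Function.update_of_ne h1] at h
    exact (hq ⟨_, h⟩).elim
  · rw [Function.update_of_ne h1, Function.update_of_ne h2] at h
    exact hI h

/-- A bilinear form on tensors which is alternating and invariant under the isometries of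
Minkowski space is a multiple of the induced inner product of the alternating parts. -/
lemma exists_eq_mul_sum_alt {B : ((Fin k → Fin n) → ℝ) →ₗ[ℝ] ((Fin k → Fin n) → ℝ) →ₗ[ℝ] ℝ}
    (hB : ∀ u v, B u v = B v u)
    (hswap : ∀ (I : Fin k → Fin n) (v : (Fin k → Fin n) → ℝ) (x y : Fin k), x ≠ y →
      B (Pi.single (I ∘ Equiv.swap x y) 1) v = -B (Pi.single I 1) v)
    (hinv : ∀ S : Fin n → Fin n → ℝ, pull2 S minkowski = minkowski → ∀ u,
      B (pullT S u) (pullT S u) = B u u) :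
    ∃ c : ℝ, ∀ u, B u u = c * ∑ I : Fin k → Fin n, (∏ a, eps (I a)) * alt u I ^ 2 := by
  classical
  have hinv' : ∀ S : Fin n → Fin n → ℝ, pull2 S minkowski = minkowski → ∀ u v,
      B (pullT S u) (pullT S v) = B u v := by
    intro S hS u v
    have h1 := hinv S hS (u + v)
    simp only [pullT_add, map_add, LinearMap.add_apply, hinv S hS] at h1
    rw [hB (pullT S v), hB v u] at h1
    linarith
  let e : (Fin k → Fin n) → (Fin k → Fin n) → ℝ := fun I => Pi.single I 1
  have hperm : ∀ (σ : Equiv.Perm (Fin k)) (I : Fin k → Fin n) (v : (Fin k → Fin n) → ℝ),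
      B (e (I ∘ σ)) v = ((Equiv.Perm.sign σ : ℤ) : ℝ) * B (e I) v := by
    intro σ
    induction σ using Equiv.Perm.swap_induction_on with
    | one => intro I v; simp [e]
    | swap_mul σ x y hxy ih =>
      intro I v
      have h1 : I ∘ (Equiv.swap x y * σ : Equiv.Perm (Fin k)) = (I ∘ Equiv.swap x y) ∘ σ := rfl
      rw [h1, ih, hswap I v x y hxy, Equiv.Perm.sign_mul, Equiv.Perm.sign_swap hxy]
      push_cast
      ring
  have hnon : ∀ (I : Fin k → Fin n) (v : (Fin k → Fin n) → ℝ), ¬ Function.Injective I →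
      B (e I) v = 0 := by
    intro I v hI
    obtain ⟨x, y, hxy, h⟩ := exists_swap_comp_eq hI
    have := hswap I v x y hxy
    rw [h] at this
    exact self_eq_neg.1 this
  -- Reflections show that indices with different ranges are orthogonal.
  have horth : ∀ I J : Fin k → Fin n, Function.Injective I → Function.Injective J → ∀ t,
      t ∈ Set.range J → t ∉ Set.range I → B (e I) (e J) = 0 := by
    intro I J hI hJ t hJt hIt
    have := hinv' _ (pull2_reflection t) (e I) (e J)
    rw [pullT_reflection_single hI, pullT_reflection_single hJ, if_pos hJt, if_neg hIt] at this
    simp only [map_smul, LinearMap.smul_apply, smul_eq_mul] at this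
    linarith
  let b : (Fin k → Fin n) → ℝ := fun I => B (e I) (e I) * ∏ a, eps (I a)
  have hbperm : ∀ (σ : Equiv.Perm (Fin k)) (I : Fin k → Fin n), b (I ∘ σ) = b I := by
    intro σ I
    have h4 : ∏ a, eps ((I ∘ σ) a) = ∏ a, eps (I a) := Equiv.prod_comp σ (fun a => eps (I a))
    simp only [b]
    rw [h4, hperm, hB, hperm]
    linear_combination (B (e I) (e I) * ∏ a, eps (I a)) * sign_mul_self_real σ
  -- A rotation or boost in the plane of `I x` and `q` compares the norms of `e I` and of the tensor
  -- in which `I x` is replaced by `q`.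
  have hbmove : ∀ I : Fin k → Fin n, Function.Injective I → ∀ x q, q ∉ Set.range I →
      b (Function.update I x q) = b I := by
    intro I hI x q hq
    have hne : I x ≠ q := fun h => hq ⟨x, h⟩
    obtain ⟨S, c, s, hS, hs, hcs, hS0, hSj⟩ := exists_planar_isometry hne
    have hSI : ∀ a, a ≠ x → S (I a) = delta (I a) := fun a ha =>
      hSj _ (fun h => ha (hI h)) fun h => hq ⟨a, h⟩
    have e1 : pullT S (e I) = c • e I + s • e (Function.update I x q) := by
      funext J
      have t : ∀ I' : Fin k → Fin n, e I' J = ∏ a, delta (I' a) (J a) := fun I' => by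
        rw [← pullT_single, pullT_delta]
      simp only [Pi.add_apply, Pi.smul_apply, smul_eq_mul]
      rw [t, t]
      simp only [e]
      rw [pullT_single,
        ← Finset.mul_prod_erase Finset.univ _ (Finset.mem_univ x),
        ← Finset.mul_prod_erase Finset.univ (fun a => delta (I a) (J a)) (Finset.mem_univ x),
        ← Finset.mul_prod_erase Finset.univ (fun a => delta (Function.update I x q a) (J a))
          (Finset.mem_univ x), hS0]
      have t1 : ∏ a ∈ Finset.univ.erase x, S (I a) (J a)
          = ∏ a ∈ Finset.univ.erase x, delta (I a) (J a) :=
        Finset.prod_congr rfl fun a ha => by rw [hSI a (Finset.ne_of_mem_erase ha)]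
      have t2 : ∏ a ∈ Finset.univ.erase x, delta (Function.update I x q a) (J a)
          = ∏ a ∈ Finset.univ.erase x, delta (I a) (J a) :=
        Finset.prod_congr rfl fun a ha => by
          rw [Function.update_of_ne (Finset.ne_of_mem_erase ha)]
      rw [t1, t2, Function.update_self]
      ring
    have hI' := injective_update hI hq x
    have e2 := hinv S hS (e I)
    have e3 : B (e I) (e (Function.update I x q)) = 0 :=
      horth _ _ hI hI' q ⟨x, Function.update_self ..⟩ hq
    rw [e1] at e2
    simp only [map_add, map_smul, LinearMap.add_apply, LinearMap.smul_apply, smul_eq_mul] at e2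
    rw [hB (e (Function.update I x q)) (e I), e3] at e2
    have e4 : s ^ 2 * (B (e (Function.update I x q)) (e (Function.update I x q))
        - eps (I x) * eps q * B (e I) (e I)) = 0 := by
      linear_combination e2 - B (e I) (e I) * hcs
    have e5 := (mul_eq_zero.1 e4).resolve_left (pow_ne_zero 2 hs)
    simp only [b]
    rw [← Finset.mul_prod_erase Finset.univ (fun a => eps (I a)) (Finset.mem_univ x),
        ← Finset.mul_prod_erase Finset.univ (fun a => eps (Function.update I x q a))
          (Finset.mem_univ x), Function.update_self]
    have t2 : ∏ a ∈ Finset.univ.erase x, eps (Function.update I x q a)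
        = ∏ a ∈ Finset.univ.erase x, eps (I a) :=
      Finset.prod_congr rfl fun a ha => by
        rw [Function.update_of_ne (Finset.ne_of_mem_erase ha)]
    rw [t2]
    linear_combination (eps q * ∏ a ∈ Finset.univ.erase x, eps (I a)) * e5
      + (eps (I x) * B (e I) (e I) * ∏ a ∈ Finset.univ.erase x, eps (I a)) * eps_mul_self q
  -- Any two injective indices are related by replacing one value at a time.
  have hbconst : ∀ (N : ℕ) (I J : Fin k → Fin n), Function.Injective I → Function.Injective J →
      (Finset.univ.filter fun a => I a ≠ J a).card = N → b I = b J := by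
    intro N
    induction N using Nat.strong_induction_on with
    | _ N ih =>
      intro I J hI hJ hN
      by_cases hIJ : I = J
      · rw [hIJ]
      obtain ⟨x, hx⟩ := Function.ne_iff.1 hIJ
      have hlt : ∀ I' : Fin k → Fin n, I' x = J x → (∀ a, I a = J a → I' a = J a) →
          (Finset.univ.filter fun a => I' a ≠ J a).card < N := by
        intro I' h1 h2
        rw [← hN]
        refine Finset.card_lt_card ⟨fun a ha => ?_, fun h => ?_⟩
        · simp only [Finset.mem_filter, Finset.mem_univ, true_and] at ha ⊢
          exact fun h => ha (h2 a h)
        · exact (Finset.mem_filter.1 (h (Finset.mem_filter.2 ⟨Finset.mem_univ x, hx⟩))).2 h1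
      by_cases hr : J x ∈ Set.range I
      · obtain ⟨y, hy⟩ := hr
        rw [← hbperm (Equiv.swap x y) I]
        refine ih _ (hlt (I ∘ Equiv.swap x y) (by simpa using hy) fun a ha => ?_) _ J
          (hI.comp (Equiv.injective _)) hJ rfl
        have h1 : a ≠ x := fun h => hx (h ▸ ha)
        have h2 : a ≠ y := fun h => by
          subst h
          exact h1 (hJ (ha.symm.trans hy))
        simp only [Function.comp_apply, Equiv.swap_apply_of_ne_of_ne h1 h2, ha]
      · rw [← hbmove I hI x _ hr]
        refine ih _ (hlt _ (Function.update_self ..) fun a ha => ?_) _ J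
          (injective_update hI hr x) hJ rfl
        rw [Function.update_of_ne (fun h => hx (by rw [h] at ha; exact ha)), ha]
  obtain ⟨c, hc⟩ : ∃ c, ∀ I : Fin k → Fin n, Function.Injective I → b I = c := by
    by_cases hex : ∃ I₀ : Fin k → Fin n, Function.Injective I₀
    · obtain ⟨I₀, h₀⟩ := hex
      exact ⟨b I₀, fun I hI => hbconst _ I I₀ hI h₀ rfl⟩
    · exact ⟨0, fun I hI => (hex ⟨I, hI⟩).elim⟩
  have hc' : ∀ I : Fin k → Fin n, Function.Injective I →
      B (e I) (e I) = c * ∏ a, eps (I a) := by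
    intro I hI
    have h1 : (∏ a, eps (I a)) * ∏ a, eps (I a) = 1 := by
      rw [← Finset.prod_mul_distrib]
      exact Finset.prod_eq_one fun a _ => eps_mul_self _
    rw [← hc I hI]
    simp only [b]
    rw [mul_assoc, h1, mul_one]
  have hexp : ∀ u : (Fin k → Fin n) → ℝ, u = ∑ I, u I • e I := fun u => by
    funext J
    simp [e, Finset.sum_apply, Pi.single_apply]
  have hrow : ∀ (I : Fin k → Fin n) (u : (Fin k → Fin n) → ℝ),
      B (e I) u = c * ((∏ a, eps (I a)) * alt u I) := by
    intro I u
    by_cases hI : Function.Injective I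
    · conv_lhs => rw [hexp u, map_sum]
      have hinj : Function.Injective fun σ : Equiv.Perm (Fin k) => I ∘ σ := fun σ τ h =>
        Equiv.ext fun a => hI (congrFun h a)
      rw [← Finset.sum_subset (Finset.subset_univ (Finset.univ.image
        fun σ : Equiv.Perm (Fin k) => I ∘ σ)), Finset.sum_image hinj.injOn, alt,
        Finset.mul_sum, Finset.mul_sum]
      · refine Finset.sum_congr rfl fun σ _ => ?_
        rw [map_smul, hB, hperm, hc' I hI, smul_eq_mul]
        ring
      · intro J _ hJ
        rw [map_smul]
        by_cases hJi : Function.Injective J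
        · have : ¬ Set.range J ⊆ Set.range I := fun h => by
            obtain ⟨σ, hσ⟩ := exists_perm_of_range_subset hJi h
            exact hJ (Finset.mem_image.2 ⟨σ, Finset.mem_univ _, hσ.symm⟩)
          obtain ⟨t, ht, ht'⟩ := Set.not_subset.1 this
          rw [horth I J hI hJi t ht ht', smul_zero]
        · rw [hB, hnon J _ hJi, smul_zero]
    · rw [hnon I u hI, alt_eq_zero u hI, mul_zero, mul_zero]
  refine ⟨c / k.factorial, fun u => ?_⟩
  have hk : (k.factorial : ℝ) ≠ 0 := by exact_mod_cast k.factorial_ne_zero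
  rw [sum_mul_alt, ← mul_assoc, div_mul_cancel₀ _ hk]
  have h1 : B u u = B (∑ I, u I • e I) u := by rw [← hexp u]
  rw [h1, map_sum, LinearMap.sum_apply, Finset.mul_sum]
  refine Finset.sum_congr rfl fun I _ => ?_
  rw [map_smul, LinearMap.smul_apply, hrow, smul_eq_mul]
  ring

end Alternating

/-! ### The quadratic coefficient of the first derivatives of the tensor field -/

section DerivativeCoefficient

variable {n m : ℕ}

/-- The array `y_Ij`, with the derivative index put first, as a tensor with `m + 1` indices. -/
def derivFirst (y' : (Fin m → Fin n) → Fin n → ℝ) (J : Fin (m + 1) → Fin n) : ℝ :=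
  y' (Fin.tail J) (J 0)

/-- The inverse of `derivFirst`. -/
def derivLast (u : (Fin (m + 1) → Fin n) → ℝ) (I : Fin m → Fin n) (j : Fin n) : ℝ :=
  u (Fin.cons j I)

lemma derivLast_derivFirst (y' : (Fin m → Fin n) → Fin n → ℝ) :
    derivLast (derivFirst y') = y' := by
  funext I j
  simp [derivLast, derivFirst]

lemma sum_fin_succ_arrow (F : (Fin (m + 1) → Fin n) → ℝ) :
    ∑ J, F J = ∑ j, ∑ I : Fin m → Fin n, F (Fin.cons j I) := by
  rw [← Fintype.sum_prod_type', ← (Fin.consEquiv fun _ : Fin (m + 1) => Fin n).sum_comp]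
  rfl

lemma derivLast_pullT (S : Fin n → Fin n → ℝ) (u : (Fin (m + 1) → Fin n) → ℝ) :
    derivLast (pullT S u) = pullDY S (derivLast u) := by
  funext I j
  simp only [derivLast, pullT, pullDY, Finset.sum_mul]
  rw [sum_fin_succ_arrow, Finset.sum_comm]
  refine Finset.sum_congr rfl fun A _ => Finset.sum_congr rfl fun b _ => ?_
  rw [Fin.prod_univ_succ]
  simp only [Fin.cons_zero, Fin.cons_succ]
  ring

/-- The change of the derivatives of a tensor with a single nonzero component under a coordinate
change of which only the second derivatives `Q^k_ij` and `Q^k_ji` are nonzero. -/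
lemma shiftY_single (K : Fin m → Fin n) (k i j : Fin n) :
    shiftY (fun c p q => delta c k * (delta p i * delta q j + delta p j * delta q i))
        (Pi.single K 1)
      = derivLast (∑ a, if K a = k then
          Pi.single (Fin.cons j (Function.update K a i) : Fin (m + 1) → Fin n) 1
            + Pi.single (Fin.cons i (Function.update K a j) : Fin (m + 1) → Fin n) 1 else 0) := by
  funext I l
  simp only [shiftY, derivLast, Finset.sum_apply]
  refine Finset.sum_congr rfl fun a _ => ?_
  classical
  obtain ⟨P, hP⟩ : ∃ P : Prop, (∀ b, b ≠ a → I b = K b) ↔ P := ⟨_, Iff.rfl⟩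
  have h1 : ∀ c, (Pi.single K 1 : (Fin m → Fin n) → ℝ) (Function.update I a c)
      = if c = K a ∧ P then 1 else 0 := fun c => by
    rw [Pi.single_apply]
    exact if_congr (Function.update_eq_iff.trans (and_congr_right fun _ => hP)) rfl rfl
  have h2 : ∀ i j, (Pi.single (Fin.cons j (Function.update K a i) : Fin (m + 1) → Fin n) 1 :
      (Fin (m + 1) → Fin n) → ℝ) (Fin.cons l I) = if l = j ∧ I a = i ∧ P then 1 else 0 := by
    intro i j
    rw [Pi.single_apply]
    refine if_congr ?_ rfl rfl
    rw [Fin.cons_inj, Function.eq_update_iff, hP]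
  simp only [h1]
  by_cases hP' : P
  · simp only [hP', and_true, mul_ite, mul_one, mul_zero, Finset.sum_ite_eq', Finset.mem_univ,
      if_true]
    split_ifs with hk
    · rw [Pi.add_apply, h2, h2]
      simp only [delta, hk, if_true, hP', and_true, one_mul, ite_and, mul_ite, mul_one, mul_zero]
    · simp [delta, hk]
  · simp only [hP', and_false, if_false, mul_zero, Finset.sum_const_zero]
    split_ifs with hk
    · rw [Pi.add_apply, h2, h2]
      simp [hP']
    · rfl

lemma cons_comp_swap (j : Fin n) (K : Fin m → Fin n) (a : Fin m) :
    (Fin.cons j K : Fin (m + 1) → Fin n) ∘ Equiv.swap 0 a.succ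
      = Fin.cons (K a) (Function.update K a j) := by
  funext x
  refine Fin.cases ?_ (fun b => ?_) x
  · simp
  · by_cases h : b = a
    · subst h; simp
    · rw [Function.comp_apply, Equiv.swap_apply_of_ne_of_ne (Fin.succ_ne_zero b)
        (fun h' => h (Fin.succ_injective _ h')), Fin.cons_succ, Fin.cons_succ,
        Function.update_of_ne h]

/-- A functional on the tensors with `m + 1` indices which vanishes on the changes of the first
derivatives of a tensor under changes of coordinates of second order is alternating. -/
lemma map_single_comp_swap {f : ((Fin (m + 1) → Fin n) → ℝ) →ₗ[ℝ] ℝ}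
    (hf : ∀ (K : Fin m → Fin n) (k i j : Fin n), f (∑ a, if K a = k then
      Pi.single (Fin.cons j (Function.update K a i) : Fin (m + 1) → Fin n) 1
        + Pi.single (Fin.cons i (Function.update K a j) : Fin (m + 1) → Fin n) 1 else 0) = 0)
    (J : Fin (m + 1) → Fin n) {x y : Fin (m + 1)} (hxy : x ≠ y) :
    f (Pi.single (J ∘ Equiv.swap x y) 1) = -f (Pi.single J 1) := by
  classical
  let g : (Fin m → Fin n) → Fin n → ℝ := fun K j =>
    f (Pi.single (Fin.cons j K : Fin (m + 1) → Fin n) 1)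
  have hg : ∀ (K : Fin m → Fin n) (k i j : Fin n), ∑ a, (if K a = k then
      g (Function.update K a i) j + g (Function.update K a j) i else 0) = 0 := by
    intro K k i j
    refine Eq.trans ?_ (hf K k i j)
    rw [map_sum]
    refine Finset.sum_congr rfl fun a _ => ?_
    split_ifs
    · rw [map_add]
    · rw [map_zero]
  have hcount : ∀ (K : Fin m → Fin n) (a : Fin m) (t : ℝ),
      ∑ c, (if K c = K a then t else 0) = 0 → t = 0 := by
    intro K a t h
    rw [← Finset.sum_filter, Finset.sum_const, nsmul_eq_mul] at h
    refine (mul_eq_zero.1 h).resolve_left ?_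
    have : a ∈ Finset.univ.filter fun c => K c = K a := by simp
    exact_mod_cast (Finset.card_pos.2 ⟨a, this⟩).ne'
  have h0 : ∀ (K : Fin m → Fin n) (a : Fin m), g K (K a) = 0 := by
    intro K a
    have h := hg K (K a) (K a) (K a)
    have h' : g K (K a) + g K (K a) = 0 := by
      refine hcount K a _ ?_
      refine Eq.trans ?_ h
      refine Finset.sum_congr rfl fun c _ => ?_
      split_ifs with hc
      · rw [← hc, Function.update_eq_self]
      · rfl
    linarith
  have hnon : ∀ (K : Fin m → Fin n) (j : Fin n), ¬ Function.Injective K → g K j = 0 := by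
    intro K j hK
    obtain ⟨a, b, hab, hne⟩ := Function.not_injective_iff.1 hK
    refine hcount K a _ ?_
    refine Eq.trans ?_ (hg K (K a) (K a) j)
    refine Finset.sum_congr rfl fun c _ => ?_
    split_ifs with hc
    · have h1 : g (Function.update K c j) (K a) = 0 := by
        by_cases hca : c = a
        · have := h0 (Function.update K c j) b
          rwa [Function.update_of_ne (by rw [hca]; exact hne.symm), ← hab] at this
        · have := h0 (Function.update K c j) a
          rwa [Function.update_of_ne (Ne.symm hca)] at this
      rw [h1, ← hc, Function.update_eq_self, add_zero]
    · rfl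
  have hstep : ∀ (K : Fin m → Fin n) (j : Fin n) (a : Fin m),
      g (Function.update K a j) (K a) = -g K j := by
    intro K j a
    by_cases hK : Function.Injective K
    · have h := hg K (K a) (K a) j
      rw [Finset.sum_eq_single a (fun c _ hc => if_neg fun h => hc (hK h)) (by simp),
        if_pos rfl, Function.update_eq_self] at h
      linarith
    · rw [hnon K j hK, neg_zero]
      by_cases hK' : Function.Injective (Function.update K a j)
      · obtain ⟨b, c, hbc, hne⟩ := Function.not_injective_iff.1 hK
        have hmem : ∃ d, d ≠ a ∧ K d = K a := by
          by_cases hb : b = a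
          · exact ⟨c, fun h => hne (hb.trans h.symm), by rw [← hb, hbc]⟩
          · by_cases hc : c = a
            · exact ⟨b, hb, by rw [← hc, hbc]⟩
            · refine (hne (hK' ?_)).elim
              rw [Function.update_of_ne hb, Function.update_of_ne hc, hbc]
        obtain ⟨d, hd, hda⟩ := hmem
        have := h0 (Function.update K a j) d
        rwa [Function.update_of_ne hd, hda] at this
      · exact hnon _ _ hK'
  have hstar : ∀ (a : Fin (m + 1)) (J : Fin (m + 1) → Fin n), a ≠ 0 →
      f (Pi.single (J ∘ Equiv.swap 0 a) 1) = -f (Pi.single J 1) := by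
    intro a J ha
    obtain ⟨b, rfl⟩ := Fin.exists_succ_eq.2 ha
    rw [← Fin.cons_self_tail J, cons_comp_swap]
    exact hstep (Fin.tail J) (J 0) b
  by_cases hx : x = 0
  · subst hx
    exact hstar y J hxy.symm
  by_cases hy : y = 0
  · subst hy
    rw [Equiv.swap_comm]
    exact hstar x J hxy
  · have h1 : J ∘ Equiv.swap x y
        = ((J ∘ Equiv.swap 0 x) ∘ Equiv.swap 0 y) ∘ Equiv.swap 0 x := by
      funext z
      have := Equiv.swap_mul_swap_mul_swap (x := y) (y := 0) (z := x) hy hxy.symm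
      rw [Equiv.swap_comm y 0] at this
      rw [← this]
      rfl
    rw [h1, hstar x _ hx, hstar y _ hy, hstar x _ hx]
    ring

end DerivativeCoefficient

/-! ### Norms and alternating parts under pull-back -/

section NormForm

variable {n k : ℕ}

/-- The inner product of a tensor with itself; `h` stands for the inverse metric. -/
noncomputable def normForm (h : Fin n → Fin n → ℝ) (z : (Fin k → Fin n) → ℝ) : ℝ :=
  ∑ I, ∑ J, (∏ a, h (I a) (J a)) * z I * z J

/-- The transformation law of a bivector. -/
noncomputable def push2 (S h : Fin n → Fin n → ℝ) (a b : Fin n) : ℝ :=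
  ∑ i, ∑ j, S a i * h i j * S b j

/-- Pulling back a tensor amounts to pushing forward the inverse metric. -/
lemma normForm_pullT (S h : Fin n → Fin n → ℝ) (z : (Fin k → Fin n) → ℝ) :
    normForm h (pullT S z) = normForm (push2 S h) z := by
  have h1 : ∀ A B : Fin k → Fin n, ∏ a, push2 S h (A a) (B a)
      = ∑ I : Fin k → Fin n, ∑ J : Fin k → Fin n,
        (∏ a, h (I a) (J a)) * (∏ a, S (A a) (I a)) * ∏ a, S (B a) (J a) := by
    intro A B
    simp only [push2, Finset.prod_univ_sum, Fintype.piFinset_univ]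
    refine Finset.sum_congr rfl fun I _ => Finset.sum_congr rfl fun J _ => ?_
    rw [← Finset.prod_mul_distrib, ← Finset.prod_mul_distrib]
    exact Finset.prod_congr rfl fun a _ => by ring
  have h2 : normForm h (pullT S z) = ∑ I : Fin k → Fin n, ∑ J : Fin k → Fin n,
      ∑ A : Fin k → Fin n, ∑ B : Fin k → Fin n, ((∏ a, h (I a) (J a)) *
      (∏ a, S (A a) (I a)) * ∏ a, S (B a) (J a)) * z A * z B := by
    simp only [normForm, pullT]
    refine Finset.sum_congr rfl fun I _ => Finset.sum_congr rfl fun J _ => ?_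
    rw [mul_assoc, Finset.sum_mul_sum, Finset.mul_sum]
    refine Finset.sum_congr rfl fun A _ => ?_
    rw [Finset.mul_sum]
    exact Finset.sum_congr rfl fun B _ => by ring
  have h3 : normForm (push2 S h) z = ∑ A : Fin k → Fin n, ∑ B : Fin k → Fin n,
      ∑ I : Fin k → Fin n, ∑ J : Fin k → Fin n, ((∏ a, h (I a) (J a)) *
      (∏ a, S (A a) (I a)) * ∏ a, S (B a) (J a)) * z A * z B := by
    simp only [normForm, h1, Finset.sum_mul]
  rw [h2, h3, Finset.sum_congr rfl fun I _ => Finset.sum_comm, Finset.sum_comm]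
  refine Finset.sum_congr rfl fun A _ => ?_
  rw [Finset.sum_congr rfl fun I _ => Finset.sum_comm, Finset.sum_comm]

lemma normForm_minkowski (z : (Fin k → Fin n) → ℝ) :
    normForm minkowski z = ∑ I, (∏ a, eps (I a)) * z I ^ 2 := by
  refine Finset.sum_congr rfl fun I _ => ?_
  have h1 : ∀ J : Fin k → Fin n, (∏ a, minkowski (I a) (J a)) * z I * z J
      = ((∏ a, eps (I a)) * z I * z J) * ∏ a, delta (J a) (I a) := by
    intro J
    simp only [minkowski_eq, Finset.prod_mul_distrib]
    rw [Finset.prod_congr rfl fun a _ => delta_comm (J a) (I a)]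
    ring
  rw [Finset.sum_congr rfl fun J _ => h1 J, sum_mul_prod_delta I]
  ring

lemma normForm_smul (h : Fin n → Fin n → ℝ) (t : ℝ) (z : (Fin k → Fin n) → ℝ) :
    normForm h (t • z) = t ^ 2 * normForm h z := by
  simp only [normForm, Finset.mul_sum, Pi.smul_apply, smul_eq_mul]
  exact Finset.sum_congr rfl fun I _ => Finset.sum_congr rfl fun J _ => by ring

lemma pullT_alt (S : Fin n → Fin n → ℝ) (u : (Fin k → Fin n) → ℝ) :
    pullT S (alt u) = alt (pullT S u) := by
  funext I
  simp only [pullT, alt, Finset.sum_mul, Finset.mul_sum]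
  rw [Finset.sum_comm]
  refine Finset.sum_congr rfl fun σ _ => ?_
  rw [← Equiv.sum_comp (Equiv.arrowCongr σ (Equiv.refl (Fin n)))]
  refine Finset.sum_congr rfl fun A _ => ?_
  have h2 : (Equiv.arrowCongr σ (Equiv.refl (Fin n))) A = A ∘ (σ⁻¹ : Equiv.Perm (Fin k)) := rfl
  have h5 : (A ∘ (σ⁻¹ : Equiv.Perm (Fin k))) ∘ σ = A := by funext a; simp
  have h4 : ∏ a, S ((A ∘ (σ⁻¹ : Equiv.Perm (Fin k))) a) (I a) = ∏ a, S (A a) ((I ∘ σ) a) := by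
    rw [← Equiv.prod_comp σ]
    simp
  rw [h2, h5, h4, mul_assoc]

end NormForm

/-! ### The coefficients at an arbitrary metric -/

section Transfer

variable {n m : ℕ}

/-- Coordinates in which the metric `w`, with inverse `h`, has the Minkowski form. -/
lemma exists_normalize {w h : Fin n → Fin n → ℝ} (hw : IsLorentzForm w)
    (hwh : ∀ i j, ∑ a, w i a * h a j = delta i j) : ∃ R : Fin n → Fin n → ℝ,
    (Matrix.of R).det ≠ 0 ∧ pull2 R w = minkowski ∧ push2 R minkowski = h := by
  obtain ⟨P, hP, hwP⟩ := hw
  have hu : IsUnit P.det := isUnit_iff_ne_zero.2 hP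
  have h1 : P * P⁻¹ = 1 := Matrix.mul_nonsing_inv P hu
  have h2 : P⁻¹ * P = 1 := Matrix.nonsing_inv_mul P hu
  have h3 : P⁻¹.transpose * P.transpose = 1 := by
    rw [← Matrix.transpose_mul, h1, Matrix.transpose_one]
  have hη : (Matrix.of minkowski : Matrix (Fin n) (Fin n) ℝ) * Matrix.of minkowski = 1 := by
    ext i j
    rw [Matrix.mul_apply]
    have e : ∀ x : Fin n, Matrix.of minkowski i x * Matrix.of minkowski x j
        = (eps i * delta i x * eps x) * delta x j := fun x => by
      rw [Matrix.of_apply, Matrix.of_apply, minkowski_eq, minkowski_eq]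
      ring
    rw [Finset.sum_congr rfl fun x _ => e x, sum_mul_delta, Matrix.one_apply, delta]
    split_ifs with hij
    · rw [hij, mul_one, eps_mul_self]
    · rw [mul_zero, zero_mul]
  have hW : Matrix.of w * Matrix.of h = 1 := by
    ext i j
    rw [Matrix.mul_apply]
    simpa [Matrix.one_apply, delta] using hwh i j
  have hpush : Matrix.of (push2 (fun i j => P⁻¹ i j) minkowski)
      = P⁻¹ * Matrix.of minkowski * P⁻¹.transpose := by
    ext i j
    simp only [push2, Matrix.of_apply, Matrix.mul_apply, Matrix.transpose_apply, Finset.sum_mul]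
    rw [Finset.sum_comm]
  refine ⟨fun i j => P⁻¹ i j, ?_, ?_, ?_⟩
  · change (P⁻¹).det ≠ 0
    rw [Matrix.det_nonsing_inv]
    simpa using hP
  · apply Matrix.of.injective
    rw [of_pull2, hwP]
    change P⁻¹.transpose * (P.transpose * Matrix.of minkowski * P) * P⁻¹ = _
    calc _ = (P⁻¹.transpose * P.transpose) * Matrix.of minkowski * (P * P⁻¹) := by
          simp only [Matrix.mul_assoc]
      _ = _ := by rw [h1, h3, one_mul, mul_one]
  · apply Matrix.of.injective
    rw [hpush]
    have h4 : (P⁻¹ * Matrix.of minkowski * P⁻¹.transpose) * Matrix.of w = 1 := by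
      rw [hwP]
      calc _ = P⁻¹ * Matrix.of minkowski * (P⁻¹.transpose * P.transpose) * Matrix.of minkowski * P := by
            simp only [Matrix.mul_assoc]
        _ = P⁻¹ * (Matrix.of minkowski * Matrix.of minkowski) * P := by
            rw [h3, mul_one]; simp only [Matrix.mul_assoc]
        _ = 1 := by rw [hη, mul_one, h2]
    calc _ = (P⁻¹ * Matrix.of minkowski * P⁻¹.transpose) * (Matrix.of w * Matrix.of h) := by
          rw [hW, mul_one]
      _ = Matrix.of h := by rw [← Matrix.mul_assoc, h4, one_mul]

lemma curvForm_product (h : Fin n → Fin n → ℝ) (A B C D : Fin n → ℝ) :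
    curvForm h (fun i j k l => A i * B j * C k * D l)
      = (1 / 2) * ((∑ i, ∑ j, C i * h i j * A j) * (∑ i, ∑ j, D i * h i j * B j)
        - (∑ i, ∑ j, A i * h i j * B j) * (∑ i, ∑ j, D i * h i j * C j)
        - (∑ i, ∑ j, C i * h i j * D j) * (∑ i, ∑ j, A i * h i j * B j)
        + (∑ i, ∑ j, A i * h i j * D j) * (∑ i, ∑ j, B i * h i j * C j)) := by
  have e : ∀ X Y : Fin n → Fin n → ℝ, (∑ j, ∑ k, X j k) * (∑ i, ∑ b, Y i b)
      = ∑ j, ∑ k, ∑ i, ∑ b, X j k * Y i b := fun X Y => by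
    simp only [Finset.sum_mul]
    simp only [Finset.mul_sum]
  rw [e, e, e, e, curvForm]
  simp only [Finset.mul_sum, ← Finset.sum_sub_distrib, ← Finset.sum_add_distrib]
  exact Finset.sum_congr rfl fun j _ => Finset.sum_congr rfl fun k _ =>
    Finset.sum_congr rfl fun i _ => Finset.sum_congr rfl fun b _ => by ring

/-- The analogue of `normForm_pullT`, checked on the tensor products of coordinate covectors. -/
lemma curvForm_pull4 (S h : Fin n → Fin n → ℝ) (a : Fin n → Fin n → Fin n → Fin n → ℝ) :
    curvForm h (pull4 S a) = curvForm (push2 S h) a := by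
  have hadd : ∀ (h : Fin n → Fin n → ℝ) (a b : Fin n → Fin n → Fin n → Fin n → ℝ),
      curvForm h (a + b) = curvForm h a + curvForm h b := fun h a b => by
    simp only [curvForm, Pi.add_apply, ← Finset.sum_add_distrib, ← mul_add]
    refine Finset.sum_congr rfl fun j _ => Finset.sum_congr rfl fun k _ => ?_
    congr 1
    exact Finset.sum_congr rfl fun i _ => Finset.sum_congr rfl fun b _ => by ring
  have hsmul : ∀ (h : Fin n → Fin n → ℝ) (t : ℝ) (a : Fin n → Fin n → Fin n → Fin n → ℝ),
      curvForm h (t • a) = t * curvForm h a := fun h t a => by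
    simp only [curvForm, Pi.smul_apply, Finset.mul_sum, smul_eq_mul]
    exact Finset.sum_congr rfl fun j _ => Finset.sum_congr rfl fun k _ =>
      Finset.sum_congr rfl fun i _ => Finset.sum_congr rfl fun b _ => by ring
  let f₁ : (Fin n → Fin n → Fin n → Fin n → ℝ) →ₗ[ℝ] ℝ :=
    { toFun := fun a => curvForm h (pull4 S a)
      map_add' := fun a b => by rw [pull4_add, hadd]
      map_smul' := fun t a => by rw [pull4_smul, hsmul]; rfl }
  let f₂ : (Fin n → Fin n → Fin n → Fin n → ℝ) →ₗ[ℝ] ℝ :=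
    { toFun := fun a => curvForm (push2 S h) a
      map_add' := fun a b => by rw [hadd]
      map_smul' := fun t a => by rw [hsmul]; rfl }
  have hunit : ∀ p q r s, f₁ (unit4 p q r s) = f₂ (unit4 p q r s) := by
    intro p q r s
    have e1 : pull4 S (unit4 p q r s) = fun i j k l => S p i * S q j * S r k * S s l := by
      funext i j k l
      rw [pull4_unit4]
    have e2 : (unit4 p q r s : Fin n → Fin n → Fin n → Fin n → ℝ)
      = fun i j k l => delta p i * delta q j * delta r k * delta s l := rfl
    have e3 : ∀ (H : Fin n → Fin n → ℝ) (p q : Fin n),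
        ∑ i, ∑ j, delta p i * H i j * delta q j = H p q := fun H p q => by simp [delta]
    change curvForm h (pull4 S (unit4 p q r s)) = curvForm (push2 S h) (unit4 p q r s)
    rw [e1, e2, curvForm_product, curvForm_product]
    simp only [e3, push2]
  change f₁ a = f₂ a
  rw [eq_sum_unit4 a]
  simp only [map_sum, map_smul, hunit]

variable {L : JetSpace n m → ℝ} (hL : ContDiffOn ℝ ∞ L (jetDomain n m))
  (hquad : IsQuadraticInDerivatives L) (hinv : IsCoordinateInvariant.{u} L)

include hL hquad hinv

/-- The coefficient of the second derivatives of the metric is a constant multiple of `curvForm`: at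
the Minkowski form by `exists_eq_curvForm`, and at any other metric by equivariance. -/
lemma exists_linPart_incl4_eq : ∃ b : ℝ, ∀ w h : Fin n → Fin n → ℝ, IsLorentzForm w →
    (∀ i j, ∑ a, w i a * h a j = delta i j) → ∀ w4 : Fin n → Fin n → Fin n → Fin n → ℝ,
    (∀ i j k l, w4 i j k l = w4 j i k l) → (∀ i j k l, w4 i j k l = w4 i j l k) →
      linPart L w (incl4 w4) = b * curvForm h w4 := by
  let f : (Fin n → Fin n → Fin n → Fin n → ℝ) →ₗ[ℝ] ℝ :=
    { toFun := fun a => linPart L minkowski (incl4 a)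
      map_add' := fun a b => by rw [incl4_add, linPart_add]
      map_smul' := fun t a => by rw [incl4_smul, linPart_smul]; rfl }
  have hη : IsLorentzForm (minkowski : Fin n → Fin n → ℝ) := isLorentzForm_minkowski
  have hsym : ∀ p q r s i j k l : Fin n, symUnit4 p q r s i j k l = symUnit4 p q r s j i k l ∧
      symUnit4 p q r s i j k l = symUnit4 p q r s i j l k := fun p q r s i j k l => by
    constructor <;> simp only [symUnit4_apply] <;> ring
  obtain ⟨b, hb⟩ := exists_eq_curvForm (f := f) (by
    obtain ⟨h, hwh⟩ := exists_inverse_array hη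
    exact map_symUnit4_cyclic (f := f) hη.symm hwh fun C hC hC' =>
      (linPart_quadForm_shiftC hL hquad hinv hη hC hC').1) (by
    intro S hS p q r s
    have := linPart_pull4 hL hquad hinv hη (det_ne_zero_of_pull2 hS)
      (fun i j k l => (hsym p q r s i j k l).1) (fun i j k l => (hsym p q r s i j k l).2)
    rwa [hS] at this)
  refine ⟨b, fun w h hw hwh w4 hw4 hw4' => ?_⟩
  obtain ⟨R, hR, hRw, hRh⟩ := exists_normalize hw hwh
  rw [← linPart_pull4 hL hquad hinv hw hR hw4 hw4', hRw, ← hRh, ← curvForm_pull4]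
  refine hb _ (fun i j k l => ?_) (fun i j k l => ?_)
  · rw [pull4, pull4, Finset.sum_comm]
    refine Finset.sum_congr rfl fun a _ => Finset.sum_congr rfl fun b _ => ?_
    rw [Finset.sum_congr rfl fun c _ => Finset.sum_congr rfl fun d _ => by rw [hw4 b a c d]]
    ring
  · rw [pull4, pull4]
    refine Finset.sum_congr rfl fun a _ => Finset.sum_congr rfl fun b _ => ?_
    rw [Finset.sum_comm]
    refine congrArg (· * _) (Finset.sum_congr rfl fun c _ => Finset.sum_congr rfl fun d _ => ?_)
    rw [hw4' a b d c]
    ring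

/-- The quadratic coefficient of the derivatives of `D` is a constant multiple of the norm of the
alternating part. At the Minkowski form it is alternating since it ignores second order coordinate
changes, whence `exists_eq_mul_sum_alt`; other metrics follow by equivariance. -/
lemma exists_quadForm_inclDY_eq : ∃ c : ℝ, ∀ w h : Fin n → Fin n → ℝ, IsLorentzForm w →
    (∀ i j, ∑ a, w i a * h a j = delta i j) → ∀ y' : (Fin m → Fin n) → Fin n → ℝ,
      quadForm L w (inclDY y') (inclDY y') = c * normForm h (alt (derivFirst y')) := by
  have hη : IsLorentzForm (minkowski : Fin n → Fin n → ℝ) := isLorentzForm_minkowski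
  have hη' : (minkowski : Fin n → Fin n → ℝ) ∈ nondegenerate n := hη.det_ne_zero
  have hadd : ∀ u v : (Fin (m + 1) → Fin n) → ℝ,
      inclDY (derivLast (u + v)) = inclDY (derivLast u) + inclDY (derivLast v) := fun u v => by
    rw [← inclDY_add]; rfl
  have hsmul : ∀ (t : ℝ) (u : (Fin (m + 1) → Fin n) → ℝ),
      inclDY (derivLast (t • u)) = t • inclDY (derivLast u) := fun t u => by
    rw [← inclDY_smul]; rfl
  let B : ((Fin (m + 1) → Fin n) → ℝ) →ₗ[ℝ] ((Fin (m + 1) → Fin n) → ℝ) →ₗ[ℝ] ℝ :=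
    LinearMap.mk₂ ℝ (fun u v => quadForm L minkowski (inclDY (derivLast u)) (inclDY (derivLast v)))
      (fun u u' v => by rw [hadd, quadForm_add_left])
      (fun t u v => by rw [hsmul, quadForm_smul_left]; rfl)
      (fun u v v' => by rw [hadd, quadForm_add_right])
      (fun t u v => by rw [hsmul, quadForm_smul_right]; rfl)
  have hB : ∀ u v, B u v = B v u := fun u v => quadForm_symm hL hη' _ _
  obtain ⟨c, hc⟩ := exists_eq_mul_sum_alt hB (by
    intro I v x y hxy
    rw [hB, hB _ v]
    refine map_single_comp_swap (f := B v) (fun K k i j => ?_) I hxy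
    have := (quadForm_inclDY_shiftY hL hquad hinv hη (Pi.single K 1) (derivLast v)
      (Q := fun c p q => delta c k * (delta p i * delta q j + delta p j * delta q i))
      (fun a p q => by ring)).1
    rw [shiftY_single] at this
    exact this) (by
    intro S hS u
    have := quadForm_pullDY hL hquad hinv hη (det_ne_zero_of_pull2 hS) (derivLast u) (derivLast u)
    rw [hS, ← derivLast_pullT] at this
    exact this)
  refine ⟨c, fun w h hw hwh y' => ?_⟩
  obtain ⟨R, hR, hRw, hRh⟩ := exists_normalize hw hwh
  rw [← quadForm_pullDY hL hquad hinv hw hR, hRw, ← hRh, ← normForm_pullT, pullT_alt,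
    normForm_minkowski, ← hc]
  change _ = quadForm L minkowski (inclDY (derivLast _)) (inclDY (derivLast _))
  rw [derivLast_pullT, derivLast_derivFirst]

end Transfer

/-! ### Coordinate expressions of the fields -/

section Components

variable {n m : ℕ} {M : Type*} [TopologicalSpace M] [ChartedSpace (E n) M]

lemma contDiffOn_tensorComp {e : OpenPartialHomeomorph M (E n)} (he : e ∈ charts n M)
    {T : TensorField n m M} (hT : IsSmooth T) (I : Fin m → Fin n) :
    ContDiffOn ℝ ∞ (tensorComp e T I) e.target :=
  (ContinuousMultilinearMap.apply ℝ (fun _ : Fin m => E n) ℝ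
    (fun a => basisVec (I a))).contDiff.comp_contDiffOn (hT e he)

lemma isLorentzForm_metricComp [IsManifold (𝓡 n) ∞ M] {e : OpenPartialHomeomorph M (E n)}
    (he : e ∈ charts n M) {g : TensorField n 2 M} (hg : IsLorentzMetric g) {x : E n}
    (hx : x ∈ e.target) : IsLorentzForm (metricComp e g x) := by
  obtain ⟨b, hb⟩ := hg.signature (e.symm x)
  let v : Fin n → TangentSpace (𝓡 n) (e.symm x) := fun i =>
    mfderiv (𝓡 n) (𝓡 n) e.symm x (basisVec i : E n)
  let P : Matrix (Fin n) (Fin n) ℝ := Matrix.of fun a i => b.repr (v i) a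
  have hv : ∀ i, v i = ∑ a, P a i • b a := fun i => (b.sum_repr (v i)).symm
  refine ⟨P, fun h0 => ?_, ?_⟩
  · obtain ⟨c, hc, hPc⟩ := Matrix.exists_mulVec_eq_zero_iff.2 h0
    apply hc
    have h1 : ∑ i, c i • v i = 0 := by
      simp only [hv, Finset.smul_sum, smul_smul]
      rw [Finset.sum_comm]
      refine Finset.sum_eq_zero fun a _ => ?_
      rw [← Finset.sum_smul]
      have h2 := congrFun hPc a
      rw [Matrix.mulVec, dotProduct] at h2
      rw [Finset.sum_congr rfl fun i _ => mul_comm (c i) (P a i), h2, Pi.zero_apply, zero_smul]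
    have h3 : (mfderiv (𝓡 n) (𝓡 n) e (e.symm x) : E n →L[ℝ] E n) (∑ i, c i • v i)
        = ∑ i, c i • (basisVec i : E n) := by
      rw [map_sum]
      refine Finset.sum_congr rfl fun i _ => ?_
      rw [map_smul]
      congr 1
      exact mfderiv_chart_symm_left_inv he hx (basisVec i)
    rw [h1, map_zero] at h3
    funext i
    have h4 := congrArg (fun z : E n => z i) h3
    have h5 : (∑ i, c i • (basisVec i : E n)) i = c i := by
      simp [basisVec, Finset.sum_apply, Pi.single_apply]
    rw [← h5]
    exact h4.symm
  · ext i j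
    rw [transpose_mul_mul_apply]
    change g (e.symm x) (fun a => v (![i, j] a)) = _
    have h5 : (fun a => v (![i, j] a)) = fun a : Fin 2 => ∑ c, P c (![i, j] a) • b c :=
      funext fun a => hv _
    rw [h5]
    refine ((g (e.symm x)).toMultilinearMap.map_sum _).trans ?_
    rw [← sum_fin_two_arrow fun a c => Matrix.of minkowski a c * P a i * P c j]
    refine Finset.sum_congr rfl fun A _ => ?_
    refine ((g (e.symm x)).toMultilinearMap.map_smul_univ _ _).trans ?_
    have h6 : (fun a => b (A a)) = ![b (A 0), b (A 1)] := by
      funext a; fin_cases a <;> rfl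
    rw [h6, Fin.prod_univ_two, smul_eq_mul, ContinuousMultilinearMap.coe_coe, hb]
    simp only [Matrix.cons_val_zero, Matrix.cons_val_one, Matrix.of_apply]
    ring

lemma alternatization_bound (f : ContinuousMultilinearMap ℝ (fun _ : Fin m => E n) ℝ) :
    ‖ContinuousMultilinearMap.alternatization f‖ ≤ m.factorial * ‖f‖ := by
  refine ContinuousAlternatingMap.opNorm_le_bound _ (by positivity) fun v => ?_
  rw [ContinuousMultilinearMap.alternatization_apply_apply]
  refine (norm_sum_le _ _).trans ?_
  have h : ∀ σ ∈ (Finset.univ : Finset (Equiv.Perm (Fin m))),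
      ‖Equiv.Perm.sign σ • f (v ∘ σ)‖ ≤ ‖f‖ * ∏ i, ‖v i‖ := by
    intro σ _
    have h1 : ‖Equiv.Perm.sign σ • f (v ∘ σ)‖ = ‖f (v ∘ σ)‖ := by
      rcases Int.units_eq_one_or (Equiv.Perm.sign σ) with h | h <;> simp [h]
    rw [h1, ← Equiv.prod_comp σ fun i => ‖v i‖]
    exact f.le_opNorm _
  refine (Finset.sum_le_sum h).trans ?_
  simp [Finset.card_univ, Fintype.card_perm, mul_assoc]

lemma differentiableAt_altPart {e : OpenPartialHomeomorph M (E n)} (he : e ∈ charts n M)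
    {D : TensorField n m M} (hD : IsSmooth D) {x : E n} (hx : x ∈ e.target) :
    DifferentiableAt ℝ (altPart e D) x := by
  let A : ContinuousMultilinearMap ℝ (fun _ : Fin m => E n) ℝ →L[ℝ] (E n) [⋀^Fin m]→L[ℝ] ℝ :=
    LinearMap.mkContinuous
      { toFun := fun f => ContinuousMultilinearMap.alternatization f
        map_add' := map_add _
        map_smul' := fun t f => by
          ext v
          simp only [ContinuousMultilinearMap.alternatization_apply_apply,
            smul_apply, RingHom.id_apply,
            ContinuousAlternatingMap.smul_apply, Finset.smul_sum]
          exact Finset.sum_congr rfl fun σ _ => smul_comm _ _ _ }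
      m.factorial alternatization_bound
  have h1 : DifferentiableAt ℝ (inChart e D) x :=
    ((hD e he).contDiffAt (e.open_target.mem_nhds hx)).differentiableAt (by simp)
  exact (A.differentiableAt.comp x h1).const_smul ((m.factorial : ℝ)⁻¹)

/-- A permutation of `m + 1` indices is a choice of the index in the first place followed by a
permutation of the remaining ones. -/
lemma alt_eq_sum_removeNth (u : (Fin (m + 1) → Fin n) → ℝ) (I : Fin (m + 1) → Fin n) :
    alt u I = ∑ i : Fin (m + 1), ∑ σ : Equiv.Perm (Fin m), (-1) ^ (i : ℕ) *
      (((Equiv.Perm.sign σ : ℤ) : ℝ) * u (Fin.cons (I i) (i.removeNth I ∘ σ))) := by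
  let τ : Fin (m + 1) × Equiv.Perm (Fin m) → Equiv.Perm (Fin (m + 1)) := fun q =>
    (Fin.cycleRange q.1)⁻¹ * Equiv.Perm.decomposeFin.symm (0, q.2)
  have hτ : Function.Bijective τ := by
    rw [Fintype.bijective_iff_injective_and_card]
    constructor
    · rintro ⟨i, σ⟩ ⟨j, ρ⟩ h
      have h0 := congrArg (fun π : Equiv.Perm (Fin (m + 1)) => π 0) h
      have hij : i = j := by simpa [τ, Equiv.Perm.inv_def] using h0
      subst hij
      have h1 := Equiv.Perm.decomposeFin.symm.injective (mul_left_cancel h)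
      simpa using h1
    · simp [Fintype.card_perm, Nat.factorial_succ]
  rw [alt, ← hτ.sum_comp, Fintype.sum_prod_type]
  refine Finset.sum_congr rfl fun i _ => Finset.sum_congr rfl fun σ _ => ?_
  have h1 : I ∘ τ (i, σ) = Fin.cons (I i) (i.removeNth I ∘ σ) := by
    have h2 : I ∘ τ (i, σ) = (I ∘ i.cycleRange.symm) ∘ Equiv.Perm.decomposeFin.symm (0, σ) := rfl
    rw [h2, ← Fin.cons_removeNth_eq_comp_cycleRange_symm]
    funext a
    refine Fin.cases ?_ (fun b => ?_) a
    · simp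
    · simp
  rw [h1]
  simp only [τ, Equiv.Perm.sign_mul, Equiv.Perm.sign_inv, Fin.sign_cycleRange,
    Equiv.Perm.decomposeFin.symm_sign]
  push_cast
  ring

/-- The components of `dγ` are, up to the factor `1/m!`, the signed sums of the first derivatives
of `D`. -/
lemma dAltComp_eq {e : OpenPartialHomeomorph M (E n)} (he : e ∈ charts n M)
    {D : TensorField n m M} (hD : IsSmooth D) {x : E n} (hx : x ∈ e.target)
    (I : Fin (m + 1) → Fin n) : dAltComp e D I x
      = (m.factorial : ℝ)⁻¹ * alt (derivFirst fun I j => partialD j (tensorComp e D I) x) I := by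
  have hd : ∀ I, DifferentiableAt ℝ (tensorComp e D I) x := fun I =>
    ((contDiffOn_tensorComp he hD I).contDiffAt (e.open_target.mem_nhds hx)).differentiableAt
      (by simp)
  rw [dAltComp, extDeriv_apply (differentiableAt_altPart he hD hx)]
  have h1 : ∀ i : Fin (m + 1), fderiv ℝ (fun y => altPart e D y
      (i.removeNth fun a => (basisVec (I a) : E n))) x (basisVec (I i))
      = (m.factorial : ℝ)⁻¹ * ∑ σ : Equiv.Perm (Fin m), ((Equiv.Perm.sign σ : ℤ) : ℝ) *
        partialD (I i) (tensorComp e D (i.removeNth I ∘ σ)) x := by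
    intro i
    have h2 : (fun y => altPart e D y (i.removeNth fun a => (basisVec (I a) : E n)))
        = fun y => (m.factorial : ℝ)⁻¹ * ∑ σ : Equiv.Perm (Fin m),
          ((Equiv.Perm.sign σ : ℤ) : ℝ) * tensorComp e D (i.removeNth I ∘ σ) y := by
      funext y
      rw [altPart, ContinuousAlternatingMap.smul_apply,
        ContinuousMultilinearMap.alternatization_apply_apply, smul_eq_mul]
      congr 1
      refine Finset.sum_congr rfl fun σ _ => ?_
      rw [Units.smul_def, zsmul_eq_mul]
      rfl
    have h3 := (HasPartialAt.sum (k := I i) (s := Finset.univ) fun (σ : Equiv.Perm (Fin m)) _ =>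
      HasPartialAt.const_mul ((Equiv.Perm.sign σ : ℤ) : ℝ)
        ⟨hd (i.removeNth I ∘ σ), rfl⟩).const_mul ((m.factorial : ℝ)⁻¹)
    rw [h2]
    exact h3.eq
  rw [Finset.sum_congr rfl fun i _ => by rw [h1 i]]
  rw [alt_eq_sum_removeNth, Finset.mul_sum]
  simp only [derivFirst, Fin.cons_zero, Fin.tail_cons]
  refine Finset.sum_congr rfl fun i _ => ?_
  rw [← Finset.mul_sum, zsmul_eq_mul]
  push_cast
  ring

/-- The factor comes from the normalization `1/m!` of `γ`, while `alt` is a sum without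
normalization. -/
lemma normSqDAlt_eq {e : OpenPartialHomeomorph M (E n)} (he : e ∈ charts n M)
    (g : TensorField n 2 M) {D : TensorField n m M} (hD : IsSmooth D) {x : E n}
    (hx : x ∈ e.target) : normSqDAlt e g D x = ((m.factorial : ℝ)⁻¹) ^ 2 *
      normForm (metricInv e g x) (alt (derivFirst fun I j => partialD j (tensorComp e D I) x)) := by
  rw [← normForm_smul, normSqDAlt, normForm]
  simp only [dAltComp_eq he hD hx, Pi.smul_apply, smul_eq_mul]

end Components

/-! ### The scalar curvature in terms of the two-jet of the metric -/

section Curvature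

variable {n : ℕ} {M : Type*} [TopologicalSpace M] [ChartedSpace (E n) M]
  {e : OpenPartialHomeomorph M (E n)} {g : TensorField n 2 M} {x : E n}

lemma partialD_comm {f : E n → ℝ} (hf : ContDiffAt ℝ ∞ f x) (k l : Fin n) :
    partialD l (partialD k f) x = partialD k (partialD l f) x := by
  have hd : DifferentiableAt ℝ (fderiv ℝ f) x :=
    (hf.fderiv_right (m := ∞) (by simp)).differentiableAt (by simp)
  have h : ∀ k l : Fin n, partialD l (partialD k f) x
      = fderiv ℝ (fderiv ℝ f) x (basisVec l) (basisVec k) := fun k l => by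
    have h1 : partialD k f = fun y => fderiv ℝ f y (basisVec k) := rfl
    rw [partialD, h1, fderiv_clm_apply hd (differentiableAt_const _)]
    simp
  rw [h, h]
  exact (hf.isSymmSndFDerivAt (by
    simpa using (WithTop.coe_le_coe.2 le_top : ((2 : ℕ∞) : WithTop ℕ∞) ≤ ((⊤ : ℕ∞) : WithTop ℕ∞))))
      _ _

lemma metricComp_symm (e : OpenPartialHomeomorph M (E n)) (hg : IsLorentzMetric g) (x : E n)
    (i j : Fin n) : metricComp e g x i j = metricComp e g x j i := by
  let v : Fin n → TangentSpace (𝓡 n) (e.symm x) := fun i =>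
    mfderiv (𝓡 n) (𝓡 n) e.symm x (basisVec i : E n)
  have h : ∀ i j, metricComp e g x i j = g (e.symm x) ![v i, v j] := fun i j => by
    change g (e.symm x) (fun a => v (![i, j] a)) = _
    congr 1
    funext a
    fin_cases a <;> rfl
  rw [h, h, hg.symm]

lemma contDiffAt_metricComp (he : e ∈ charts n M) (hg : IsLorentzMetric g) (hx : x ∈ e.target)
    (i j : Fin n) : ContDiffAt ℝ ∞ (fun y => metricComp e g y i j) x :=
  (contDiffOn_tensorComp he hg.smooth ![i, j]).contDiffAt (e.open_target.mem_nhds hx)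

variable [IsManifold (𝓡 n) ∞ M]

lemma sum_metricComp_mul_metricInv (he : e ∈ charts n M) (hg : IsLorentzMetric g)
    (hx : x ∈ e.target) (i j : Fin n) :
    ∑ a, metricComp e g x i a * metricInv e g x a j = delta i j := by
  have := congrFun (congrFun (Matrix.mul_nonsing_inv (Matrix.of (metricComp e g x))
    (isUnit_iff_ne_zero.2 (isLorentzForm_metricComp he hg hx).det_ne_zero)) i) j
  rw [Matrix.mul_apply] at this
  rw [delta, ← Matrix.one_apply]
  exact this

lemma sum_metricInv_mul_metricComp (he : e ∈ charts n M) (hg : IsLorentzMetric g)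
    (hx : x ∈ e.target) (i j : Fin n) :
    ∑ a, metricInv e g x i a * metricComp e g x a j = delta i j := by
  have := congrFun (congrFun (Matrix.nonsing_inv_mul (Matrix.of (metricComp e g x))
    (isUnit_iff_ne_zero.2 (isLorentzForm_metricComp he hg hx).det_ne_zero)) i) j
  rw [Matrix.mul_apply] at this
  rw [delta, ← Matrix.one_apply]
  exact this

lemma differentiableAt_det {ι : Type*} [Fintype ι] [DecidableEq ι] {F : E n → Matrix ι ι ℝ}
    (hF : ∀ i j, DifferentiableAt ℝ (fun y => F y i j) x) :
    DifferentiableAt ℝ (fun y => (F y).det) x := by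
  simp only [Matrix.det_apply']
  exact DifferentiableAt.fun_sum fun σ _ =>
    DifferentiableAt.const_mul
      (HasFDerivAt.finsetProd fun i _ => (hF (σ i) i).hasFDerivAt).differentiableAt _

lemma differentiableAt_metricInv (he : e ∈ charts n M) (hg : IsLorentzMetric g)
    (hx : x ∈ e.target) (i j : Fin n) :
    DifferentiableAt ℝ (fun y => metricInv e g y i j) x := by
  have hd : ∀ i j, DifferentiableAt ℝ (fun y => metricComp e g y i j) x := fun i j =>
    (contDiffAt_metricComp he hg hx i j).differentiableAt (by simp)
  have h1 : (fun y => metricInv e g y i j) = fun y => (Matrix.of (metricComp e g y)).det⁻¹ *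
      ((Matrix.of (metricComp e g y)).updateRow j (Pi.single i 1)).det := by
    funext y
    rw [metricInv, Matrix.inv_def, Matrix.smul_apply, Matrix.adjugate_apply, Ring.inverse_eq_inv',
      smul_eq_mul]
  rw [h1]
  refine ((differentiableAt_det fun i j => hd i j).inv
    (isLorentzForm_metricComp he hg hx).det_ne_zero).mul (differentiableAt_det fun k l => ?_)
  simp only [Matrix.updateRow_apply]
  split_ifs
  · exact differentiableAt_const _
  · exact hd k l

/-- The Christoffel symbols of the first kind. -/
lemma sum_metricComp_mul_christoffel (he : e ∈ charts n M) (hg : IsLorentzMetric g)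
    (hx : x ∈ e.target) (b j k : Fin n) :
    ∑ a, metricComp e g x b a * christoffel e g a j k x
      = (1 / 2) * (partialD k (fun y => metricComp e g y j b) x
        + partialD j (fun y => metricComp e g y k b) x
        - partialD b (fun y => metricComp e g y j k) x) := by
  let F : Fin n → ℝ := fun b => partialD k (fun y => metricComp e g y j b) x
        + partialD j (fun y => metricComp e g y k b) x
        - partialD b (fun y => metricComp e g y j k) x
  have h1 : ∀ a, metricComp e g x b a * christoffel e g a j k x
      = ∑ c, (1 / 2) * F c * (metricComp e g x b a * metricInv e g x a c) := fun a => by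
    simp only [christoffel, Finset.mul_sum]
    exact Finset.sum_congr rfl fun c _ => by simp only [F]; ring
  rw [Finset.sum_congr rfl fun a _ => h1 a, Finset.sum_comm]
  simp only [← Finset.mul_sum, sum_metricComp_mul_metricInv he hg hx]
  rw [Finset.sum_congr rfl fun c _ => by rw [delta_comm b c], sum_mul_delta]

omit [IsManifold (𝓡 n) ∞ M] in
lemma christoffel_symm (e : OpenPartialHomeomorph M (E n)) (hg : IsLorentzMetric g) (x : E n)
    (i j k : Fin n) : christoffel e g i j k x = christoffel e g i k j x := by
  simp only [christoffel]
  congr 1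
  refine Finset.sum_congr rfl fun a _ => ?_
  have h : (fun y => metricComp e g y j k) = fun y => metricComp e g y k j :=
    funext fun y => metricComp_symm e hg y j k
  rw [h]
  ring

/-- The metric is parallel: its first derivatives are those which arise from a constant metric by a
coordinate change with second derivatives `Γ`. -/
lemma partialD_metricComp_eq (he : e ∈ charts n M) (hg : IsLorentzMetric g)
    (hx : x ∈ e.target) (i j k : Fin n) : partialD k (fun y => metricComp e g y i j) x
      = shift3 (metricComp e g x) (fun a i j => christoffel e g a i j x) i j k := by
  have hs : ∀ i j, (fun y => metricComp e g y i j) = fun y => metricComp e g y j i :=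
    fun i j => funext fun y => metricComp_symm e hg y i j
  rw [shift3, Finset.sum_add_distrib, Finset.sum_congr rfl fun a _ => by
    rw [metricComp_symm e hg x a j], sum_metricComp_mul_christoffel he hg hx,
    sum_metricComp_mul_christoffel he hg hx, hs k j, hs j k, hs j i, hs k i, hs k j, hs i k]
  ring

/-- The expression of which the curvature tensor is the antisymmetrization in `k` and `l`, in terms
of the two-jet of the metric. -/
lemma partialD_christoffel_add (he : e ∈ charts n M) (hg : IsLorentzMetric g)
    (hx : x ∈ e.target) (i j k l : Fin n) :
    partialD l (christoffel e g i j k) x + ∑ r, christoffel e g r j k x * christoffel e g i r l x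
      = ∑ b, metricInv e g x i b *
        ((1 / 2) * (partialD l (partialD k (fun y => metricComp e g y j b)) x
          + partialD l (partialD j (fun y => metricComp e g y k b)) x
          - partialD l (partialD b (fun y => metricComp e g y j k)) x)
        - ∑ a, ∑ c, metricComp e g x a c * (christoffel e g a j k x * christoffel e g c b l x)) := by
  have hd : ∀ i j, DifferentiableAt ℝ (fun y => metricComp e g y i j) x := fun i j =>
    (contDiffAt_metricComp he hg hx i j).differentiableAt (by simp)
  have hd2 : ∀ i j k, DifferentiableAt ℝ (partialD k fun y => metricComp e g y i j) x :=
    fun i j k => (((contDiffAt_metricComp he hg hx i j).fderiv_right (m := ∞)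
      (by simp)).clm_apply contDiffAt_const).differentiableAt (by simp)
  have hdF : ∀ j k b, DifferentiableAt ℝ (fun y => partialD k (fun y => metricComp e g y j b) y
      + partialD j (fun y => metricComp e g y k b) y
      - partialD b (fun y => metricComp e g y j k) y) x := fun j k b =>
    ((hd2 j b k).add (hd2 k b j)).sub (hd2 j k b)
  have hdΓ : ∀ i j k, DifferentiableAt ℝ (christoffel e g i j k) x := fun i j k =>
    (DifferentiableAt.fun_sum fun a _ =>
      (differentiableAt_metricInv he hg hx i a).mul (hdF j k a)).const_mul (1 / 2)
  -- Differentiate `g_ba Γ^a_jk = ½ (g_jb,k + g_kb,j - g_jk,b)`.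
  have hkey : ∀ b, ∑ a, (partialD l (fun y => metricComp e g y b a) x * christoffel e g a j k x
      + metricComp e g x b a * partialD l (christoffel e g a j k) x)
      = (1 / 2) * (partialD l (partialD k (fun y => metricComp e g y j b)) x
          + partialD l (partialD j (fun y => metricComp e g y k b)) x
          - partialD l (partialD b (fun y => metricComp e g y j k)) x) := by
    intro b
    have h1 : HasPartialAt l (fun y => ∑ a, metricComp e g y b a * christoffel e g a j k y) _ x :=
      HasPartialAt.sum fun a _ => HasPartialAt.mul ⟨hd b a, rfl⟩ ⟨hdΓ a j k, rfl⟩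
    have h2 := (((HasPartialAt.mk (k := l) (hd2 j b k) rfl).add
      (HasPartialAt.mk (hd2 k b j) rfl)).sub (HasPartialAt.mk (hd2 j k b) rfl)).const_mul (1 / 2)
    rw [← h1.eq, ← h2.eq]
    refine (partialD_congr ?_ l).eq_of_nhds
    filter_upwards [e.open_target.mem_nhds hx] with y hy
    exact sum_metricComp_mul_christoffel he hg hy b j k
  let Y : Fin n → ℝ := fun c => partialD l (christoffel e g c j k) x
    + ∑ r, christoffel e g r j k x * christoffel e g c r l x
  have hY : ∀ b, ∑ c, metricComp e g x b c * Y c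
      = (1 / 2) * (partialD l (partialD k (fun y => metricComp e g y j b)) x
          + partialD l (partialD j (fun y => metricComp e g y k b)) x
          - partialD l (partialD b (fun y => metricComp e g y j k)) x)
        - ∑ a, ∑ c, metricComp e g x a c
          * (christoffel e g a j k x * christoffel e g c b l x) := by
    intro b
    have h1 : ∑ a, partialD l (fun y => metricComp e g y b a) x * christoffel e g a j k x
        = ∑ a, ∑ c, metricComp e g x a c * (christoffel e g a j k x * christoffel e g c b l x)
        + ∑ c, metricComp e g x b c
          * ∑ r, christoffel e g r j k x * christoffel e g c r l x := by
      simp only [partialD_metricComp_eq he hg hx, shift3, Finset.sum_mul, add_mul,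
        Finset.sum_add_distrib, Finset.mul_sum]
      congr 1
      · refine Finset.sum_congr rfl fun a _ => Finset.sum_congr rfl fun c _ => ?_
        rw [metricComp_symm e hg x c a]
        ring
      · rw [Finset.sum_comm]
        exact Finset.sum_congr rfl fun a _ => Finset.sum_congr rfl fun c _ => by ring
    rw [← hkey b, Finset.sum_add_distrib, h1]
    simp only [Y, mul_add, Finset.sum_add_distrib]
    ring
  simp only [← hY, Finset.mul_sum]
  rw [Finset.sum_comm]
  simp only [← mul_assoc, ← Finset.sum_mul, sum_metricInv_mul_metricComp he hg hx]
  exact ((Finset.sum_congr rfl fun c _ => by rw [delta_comm i c, mul_comm]).trans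
    (sum_mul_delta Y i)).symm

/-- The scalar curvature is linear in the second derivatives of the metric that remain once the
coordinate change `Γ` has removed the first ones. -/
lemma scalarCurvature_eq (he : e ∈ charts n M) (hg : IsLorentzMetric g) (hx : x ∈ e.target) :
    scalarCurvature e g x = curvForm (metricInv e g x)
      ((fun i j k l => partialD l (partialD k (fun y => metricComp e g y i j)) x)
        - shiftQQ (metricComp e g x) (fun a i j => christoffel e g a i j x)
          (fun a i j => christoffel e g a i j x)) := by
  let p : Fin n → Fin n → Fin n → Fin n → ℝ := fun j k b l =>
    ∑ a, ∑ c, metricComp e g x a c * (christoffel e g a j k x * christoffel e g c b l x)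
  have hp1 : ∀ j k b l, p j k b l = p b l j k := fun j k b l => by
    simp only [p]
    rw [Finset.sum_comm]
    refine Finset.sum_congr rfl fun a _ => Finset.sum_congr rfl fun c _ => ?_
    rw [metricComp_symm e hg x a c]
    ring
  have hp2 : ∀ j k b l, p j k b l = p k j b l := fun j k b l => by
    simp only [p, christoffel_symm e hg x _ j k]
  have hp3 : ∀ j k b l, p j k b l = p j k l b := fun j k b l => by
    rw [hp1, hp2, hp1]
  have hQQ : ∀ i j k l, shiftQQ (metricComp e g x) (fun a i j => christoffel e g a i j x)
      (fun a i j => christoffel e g a i j x) i j k l = p i k j l + p i l j k := fun i j k l => by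
    simp only [shiftQQ, p, mul_add, Finset.sum_add_distrib]
  rw [scalarCurvature, curvForm]
  refine Finset.sum_congr rfl fun j _ => Finset.sum_congr rfl fun k _ => ?_
  congr 1
  refine Finset.sum_congr rfl fun i _ => ?_
  have h1 := partialD_christoffel_add he hg hx i j k i
  have h2 := partialD_christoffel_add he hg hx i j i k
  have h3 : riemann e g i j k i x = (partialD i (christoffel e g i j k) x
      + ∑ r, christoffel e g r j k x * christoffel e g i r i x)
      - (partialD k (christoffel e g i j i) x
      + ∑ r, christoffel e g r j i x * christoffel e g i r k x) := by
    rw [riemann, Finset.sum_sub_distrib]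
    ring
  rw [h3, h1, h2, ← Finset.sum_sub_distrib]
  refine Finset.sum_congr rfl fun b _ => ?_
  rw [← mul_sub]
  congr 1
  have hc : partialD i (partialD k fun y => metricComp e g y j b) x
      = partialD k (partialD i fun y => metricComp e g y j b) x :=
    partialD_comm (contDiffAt_metricComp he hg hx j b) k i
  simp only [Pi.sub_apply, hQQ]
  change _ - p j k b i - (_ - p j i b k) = _
  have e1 := hp2 k j b i
  have e2 := hp3 j i k b
  have e3 := hp2 i j b k
  have e4 := hp3 j k i b
  have e5 : p k i b j = p j b k i := by rw [hp1, hp2]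
  have e6 : p i k b j = p j b i k := by rw [hp1, hp2]
  rw [hc, e1, e2, e3, e4, e5, e6]
  ring

end Curvature

/-! ### The divergence in terms of the one-jets of the fields -/

section Divergence

variable {n m : ℕ}

lemma hasDerivAt_delta_add (R : Fin n → Fin n → ℝ) (a i : Fin n) :
    HasDerivAt (fun t : ℝ => delta a i + t * R a i) (R a i) 0 := by
  simpa using ((hasDerivAt_id (0 : ℝ)).mul_const (R a i)).const_add (delta a i)

/-- The infinitesimal action on bilinear forms of the linear coordinate changes `1 + tR`. -/
lemma hasDerivAt_pull2 (R w : Fin n → Fin n → ℝ) :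
    HasDerivAt (fun t : ℝ => pull2 (fun a i => delta a i + t * R a i) w)
      (fun i k => ∑ a, (w a k * R a i + w i a * R a k)) 0 := by
  refine hasDerivAt_pi.2 fun i => hasDerivAt_pi.2 fun k => ?_
  have h := HasDerivAt.fun_sum (u := Finset.univ) fun a _ =>
    HasDerivAt.fun_sum (u := Finset.univ) fun b _ =>
      ((hasDerivAt_delta_add R a i).mul (hasDerivAt_delta_add R b k)).const_mul (w a b)
  refine h.congr_deriv ?_
  simp only [zero_mul, add_zero, mul_add, Finset.sum_add_distrib]
  congr 1
  · refine Finset.sum_congr rfl fun a _ => ?_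
    rw [← sum_mul_delta (fun b => w a b * R a i) k]
    exact Finset.sum_congr rfl fun b _ => by ring
  · rw [Finset.sum_comm]
    refine Finset.sum_congr rfl fun b _ => ?_
    rw [← sum_mul_delta (fun a => w a b * R b k) i]
    exact Finset.sum_congr rfl fun a _ => by ring

/-- The infinitesimal action on tensors with `m + 1` indices. -/
lemma hasDerivAt_pullDY (R : Fin n → Fin n → ℝ) (y' : (Fin m → Fin n) → Fin n → ℝ)
    (I : Fin m → Fin n) (l : Fin n) :
    HasDerivAt (fun t : ℝ => pullDY (fun a i => delta a i + t * R a i) y' I l)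
      (∑ b, y' I b * R b l + ∑ a, ∑ k, R k (I a) * y' (Function.update I a k) l) 0 := by
  have h := HasDerivAt.fun_sum (u := Finset.univ) fun (A : Fin m → Fin n) _ =>
    (HasDerivAt.fun_sum (u := Finset.univ) fun b _ =>
      (hasDerivAt_delta_add R b l).const_mul (y' A b)).mul
    (HasDerivAt.fun_finsetProd (u := Finset.univ) fun a _ => hasDerivAt_delta_add R (A a) (I a))
  refine h.congr_deriv ?_
  simp only [zero_mul, add_zero, Finset.sum_add_distrib, sum_mul_delta, smul_eq_mul]
  congr 1
  · exact sum_mul_prod_delta I fun A => ∑ b, y' A b * R b l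
  · simp only [Finset.mul_sum]
    rw [Finset.sum_comm]
    refine Finset.sum_congr rfl fun a _ => ?_
    rw [Finset.sum_congr rfl fun A _ => show y' A l * ((∏ c ∈ Finset.univ.erase a,
        delta (A c) (I c)) * R (A a) (I a)) = (y' A l * R (A a) (I a)) *
          ∏ c ∈ Finset.univ.erase a, delta (A c) (I c) by ring,
      sum_mul_prod_erase_delta a I fun A => y' A l * R (A a) (I a)]
    refine Finset.sum_congr rfl fun k _ => ?_
    rw [Function.update_self, mul_comm]

lemma hasDerivAt_det_delta_add (R : Fin n → Fin n → ℝ) :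
    HasDerivAt (fun t : ℝ => (Matrix.of fun a i => delta a i + t * R a i).det)
      (∑ a, R a a) 0 := by
  obtain ⟨p, hp⟩ : ∃ p : Polynomial ℝ, ∀ t : ℝ,
      (Matrix.of fun a i => delta a i + t * R a i).det = 1 + (∑ a, R a a) * t + p.eval t * t ^ 2 := by
    refine ⟨((1 : Matrix (Fin n) (Fin n) (Polynomial ℝ)) + (Polynomial.X : Polynomial ℝ) •
      (Matrix.of R).map (Polynomial.C : ℝ →+* Polynomial ℝ)).det.divX.divX, fun t => ?_⟩
    have h2 : (Matrix.of fun a i => delta a i + t * R a i) = 1 + t • Matrix.of R := by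
      ext a i
      simp [delta, Matrix.one_apply]
    rw [h2, Matrix.det_one_add_smul]
    rfl
  simp only [hp]
  have h3 := (((hasDerivAt_id (0 : ℝ)).const_mul (∑ a, R a a)).const_add 1).add
    ((p.hasDerivAt (0 : ℝ)).mul (hasDerivAt_pow 2 (0 : ℝ)))
  refine h3.congr_deriv ?_
  simp

lemma det_delta_add_zero (R : Fin n → Fin n → ℝ) :
    (Matrix.of fun a i => delta a i + (0 : ℝ) * R a i).det = 1 := by
  simp only [zero_mul, add_zero]
  exact det_delta

/-- `√|det w|`. -/
noncomputable def density (w : Fin n → Fin n → ℝ) : ℝ := Real.sqrt |(Matrix.of w).det|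

lemma density_pull2 (S w : Fin n → Fin n → ℝ) :
    density (pull2 S w) = |(Matrix.of S).det| * density w := by
  rw [density, of_pull2, Matrix.det_mul, Matrix.det_mul, Matrix.det_transpose, abs_mul, abs_mul,
    show |(Matrix.of S).det| * |(Matrix.of w).det| * |(Matrix.of S).det|
      = |(Matrix.of S).det| ^ 2 * |(Matrix.of w).det| by ring, Real.sqrt_mul (by positivity),
    Real.sqrt_sq (abs_nonneg _), density]

lemma differentiableAt_density {w : Fin n → Fin n → ℝ} (hw : (Matrix.of w).det ≠ 0) :
    DifferentiableAt ℝ density w := by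
  have h1 : DifferentiableAt ℝ (fun w : Fin n → Fin n → ℝ => (Matrix.of w).det) w := by
    simp only [Matrix.det_apply', Matrix.of_apply]
    fun_prop
  exact (h1.abs hw).sqrt (abs_ne_zero.2 hw)

/-- The derivative of the density in the direction of the infinitesimal action of `R` is
`tr R` times the density. For `R^a_i = Γ^a_ik` this is the derivative of `√|det g|` along `x^k`. -/
lemma fderiv_density {w : Fin n → Fin n → ℝ} (hw : (Matrix.of w).det ≠ 0)
    (R : Fin n → Fin n → ℝ) :
    fderiv ℝ density w (fun i k => ∑ a, (w a k * R a i + w i a * R a k))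
      = (∑ a, R a a) * density w := by
  have h0 : pull2 (fun a i => delta a i + (0 : ℝ) * R a i) w = w := by
    simp only [zero_mul, add_zero]
    exact pull2_delta w
  have h1 : HasDerivAt (fun t : ℝ => density (pull2 (fun a i => delta a i + t * R a i) w))
      (fderiv ℝ density w (fun i k => ∑ a, (w a k * R a i + w i a * R a k))) 0 :=
    HasFDerivAt.comp_hasDerivAt (l := density) (0 : ℝ) (by
      rw [h0]; exact (differentiableAt_density hw).hasFDerivAt) (hasDerivAt_pull2 R w)
  have hd := hasDerivAt_det_delta_add R
  have h2 : (fun t : ℝ => density (pull2 (fun a i => delta a i + t * R a i) w))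
      =ᶠ[nhds 0] fun t => (Matrix.of fun a i => delta a i + t * R a i).det * density w := by
    have hpos : ∀ᶠ t in nhds (0 : ℝ), 0 < (Matrix.of fun a i => delta a i + t * R a i).det := by
      refine hd.continuousAt.eventually (lt_mem_nhds ?_)
      change 0 < (Matrix.of fun a i => delta a i + (0 : ℝ) * R a i).det
      rw [det_delta_add_zero]
      exact one_pos
    filter_upwards [hpos] with t ht
    rw [density_pull2, abs_of_pos ht]
  exact (h1.congr_of_eventuallyEq h2.symm).unique (hd.mul_const _)

variable {L : JetSpace n m → ℝ}

/-- The tensor whose component with indices `I, j` is `1` and whose other components vanish. -/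
def unitDY (I : Fin m → Fin n) (j : Fin n) : (Fin m → Fin n) → Fin n → ℝ :=
  Pi.single I (Pi.single j 1)

lemma linPart_inclDY_eq_sum (L : JetSpace n m → ℝ) (w : Fin n → Fin n → ℝ)
    (y' : (Fin m → Fin n) → Fin n → ℝ) :
    linPart L w (inclDY y') = ∑ I, ∑ j, linPart L w (inclDY (unitDY I j)) * y' I j := by
  let f : ((Fin m → Fin n) → Fin n → ℝ) →ₗ[ℝ] ℝ :=
    { toFun := fun y' => linPart L w (inclDY y')
      map_add' := fun a b => by rw [inclDY_add, linPart_add]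
      map_smul' := fun t a => by rw [inclDY_smul, linPart_smul]; rfl }
  have h : y' = ∑ I, ∑ j, y' I j • unitDY I j := by
    funext I j
    simp [Finset.sum_apply, unitDY, Pi.single_apply, ite_apply]
  change f y' = ∑ I, ∑ j, f (unitDY I j) * y' I j
  conv_lhs => rw [h]
  simp only [map_sum, map_smul, smul_eq_mul, mul_comm]

/-- The infinitesimal form of the equivariance of the coefficients `β^Ij`. -/
lemma sum_fderiv_linPart_inclDY (hL : ContDiffOn ℝ ∞ L (jetDomain n m))
    (hquad : IsQuadraticInDerivatives L) (hinv : IsCoordinateInvariant.{u} L)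
    {w : Fin n → Fin n → ℝ} (hw : IsLorentzForm w) (R : Fin n → Fin n → ℝ)
    (y' : (Fin m → Fin n) → Fin n → ℝ) :
    ∑ I, ∑ l, (fderiv ℝ (fun w => linPart L w (inclDY (unitDY I l))) w
        (fun i k => ∑ a, (w a k * R a i + w i a * R a k)) * y' I l
      + linPart L w (inclDY (unitDY I l)) *
        (∑ b, y' I b * R b l + ∑ a, ∑ k, R k (I a) * y' (Function.update I a k) l)) = 0 := by
  have h0 : pull2 (fun a i => delta a i + (0 : ℝ) * R a i) w = w := by
    simp only [zero_mul, add_zero]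
    exact pull2_delta w
  have h0' : pullDY (fun a i => delta a i + (0 : ℝ) * R a i) y' = y' := by
    simp only [zero_mul, add_zero]
    funext I l
    rw [pullDY, sum_mul_prod_delta I fun A => ∑ b, y' A b * delta b l, sum_mul_delta]
  have h1 : ∀ I l, HasDerivAt (fun t : ℝ => linPart L
      (pull2 (fun a i => delta a i + t * R a i) w) (inclDY (unitDY I l)))
      (fderiv ℝ (fun w => linPart L w (inclDY (unitDY I l))) w
        (fun i k => ∑ a, (w a k * R a i + w i a * R a k))) 0 := fun I l => by
    refine HasFDerivAt.comp_hasDerivAt (l := fun w => linPart L w (inclDY (unitDY I l)))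
      (0 : ℝ) ?_ (hasDerivAt_pull2 R w)
    rw [h0]
    exact (((contDiffOn_linPart hL (inclDY (unitDY I l))).contDiffAt
      (isOpen_nondegenerate.mem_nhds hw.det_ne_zero)).differentiableAt (by simp)).hasFDerivAt
  have h2 := HasDerivAt.fun_sum (u := Finset.univ) fun (I : Fin m → Fin n) _ =>
    HasDerivAt.fun_sum (u := Finset.univ) fun l _ => (h1 I l).mul (hasDerivAt_pullDY R y' I l)
  have h3 : (fun t : ℝ => ∑ I, ∑ l, linPart L (pull2 (fun a i => delta a i + t * R a i) w)
      (inclDY (unitDY I l)) * pullDY (fun a i => delta a i + t * R a i) y' I l)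
      =ᶠ[nhds 0] fun _ => linPart L w (inclDY y') := by
    have hne : ∀ᶠ t in nhds (0 : ℝ), (Matrix.of fun a i => delta a i + t * R a i).det ≠ 0 := by
      refine (hasDerivAt_det_delta_add R).continuousAt.eventually_ne ?_
      rw [det_delta_add_zero]
      exact one_ne_zero
    filter_upwards [hne] with t ht
    rw [← linPart_inclDY_eq_sum, linPart_pullDY hL hquad hinv hw ht]
  have h4 := (h2.congr_of_eventuallyEq h3.symm).unique (hasDerivAt_const (0 : ℝ) _)
  rw [← h4]
  refine Finset.sum_congr rfl fun I _ => Finset.sum_congr rfl fun l _ => ?_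
  rw [h0, h0']

variable {M : Type*} [TopologicalSpace M] [ChartedSpace (E n) M] [IsManifold (𝓡 n) ∞ M]
  {e : OpenPartialHomeomorph M (E n)} {g : TensorField n 2 M} {x : E n}

/-- The chain rule for functions of the metric. -/
lemma hasPartialAt_comp_metricComp (he : e ∈ charts n M) (hg : IsLorentzMetric g)
    (hx : x ∈ e.target) {F : (Fin n → Fin n → ℝ) → ℝ}
    (hF : DifferentiableAt ℝ F (metricComp e g x)) (j : Fin n) :
    HasPartialAt j (fun y => F (metricComp e g y)) (fderiv ℝ F (metricComp e g x) fun i k =>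
      ∑ a, (metricComp e g x a k * christoffel e g a i j x
        + metricComp e g x i a * christoffel e g a k j x)) x := by
  have hd : ∀ i k, DifferentiableAt ℝ (fun y => metricComp e g y i k) x := fun i k =>
    (contDiffAt_metricComp he hg hx i k).differentiableAt (by simp)
  have h1 : HasFDerivAt (metricComp e g) (ContinuousLinearMap.pi fun i =>
      ContinuousLinearMap.pi fun k => fderiv ℝ (fun y => metricComp e g y i k) x) x :=
    hasFDerivAt_pi.2 fun i => hasFDerivAt_pi.2 fun k => (hd i k).hasFDerivAt
  have h2 := hF.hasFDerivAt.comp x h1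
  refine ⟨h2.differentiableAt, ?_⟩
  have h3 : fderiv ℝ (fun y => F (metricComp e g y)) x = _ := h2.fderiv
  rw [partialD, h3, ContinuousLinearMap.comp_apply]
  congr 1
  funext i k
  exact partialD_metricComp_eq he hg hx i k j

/-- The divergence of the vector field with components `β^Ij D_I` is the contraction of `β` with
the covariant derivative of `D`, because `β` is parallel. -/
lemma divergence_eq (hL : ContDiffOn ℝ ∞ L (jetDomain n m))
    (hquad : IsQuadraticInDerivatives L) (hinv : IsCoordinateInvariant.{u} L)
    (he : e ∈ charts n M) (hg : IsLorentzMetric g) {D : TensorField n m M} (hD : IsSmooth D)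
    (hx : x ∈ e.target) {X : VectorField n M}
    (hX : ∀ y ∈ e.target, ∀ j, vecComp e X j y = ∑ I, linPart L (metricComp e g y)
      (inclDY (unitDY I j)) * tensorComp e D I y) :
    divergence e g X x = linPart L (metricComp e g x)
      (inclDY ((fun I j => partialD j (tensorComp e D I) x)
        - shiftY (fun a i j => christoffel e g a i j x) fun I => tensorComp e D I x)) := by
  have hw := isLorentzForm_metricComp he hg hx
  let w := metricComp e g x
  let y : (Fin m → Fin n) → ℝ := fun I => tensorComp e D I x
  let wdot : Fin n → Fin n → Fin n → ℝ := fun j i k => ∑ a, (metricComp e g x a k *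
    christoffel e g a i j x + metricComp e g x i a * christoffel e g a k j x)
  let β : (Fin m → Fin n) → Fin n → (Fin n → Fin n → ℝ) → ℝ := fun I j w =>
    linPart L w (inclDY (unitDY I j))
  have hρ0 : volDensity e g x ≠ 0 :=
    (Real.sqrt_pos.2 (abs_pos.2 hw.det_ne_zero)).ne'
  have hβd : ∀ I j, DifferentiableAt ℝ (β I j) w := fun I j =>
    ((contDiffOn_linPart hL (inclDY (unitDY I j))).contDiffAt
      (isOpen_nondegenerate.mem_nhds hw.det_ne_zero)).differentiableAt (by simp)
  have hDd : ∀ I, DifferentiableAt ℝ (tensorComp e D I) x := fun I =>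
    ((contDiffOn_tensorComp he hD I).contDiffAt (e.open_target.mem_nhds hx)).differentiableAt
      (by simp)
  have hpart : ∀ j, partialD j (fun y => volDensity e g y * vecComp e X j y) x
      = volDensity e g x * ((∑ a, christoffel e g a a j x) * ∑ I, β I j w * y I
        + ∑ I, (fderiv ℝ (β I j) w (wdot j) * y I
          + β I j w * partialD j (tensorComp e D I) x)) := by
    intro j
    have h1 : HasPartialAt j (fun y => volDensity e g y) _ x :=
      hasPartialAt_comp_metricComp he hg hx (differentiableAt_density hw.det_ne_zero) j
    have h2 : HasPartialAt j (fun y => ∑ I, β I j (metricComp e g y) * tensorComp e D I y) _ x :=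
      HasPartialAt.sum fun I _ => (hasPartialAt_comp_metricComp he hg hx (hβd I j) j).mul
        ⟨hDd I, rfl⟩
    have h3 : (fun y => volDensity e g y * vecComp e X j y) =ᶠ[nhds x] fun y =>
        volDensity e g y * ∑ I, β I j (metricComp e g y) * tensorComp e D I y := by
      filter_upwards [e.open_target.mem_nhds hx] with z hz
      rw [hX z hz]
    rw [(partialD_congr h3 j).eq_of_nhds, (h1.mul h2).eq, fderiv_density hw.det_ne_zero]
    change (∑ a, christoffel e g a a j x) * volDensity e g x * _ + _ = _
    ring
  -- The equivariance of `β` under `R = Γ_j`, applied to the tensor with components `y_I δ_lj`.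
  have hequi : ∀ j, ∑ I, (fderiv ℝ (β I j) w (wdot j) * y I)
      + ∑ I, ∑ l, β I l w * (y I * christoffel e g j l j x)
      + ∑ I, β I j w * ∑ a, ∑ k, christoffel e g k (I a) j x * y (Function.update I a k) = 0 := by
    intro j
    have h := sum_fderiv_linPart_inclDY hL hquad hinv hw (fun a i => christoffel e g a i j x)
      (fun I l => y I * delta l j)
    rw [← h, ← Finset.sum_add_distrib, ← Finset.sum_add_distrib]
    refine Finset.sum_congr rfl fun I _ => ?_
    have h1 : ∀ l, fderiv ℝ (β I l) w (wdot j) * (y I * delta l j) + β I l w *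
        (∑ b, y I * delta b j * christoffel e g b l j x
          + ∑ a, ∑ k, christoffel e g k (I a) j x * (y (Function.update I a k) * delta l j))
        = (fderiv ℝ (β I l) w (wdot j) * y I) * delta l j
          + β I l w * (y I * christoffel e g j l j x)
          + (β I l w * ∑ a, ∑ k, christoffel e g k (I a) j x * y (Function.update I a k))
            * delta l j := by
      intro l
      have h2 : ∑ b, y I * delta b j * christoffel e g b l j x
          = y I * christoffel e g j l j x := by
        rw [← sum_mul_delta (fun b => y I * christoffel e g b l j x) j]
        exact Finset.sum_congr rfl fun b _ => by ring
      rw [h2]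
      simp only [← mul_assoc, ← Finset.sum_mul]
      ring
    refine Eq.trans ?_ (Finset.sum_congr rfl fun l _ => (h1 l).symm)
    rw [Finset.sum_add_distrib, Finset.sum_add_distrib, sum_mul_delta, sum_mul_delta]
  -- The trace of the vector index in `hequi` cancels the derivative of the density.
  rw [divergence, Finset.sum_congr rfl fun j _ => hpart j, ← Finset.mul_sum, ← mul_assoc,
    inv_mul_cancel₀ hρ0, one_mul, linPart_inclDY_eq_sum]
  have hsum : ∑ j, (∑ I, (fderiv ℝ (β I j) w (wdot j) * y I)
      + ∑ I, ∑ l, β I l w * (y I * christoffel e g j l j x)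
      + ∑ I, β I j w * ∑ a, ∑ k, christoffel e g k (I a) j x * y (Function.update I a k)) = 0 :=
    Finset.sum_eq_zero fun j _ => hequi j
  have htrace : ∑ j, ∑ I, ∑ l, β I l w * (y I * christoffel e g j l j x)
      = ∑ j, (∑ a, christoffel e g a a j x) * ∑ I, β I j w * y I := by
    simp only [Finset.sum_mul_sum]
    rw [Finset.sum_congr rfl fun j _ => Finset.sum_comm, Finset.sum_comm]
    refine Finset.sum_congr rfl fun l _ => Finset.sum_congr rfl fun j _ =>
      Finset.sum_congr rfl fun I _ => ?_
    rw [christoffel_symm e hg x j l j]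
    ring
  have hrhs : ∑ I, ∑ j, β I j w * (partialD j (tensorComp e D I) x
      - shiftY (fun a i j => christoffel e g a i j x) y I j)
      = ∑ j, ∑ I, β I j w * partialD j (tensorComp e D I) x - ∑ j, ∑ I, β I j w *
        ∑ a, ∑ k, christoffel e g k (I a) j x * y (Function.update I a k) := by
    rw [Finset.sum_comm, ← Finset.sum_sub_distrib]
    refine Finset.sum_congr rfl fun j _ => ?_
    rw [← Finset.sum_sub_distrib]
    exact Finset.sum_congr rfl fun I _ => by rw [← mul_sub]; rfl
  refine Eq.trans ?_ hrhs.symm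
  simp only [Finset.sum_add_distrib] at hsum ⊢
  rw [htrace] at hsum
  linarith

end Divergence

/-! ### Independence of the chart -/

section ChartIndependence

variable {n m : ℕ} {M : Type*} [TopologicalSpace M] [ChartedSpace (E n) M] [IsManifold (𝓡 n) ∞ M]
  {e e' : OpenPartialHomeomorph M (E n)} {g : TensorField n 2 M} {x : E n}

lemma metricComp_transition (he : e ∈ charts n M) (he' : e' ∈ charts n M)
    (g : TensorField n 2 M) (hx : x ∈ e.target) (hx' : e.symm x ∈ e'.source) :
    metricComp e g x
      = pull2 (jacobian (e' ∘ e.symm) x) (metricComp e' g (e' (e.symm x))) := by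
  funext i j
  rw [metricComp, tensorComp_transition he he' g _ hx hx', pull2, ← sum_fin_two_arrow]
  refine Finset.sum_congr rfl fun A _ => ?_
  have h : A = ![A 0, A 1] := by funext a; fin_cases a <;> rfl
  rw [Fin.prod_univ_two, metricComp, ← h]
  rfl

lemma det_jacobian_ne_zero (he : e ∈ charts n M) (he' : e' ∈ charts n M)
    (hg : IsLorentzMetric g) (hx : x ∈ e.target) (hx' : e.symm x ∈ e'.source) :
    (Matrix.of (jacobian (e' ∘ e.symm) x)).det ≠ 0 := by
  intro h0
  apply (isLorentzForm_metricComp he hg hx).det_ne_zero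
  rw [metricComp_transition he he' g hx hx', of_pull2, Matrix.det_mul, h0, mul_zero]

variable {L : JetSpace n m → ℝ} (hL : ContDiffOn ℝ ∞ L (jetDomain n m))
  (hquad : IsQuadraticInDerivatives L) (hinv : IsCoordinateInvariant.{u} L)

include hL hquad hinv

lemma linPart_inclY_transition (he : e ∈ charts n M) (he' : e' ∈ charts n M)
    (hg : IsLorentzMetric g) (D : TensorField n m M) {p : M} (hp : p ∈ e.source)
    (hp' : p ∈ e'.source) :
    linPart L (metricComp e g (e p)) (inclY fun I => tensorComp e D I (e p))
      = linPart L (metricComp e' g (e' p)) (inclY fun I => tensorComp e' D I (e' p)) := by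
  have hx := e.map_source hp
  have hx' : e.symm (e p) ∈ e'.source := by rwa [e.left_inv hp]
  have hD : (fun I => tensorComp e D I (e p)) = pullT (jacobian (e' ∘ e.symm) (e p))
      (fun A => tensorComp e' D A (e' (e.symm (e p)))) :=
    funext fun I => tensorComp_transition he he' D I hx hx'
  rw [metricComp_transition he he' g hx hx', hD, e.left_inv hp]
  exact linPart_pullT hL hquad hinv (isLorentzForm_metricComp he' hg (e'.map_source hp'))
    (det_jacobian_ne_zero he he' hg hx hx') _

lemma quadForm_inclY_transition (he : e ∈ charts n M) (he' : e' ∈ charts n M)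
    (hg : IsLorentzMetric g) (D : TensorField n m M) {p : M} (hp : p ∈ e.source)
    (hp' : p ∈ e'.source) :
    quadForm L (metricComp e g (e p)) (inclY fun I => tensorComp e D I (e p))
        (inclY fun I => tensorComp e D I (e p))
      = quadForm L (metricComp e' g (e' p)) (inclY fun I => tensorComp e' D I (e' p))
        (inclY fun I => tensorComp e' D I (e' p)) := by
  have hx := e.map_source hp
  have hx' : e.symm (e p) ∈ e'.source := by rwa [e.left_inv hp]
  have hD : (fun I => tensorComp e D I (e p)) = pullT (jacobian (e' ∘ e.symm) (e p))
      (fun A => tensorComp e' D A (e' (e.symm (e p)))) :=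
    funext fun I => tensorComp_transition he he' D I hx hx'
  rw [metricComp_transition he he' g hx hx', hD, e.left_inv hp]
  exact quadForm_pullT hL hquad hinv (isLorentzForm_metricComp he' hg (e'.map_source hp'))
    (det_jacobian_ne_zero he he' hg hx hx') _

/-- The components `β^Ij D_I` transform as those of a vector field. -/
lemma sum_linPart_inclDY_transition (he : e ∈ charts n M) (he' : e' ∈ charts n M)
    (hg : IsLorentzMetric g) (D : TensorField n m M) {p : M} (hp : p ∈ e.source)
    (hp' : p ∈ e'.source) (j : Fin n) :
    ∑ l, jacobian (e' ∘ e.symm) (e p) j l * ∑ I, linPart L (metricComp e g (e p))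
        (inclDY (unitDY I l)) * tensorComp e D I (e p)
      = ∑ I, linPart L (metricComp e' g (e' p)) (inclDY (unitDY I j))
        * tensorComp e' D I (e' p) := by
  have hx := e.map_source hp
  have hx' : e.symm (e p) ∈ e'.source := by rwa [e.left_inv hp]
  let T := jacobian (e' ∘ e.symm) (e p)
  let y' : (Fin m → Fin n) → Fin n → ℝ := fun I l => tensorComp e' D I (e' p) * delta l j
  have hD : ∀ I, tensorComp e D I (e p) = pullT T (fun A => tensorComp e' D A (e' p)) I := by
    intro I
    rw [tensorComp_transition he he' D I hx hx', e.left_inv hp]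
  have hy' : pullDY T y' = fun I l => tensorComp e D I (e p) * T j l := by
    funext I l
    rw [hD, pullT, pullDY, Finset.sum_mul]
    refine Finset.sum_congr rfl fun A _ => ?_
    rw [Finset.sum_congr rfl fun b _ => show y' A b * T b l
      = (tensorComp e' D A (e' p) * T b l) * delta b j by simp only [y']; ring,
      sum_mul_delta (fun b => tensorComp e' D A (e' p) * T b l)]
    ring
  have h := linPart_pullDY hL hquad hinv (isLorentzForm_metricComp he' hg (e'.map_source hp'))
    (det_jacobian_ne_zero he he' hg hx hx') y'
  have hw := metricComp_transition he he' g hx hx'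
  rw [e.left_inv hp] at hw
  rw [← hw, hy', linPart_inclDY_eq_sum, linPart_inclDY_eq_sum L _ y'] at h
  have hr : ∑ I, ∑ l, linPart L (metricComp e' g (e' p)) (inclDY (unitDY I l)) * y' I l
      = ∑ I, linPart L (metricComp e' g (e' p)) (inclDY (unitDY I j))
        * tensorComp e' D I (e' p) := by
    refine Finset.sum_congr rfl fun I _ => ?_
    rw [← sum_mul_delta (fun l => linPart L (metricComp e' g (e' p)) (inclDY (unitDY I l))
      * tensorComp e' D I (e' p)) j]
    exact Finset.sum_congr rfl fun l _ => by simp only [y']; ring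
  rw [← hr, ← h, Finset.sum_comm]
  refine Finset.sum_congr rfl fun l _ => ?_
  rw [Finset.mul_sum]
  exact Finset.sum_congr rfl fun I _ => by ring

/-- There is a vector field with components `β^Ij D_I` in every chart. -/
lemma exists_vectorField (hg : IsLorentzMetric g) (D : TensorField n m M) :
    ∃ X : VectorField n M, ∀ e ∈ charts n M, ∀ x ∈ e.target, ∀ j, vecComp e X j x
      = ∑ I, linPart L (metricComp e g x) (inclDY (unitDY I j)) * tensorComp e D I x := by
  let v : M → E n := fun p => ∑ l, (∑ I, linPart L (metricComp (chartAt (E n) p) g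
    (chartAt (E n) p p)) (inclDY (unitDY I l)) * tensorComp (chartAt (E n) p) D I
      (chartAt (E n) p p)) • basisVec l
  refine ⟨fun p => (mfderiv (𝓡 n) (𝓡 n) (chartAt (E n) p).symm (chartAt (E n) p p) :
    E n →L[ℝ] E n) (v p), fun e he x hx j => ?_⟩
  have hq := e.map_target hx
  have key : ∀ q : M, q ∈ e.source →
      EuclideanSpace.proj (𝕜 := ℝ) j ((mfderiv (𝓡 n) (𝓡 n) e q : E n →L[ℝ] E n) ((mfderiv (𝓡 n) (𝓡 n) (chartAt (E n) q).symm
        (chartAt (E n) q q) : E n →L[ℝ] E n) (v q)))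
      = ∑ I, linPart L (metricComp e g (e q)) (inclDY (unitDY I j)) * tensorComp e D I (e q) := by
    intro q hq
    have h0 : chartAt (E n) q ∈ charts n M := IsManifold.chart_mem_maximalAtlas q
    have hq0 : q ∈ (chartAt (E n) q).source := mem_chart_source (E n) q
    have h1 := mfderiv_chart_comp_symm h0 he ((chartAt (E n) q).map_source hq0)
      (by rwa [(chartAt (E n) q).left_inv hq0]) (v q)
    rw [(chartAt (E n) q).left_inv hq0] at h1
    rw [← sum_linPart_inclDY_transition hL hquad hinv h0 he hg D hq0 hq j]
    refine (congrArg (fun z : E n => z j) h1).trans ?_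
    rw [fderiv_apply_eq_mulVec]
    refine Finset.sum_congr rfl fun l _ => ?_
    congr 1
    simp [v, basisVec, Finset.sum_apply, Pi.single_apply]
  have := key (e.symm x) hq
  rw [e.right_inv hx] at this
  exact this

end ChartIndependence

/-! ### The coefficients as arrays of functions of the metric -/

section Conclusion

variable {n m : ℕ}

lemma linPart_inclY_eq_sum (L : JetSpace n m → ℝ) (w : Fin n → Fin n → ℝ)
    (y : (Fin m → Fin n) → ℝ) :
    linPart L w (inclY y) = ∑ I, linPart L w (inclY (Pi.single I 1)) * y I := by
  let f : ((Fin m → Fin n) → ℝ) →ₗ[ℝ] ℝ :=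
    { toFun := fun y => linPart L w (inclY y)
      map_add' := fun a b => by rw [inclY_add, linPart_add]
      map_smul' := fun t a => by rw [inclY_smul, linPart_smul]; rfl }
  have h : y = ∑ I, y I • (Pi.single I 1 : (Fin m → Fin n) → ℝ) := by
    funext J
    simp [Finset.sum_apply, Pi.single_apply]
  change f y = ∑ I, f (Pi.single I 1) * y I
  conv_lhs => rw [h]
  simp only [map_sum, map_smul, smul_eq_mul, mul_comm]

lemma quadForm_inclY_eq_sum (L : JetSpace n m → ℝ) (w : Fin n → Fin n → ℝ)
    (y : (Fin m → Fin n) → ℝ) :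
    quadForm L w (inclY y) (inclY y) = ∑ I, ∑ J,
      quadForm L w (inclY (Pi.single I 1)) (inclY (Pi.single J 1)) * y I * y J := by
  let B : ((Fin m → Fin n) → ℝ) →ₗ[ℝ] ((Fin m → Fin n) → ℝ) →ₗ[ℝ] ℝ :=
    LinearMap.mk₂ ℝ (fun u v => quadForm L w (inclY u) (inclY v))
      (fun u u' v => by rw [inclY_add, quadForm_add_left])
      (fun t u v => by rw [inclY_smul, quadForm_smul_left]; rfl)
      (fun u v v' => by rw [inclY_add, quadForm_add_right])
      (fun t u v => by rw [inclY_smul, quadForm_smul_right]; rfl)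
  have h : y = ∑ I, y I • (Pi.single I 1 : (Fin m → Fin n) → ℝ) := by
    funext J
    simp [Finset.sum_apply, Pi.single_apply]
  change B y y = ∑ I, ∑ J, B (Pi.single I 1) (Pi.single J 1) * y I * y J
  conv_lhs => rw [h]
  simp only [map_sum, map_smul, LinearMap.sum_apply, LinearMap.smul_apply, smul_eq_mul,
    Finset.mul_sum]
  rw [Finset.sum_comm]
  exact Finset.sum_congr rfl fun I _ => Finset.sum_congr rfl fun J _ => by ring

end Conclusion

end LorentzLagrangian

open LorentzLagrangian
theorem theorem3p1 (n m : ℕ) (hn : 1 ≤ n) (L : JetSpace n m → ℝ)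
    (hL : ContDiffOn ℝ ∞ L (jetDomain n m)) (hquad : IsQuadraticInDerivatives L)
    (hinv : IsCoordinateInvariant.{u} L) :
    ∃ (a b c : ℝ)
      (μ : (Fin m → Fin n) → (Fin m → Fin n) → (Fin n → Fin n → ℝ) → ℝ)
      (lam : (Fin m → Fin n) → (Fin n → Fin n → ℝ) → ℝ)
      (β : (Fin m → Fin n) → Fin n → (Fin n → Fin n → ℝ) → ℝ),
      (∀ I J, ContDiffOn ℝ ∞ (μ I J) (nondegenerate n)) ∧
      (∀ I, ContDiffOn ℝ ∞ (lam I) (nondegenerate n)) ∧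
      (∀ I j, ContDiffOn ℝ ∞ (β I j) (nondegenerate n)) ∧
      ∀ (M : Type u) [TopologicalSpace M] [T2Space M] [SecondCountableTopology M]
        [ChartedSpace (E n) M] [IsManifold (𝓡 n) ∞ M]
        (g : TensorField n 2 M) (D : TensorField n m M), IsLorentzMetric g → IsSmooth D →
        ∀ f : M → ℝ, Represents L g D f →
        ∃ (Q T : M → ℝ) (X : VectorField n M),
          ∀ e ∈ charts n M, ∀ p ∈ e.source,
            Q p = ∑ I, ∑ J, μ I J (metricComp e g (e p)) *
              tensorComp e D I (e p) * tensorComp e D J (e p) ∧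
            T p = ∑ I, lam I (metricComp e g (e p)) * tensorComp e D I (e p) ∧
            (∀ j, vecComp e X j (e p)
              = ∑ I, β I j (metricComp e g (e p)) * tensorComp e D I (e p)) ∧
            f p = a + b * scalarCurvature e g (e p) + c * normSqDAlt e g D (e p)
              + Q p + T p + divergence e g X (e p) := by
  obtain ⟨b, hb⟩ := exists_linPart_incl4_eq hL hquad hinv
  obtain ⟨c, hc⟩ := exists_quadForm_inclDY_eq hL hquad hinv
  -- `(m!)²` undoes the normalization of `γ`, which `alt` does not have.
  refine ⟨L (basePoint minkowski), b, c * (m.factorial : ℝ) ^ 2,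
    fun I J w => quadForm L w (inclY (Pi.single I 1)) (inclY (Pi.single J 1)),
    fun I w => linPart L w (inclY (Pi.single I 1)),
    fun I j w => linPart L w (inclDY (unitDY I j)),
    fun I J => contDiffOn_quadForm hL _ _, fun I => contDiffOn_linPart hL _,
    fun I j => contDiffOn_linPart hL _, ?_⟩
  intro M _ _ _ _ _ g D hg hD f hf
  obtain ⟨X, hX⟩ := exists_vectorField hL hquad hinv hg D
  refine ⟨fun p => quadForm L (metricComp (chartAt (E n) p) g (chartAt (E n) p p))
      (inclY fun I => tensorComp (chartAt (E n) p) D I (chartAt (E n) p p))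
      (inclY fun I => tensorComp (chartAt (E n) p) D I (chartAt (E n) p p)),
    fun p => linPart L (metricComp (chartAt (E n) p) g (chartAt (E n) p p))
      (inclY fun I => tensorComp (chartAt (E n) p) D I (chartAt (E n) p p)), X,
    fun e he p hp => ?_⟩
  have h0 : chartAt (E n) p ∈ charts n M := IsManifold.chart_mem_maximalAtlas p
  have hp0 : p ∈ (chartAt (E n) p).source := mem_chart_source (E n) p
  have hx := e.map_source hp
  have hw := isLorentzForm_metricComp he hg hx
  have hwh := sum_metricComp_mul_metricInv he hg hx
  have hQ := quadForm_inclY_transition hL hquad hinv h0 he hg D hp0 hp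
  have hT := linPart_inclY_transition hL hquad hinv h0 he hg D hp0 hp
  refine ⟨hQ.trans (quadForm_inclY_eq_sum L _ _), hT.trans (linPart_inclY_eq_sum L _ _),
    hX e he _ hx, ?_⟩
  have hconst : L (basePoint (metricComp e g (e p))) = L (basePoint minkowski) := by
    obtain ⟨R, hR, hRw, -⟩ := exists_normalize hw hwh
    rw [← hRw, eq_const_pull2 hL hquad hinv hw hR]
  let w4 : Fin n → Fin n → Fin n → Fin n → ℝ := fun i j k l =>
    partialD l (partialD k (fun y => metricComp e g y i j)) (e p)
  have hw4 : ∀ i j k l, w4 i j k l = w4 j i k l := fun i j k l => by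
    simp only [w4, metricComp_symm e hg _ i j]
  have hw4' : ∀ i j k l, w4 i j k l = w4 i j l k := fun i j k l =>
    partialD_comm (contDiffAt_metricComp he hg hx i j) k l
  have hΓ : ∀ a i j, christoffel e g a i j (e p) = christoffel e g a j i (e p) :=
    fun a i j => christoffel_symm e hg _ a i j
  have hjet : jet e g D (e p) = (metricComp e g (e p), shift3 (metricComp e g (e p))
      (fun a i j => christoffel e g a i j (e p)), w4, fun I => tensorComp e D I (e p),
      fun I j => partialD j (tensorComp e D I) (e p)) := by
    have h3 : (fun i j k => partialD k (fun y => metricComp e g y i j) (e p))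
        = shift3 (metricComp e g (e p)) (fun a i j => christoffel e g a i j (e p)) :=
      funext fun i => funext fun j => funext fun k => partialD_metricComp_eq he hg hx i j k
    rw [← h3]
    rfl
  have hfac : (m.factorial : ℝ) ≠ 0 := by exact_mod_cast m.factorial_ne_zero
  have hc2 : c * (m.factorial : ℝ) ^ 2 * normSqDAlt e g D (e p) = quadForm L (metricComp e g (e p))
      (inclDY fun I j => partialD j (tensorComp e D I) (e p))
      (inclDY fun I j => partialD j (tensorComp e D I) (e p)) := by
    rw [hc _ _ hw hwh, normSqDAlt_eq he g hD hx]
    field_simp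
  have hs4 := shiftQQ_swap_left hw.symm fun a i j => christoffel e g a i j (e p)
  have hs4' := shiftQQ_swap_right (metricComp e g (e p)) fun a i j => christoffel e g a i j (e p)
  have hR : b * scalarCurvature e g (e p) = linPart L (metricComp e g (e p))
      (incl4 (w4 - shiftQQ (metricComp e g (e p)) (fun a i j => christoffel e g a i j (e p))
        fun a i j => christoffel e g a i j (e p))) := by
    rw [scalarCurvature_eq he hg hx]
    exact (hb _ _ hw hwh _ (fun i j k l => congrArg₂ (· - ·) (hw4 i j k l) (hs4 i j k l))
      (fun i j k l => congrArg₂ (· - ·) (hw4' i j k l) (hs4' i j k l))).symm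
  change _ = _ + _ + _ + quadForm L _ _ _ + linPart L _ _ + _
  rw [hQ, hT, hc2, divergence_eq hL hquad hinv he hg hD hx (hX e he),
    hR, ← hconst, ← hf.eq e he p hp, hjet,
    eq_normalForm_shift hL hquad hinv hw hΓ hw4 hw4']
  ring
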